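/- **Setting.** $\Lambda$ is the set of $\lambda$-terms, with size $|x|=1$, $|\lambda x.t|=|t|+1$, $|tu|=|t|+|u|$; values are variables and abstractions. Weak call-by-value reduction is generated by $(\lambda x.t)v\to t[v/x]$ ($v$ a value) and is closed under both sides of application (not under $\lambda$). A step $t\to u$ costs $\max\{|u|-|t|,1\}$; $t\Downarrow$ means that $t$ reduces to a value, $Time(t)$ is the (unique) total cost of doing so, and $TS(t)=Time(t)+|t|$. Write $t\langle u_1/x_1,\dots,u_n/x_n\rangle=(\lambda x_1\cdots x_n.t)u_1\cdots u_n$ ($x_i$ distinct), and let $\theta,\xi$ range over lists of bindings $u/x$. *Formulas.* Linear formulas: $L,M::=\alpha\mid\forall\alpha L\mid\mu\alpha L\mid L\multimap M$, where $\mu\alpha L$ requires that $\alpha$ occurs only positively in $L$. Formulas: $A,B::=L\mid\forall\alpha A\mid L\multimap B\mid A\Rightarrow B$. *The system DIAL.* In a judgment $\Gamma;\Delta\vdash t:A$ the contexts are unordered, all declared variables are distinct, and $\Delta$ contains only linear formulas. Axioms: $x:A;\vdash x:A$ and $;x:L\vdash x:L$. Rules: - from $\Gamma;\Delta\vdash t:\mu\alpha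 L$ infer $\Gamma;\Delta\vdash t:L[\mu\alpha L/\alpha]$, and conversely; - from $\Gamma;\Delta\vdash t:A$ with $\alpha$ not free in $\Gamma;\Delta$ infer $\Gamma;\Delta\vdash t:\forall\alpha A$; from $\Gamma;\Delta\vdash t:\forall\alpha A$ infer $\Gamma;\Delta\vdash t:A[L/\alpha]$; - from $\Gamma_1;\Delta\vdash t:A\Rightarrow B$ and $\Gamma_2;\vdash u:A$ infer $\Gamma_1,\Gamma_2;\Delta\vdash tu:B$; from $\Gamma,z:A;\Delta\vdash t:B$ infer $\Gamma;\Delta\vdash\lambda z.t:A\Rightarrow B$; - from $\Gamma_1;\Delta_1\vdash t:L\multimap B$ and $\Gamma_2;\Delta_2\vdash u:L$ infer $\Gamma_1,\Gamma_2;\Delta_1,\Delta_2\vdash tu:B$; from $\Gamma;\Delta,z:L\vdash t:B$ infer $\Gamma;\Delta\vdash\lambda z.t:L\multimap B$; - from $\Gamma,x:A,y:A;\Delta\vdash t:B$ infer $\Gamma,z:A;\Delta\vdash t[z/x,z/y]:B$; from $\Gamma;\Delta,x:L\vdash t:B$ infer $\Gamma,x:L;\Delta\vdash t:B$; from $\Gamma;\Delta\vdash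 t:B$ infer $\Gamma,\Gamma';\Delta,\Delta'\vdash t:B$. *Higher order (additive) polynomials* are the simply typed $\lambda$-terms over one base type $o$, with constants $n:o$ ($n\in\mathbb N$) and $+:o\to o\to o$, identified up to $\alpha\beta\eta$-equivalence and the laws of addition (commutative monoid, and $m+n$ computed in $\mathbb N$). For $\tau=\tau_1\to\cdots\to\tau_k\to o$, $p:\tau$ and $q:o$ put $p+q=\lambda x_1\cdots x_k.(p\,x_1\cdots x_k+q)$, $0_\tau=\lambda x_1\cdots x_k.0$ and $\downarrow p=p\,0_{\tau_1}\cdots0_{\tau_k}:o$; for closed $p$, $\downarrow p$ is a natural number. Put $o(L)=o$ for linear $L$, $o(L\multimap A)=o(A)$, $o(\forall\alpha A)=o(A)$, $o(A\Rightarrow B)=o(A)\to o(B)$. *Saturated sets.* A (possibly empty) set $X$ of pairs $(t,p)$, with $t\in\Lambda$ and $p$ a closed polynomial of type $\tau$, is saturated of type $\tau$ if for all $(t,p)\in X$: $t\Downarrow$ and $TS(t)\le\downarrow p$; $(t,p+n)\in X$ for all $n\in\mathbb N$; and, for all terms $t_0,t_1$ and lists $\vec u$ of terms, - if $t=t_0\langle\theta,v_1/y_1,v_2/y_2,\xi\rangle\vec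 u$ then $(t_0\langle\theta,v_2/y_2,v_1/y_1,\xi\rangle\vec u,\,p)\in X$; - if $t=t_0\langle\theta\rangle\vec u$, $z\notin FV(t_0)$, $z$ is not bound in $\theta$ and $w\Downarrow$, then $(t_0\langle\theta,w/z\rangle\vec u,\,p+TS(w)+2)\in X$; - if $t=t_0\langle\theta,w/z_1,w/z_2\rangle\vec u$, and $z$ is not bound in $\theta$ and not free in $t_0$ unless it is $z_1$ or $z_2$, then $(t_0[z/z_1,z/z_2]\langle\theta,w/z\rangle\vec u,\,p)\in X$; - if $t=(t_0\langle\theta\rangle)(t_1\langle\xi\rangle)\vec u$, the variables of $\theta$ and $\xi$ are distinct, those of $\theta$ are not free in $t_1$ and those of $\xi$ are not free in $t_0$, then $((t_0t_1)\langle\theta,\xi\rangle\vec u,\,p)\in X$; - if $t=t_0\vec u$ then $((x\langle t_0/x\rangle)\vec u,\,p+3)\in X$ for every variable $x$. *Realizability.* A valuation $\eta$ maps propositional variables to saturated sets of type $o$. For $t\in\Lambda$ and a closed polynomial $p:o(A)$, define $t,p\Vdash_\eta A$ by recursion on $A$: - $t,n\Vdash_\eta\alpha$ iff $(t,n)\in\eta(\alpha)$;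 - $t,p\Vdash_\eta L\multimap A$ iff $t\Downarrow$, $TS(t)\le\downarrow p$, and $u,m\Vdash_\eta L$ implies $tu,\,p+m\Vdash_\eta A$ for all $u,m$; - $t,p\Vdash_\eta B\Rightarrow A$ iff $t\Downarrow$, $TS(t)\le\downarrow p$, and $u,q\Vdash_\eta B$ implies $tu,\,p(q)\Vdash_\eta A$ for all $u,q$; - $t,p\Vdash_\eta\forall\alpha A$ iff $t,p\Vdash_{\eta\{\alpha\leftarrow X\}}A$ for every saturated set $X$ of type $o$; - $t,p\Vdash_\eta\mu\alpha L$ iff $(t,p)\in X$ for every saturated set $X$ of type $o$ with $\{(u,q):u,q\Vdash_{\eta\{\alpha\leftarrow X\}}L\}\subseteq X$. **Theorem (Adequacy).** Suppose that $x_1:C_1,\dots,x_a:C_a;\ y_1:M_1,\dots,y_b:M_b\vdash t:A$ is derivable in DIAL. Then there is a higher order polynomial $p(x_1,\dots,x_a):o(A)$ in variables $x_i$ of type $o(C_i)$ such that: 1. for every valuation $\eta$, all terms $u_i,s_j$, all closed polynomials $q_i:o(C_i)$ and $m_j:o$, if $u_i,q_i\Vdash_\eta C_i$ for all $i\le a$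 and $s_j,m_j\Vdash_\eta M_j$ for all $j\le b$, then $$t\langle u_1/x_1,\dots,u_a/x_a,s_1/y_1,\dots,s_b/y_b\rangle,\quad p(q_1,\dots,q_a)+m_1+\cdots+m_b\ \Vdash_\eta\ A;$$ 2. if each $x_i$ occurs $c_i$ times in $t$, then for all closed polynomials $q_i:o(C_i)$ $$|t|+c_1\downarrow q_1+\cdots+c_a\downarrow q_a\ \le\ \downarrow p(q_1,\dots,q_a).$$ -/

import Mathlib

namespace DIAL

/-! ## The weak call-by-value lambda calculus with its time measure -/

/-- Lambda terms modulo `α`-equivalence. The variables are the natural numbers; a free occurrence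
of the variable `x` that lies under `d` abstractions is written `var (x + d)`, and the indices below
`d` are the bound ones. -/
inductive LTerm : Type
  | var (n : ℕ)
  | lam (t : LTerm)
  | app (t u : LTerm)

namespace LTerm

/-- Lifts a renaming under a binder. -/
def upRen (ρ : ℕ → ℕ) : ℕ → ℕ
  | 0 => 0
  | n + 1 => ρ n + 1

/-- Capture-avoiding renaming of the free variables. -/
def rename : (ℕ → ℕ) → LTerm → LTerm
  | ρ, var n => var (ρ n)
  | ρ, lam t => lam (rename (upRen ρ) t)
  | ρ, app t u => app (rename ρ t) (rename ρ u)

/-- Lifts a substitution under a binder. -/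
def upSub (s : ℕ → LTerm) : ℕ → LTerm
  | 0 => var 0
  | n + 1 => rename Nat.succ (s n)

/-- Capture-avoiding simultaneous substitution for the free variables. -/
def subst : (ℕ → LTerm) → LTerm → LTerm
  | s, var n => s n
  | s, lam t => lam (subst (upSub s) t)
  | s, app t u => app (subst s t) (subst s u)

/-- `b.inst v` replaces the variable bound by the abstraction `lam b` by `v`. -/
def inst (b v : LTerm) : LTerm :=
  subst (fun n => match n with
    | 0 => v
    | k + 1 => var k) b

/-- `abs x t` is the abstraction `λ x. t` of the variable `x`. -/
def abs (x : ℕ) (t : LTerm) : LTerm :=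
  lam (rename (fun y => if y = x then 0 else y + 1) t)

/-- The number of free occurrences of the variable `x`. -/
def occ : ℕ → LTerm → ℕ
  | x, var y => if y = x then 1 else 0
  | x, lam t => occ (x + 1) t
  | x, app t u => occ x t + occ x u

/-- The set of free variables. -/
def FV (t : LTerm) : Set ℕ := {x | occ x t ≠ 0}

/-- The size `|t|`. -/
def size : LTerm → ℕ
  | var _ => 1
  | lam t => size t + 1
  | app t u => size t + size u

/-- Values are the variables and the abstractions. -/
inductive IsValue : LTerm → Prop
  | var (n : ℕ) : IsValue (var n)
  | lam (t : LTerm) : IsValue (lam t)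

/-- Weak call-by-value reduction. -/
inductive Step : LTerm → LTerm → Prop
  | beta {b v : LTerm} : IsValue v → Step (app (lam b) v) (b.inst v)
  | left {t t' u : LTerm} : Step t t' → Step (app t u) (app t' u)
  | right {u t t' : LTerm} : Step t t' → Step (app u t) (app u t')

/-- `CostRed t n u`: the term `t` reduces to `u` with cost `n`. (The natural-number subtraction is
harmless, because of the maximum with `1`.) -/
inductive CostRed : LTerm → ℕ → LTerm → Prop
  | refl (t : LTerm) : CostRed t 0 t
  | step {t u : LTerm} : Step t u → CostRed t (max (size u - size t) 1) u
  | trans {s t u : LTerm} {n m : ℕ} : CostRed s n t → CostRed t m u → CostRed s (n + m) u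

/-- `t ⇓`: the term `t` evaluates to a value. -/
def Evaluates (t : LTerm) : Prop := ∃ v, IsValue v ∧ Relation.ReflTransGen Step t v

/-- The cost of evaluating `t` to a value. The cost does not depend on the reduction sequence, so
the set below has exactly one element if `t ⇓`. Only used together with `Evaluates t`. -/
noncomputable def time (t : LTerm) : ℕ := sInf {n | ∃ v, IsValue v ∧ CostRed t n v}

/-- `TS(t) = Time(t) + |t|`. -/
noncomputable def TS (t : LTerm) : ℕ := time t + size t

/-- `λ x₁ ⋯ xₙ. t`. -/
def lams (xs : List ℕ) (t : LTerm) : LTerm := xs.foldr abs t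

/-- `t u₁ ⋯ uₙ`. -/
def apps (t : LTerm) (us : List LTerm) : LTerm := us.foldl app t

/-- `t⟨u₁/x₁, …, uₙ/xₙ⟩ = (λ x₁ ⋯ xₙ. t) u₁ ⋯ uₙ`, where `uᵢ/xᵢ` is the pair `(uᵢ, xᵢ)`. -/
def bind (t : LTerm) (θ : List (LTerm × ℕ)) : LTerm :=
  apps (lams (θ.map Prod.snd) t) (θ.map Prod.fst)

/-- `t[z/x, z/y]`. -/
def contract (t : LTerm) (z x y : ℕ) : LTerm :=
  rename (fun w => if w = x ∨ w = y then z else w) t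

end LTerm

/-! ## Formulas and typing -/

/-- Raw formulas, modulo renaming of bound propositional variables, with the same convention for
variables as in `LTerm`. The formulas of the system are those that satisfy `Formula.WF`. -/
inductive Formula : Type
  | var (α : ℕ)
  | all (A : Formula)
  | mu (L : Formula)
  | lolli (L B : Formula)
  | imp (A B : Formula)

namespace Formula

/-- Capture-avoiding renaming of the free propositional variables. -/
def rename : (ℕ → ℕ) → Formula → Formula
  | ρ, var n => var (ρ n)
  | ρ, all A => all (rename (LTerm.upRen ρ) A)
  | ρ, mu A => mu (rename (LTerm.upRen ρ) A)
  | ρ, lolli A B => lolli (rename ρ A) (rename ρ B)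
  | ρ, imp A B => imp (rename ρ A) (rename ρ B)

/-- Lifts a substitution under a binder. -/
def upSub (s : ℕ → Formula) : ℕ → Formula
  | 0 => var 0
  | n + 1 => rename Nat.succ (s n)

/-- Capture-avoiding simultaneous substitution for the free propositional variables. -/
def subst : (ℕ → Formula) → Formula → Formula
  | s, var n => s n
  | s, all A => all (subst (upSub s) A)
  | s, mu A => mu (subst (upSub s) A)
  | s, lolli A B => lolli (subst s A) (subst s B)
  | s, imp A B => imp (subst s A) (subst s B)

/-- `A.inst L` replaces the variable bound by `all A` or by `mu A` by `L`. -/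
def inst (A L : Formula) : Formula :=
  subst (fun n => match n with
    | 0 => L
    | k + 1 => var k) A

/-- `∀ α A` for the propositional variable `α`. -/
def forallVar (α : ℕ) (A : Formula) : Formula :=
  all (rename (fun β => if β = α then 0 else β + 1) A)

/-- `α` occurs free in the formula. -/
def Occurs : ℕ → Formula → Prop
  | α, var β => β = α
  | α, all A => Occurs (α + 1) A
  | α, mu A => Occurs (α + 1) A
  | α, lolli A B => Occurs α A ∨ Occurs α B
  | α, imp A B => Occurs α A ∨ Occurs α B

/-- `OccursOnly true α A`: `α` occurs only positively in `A`;
`OccursOnly false α A`: `α` occurs only negatively in `A`. -/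
def OccursOnly : Bool → ℕ → Formula → Prop
  | b, α, var β => β = α → b = true
  | b, α, all A => OccursOnly b (α + 1) A
  | b, α, mu A => OccursOnly b (α + 1) A
  | b, α, lolli A B => OccursOnly (!b) α A ∧ OccursOnly b α B
  | b, α, imp A B => OccursOnly (!b) α A ∧ OccursOnly b α B

/-- No non-linear arrow occurs in the formula. -/
def NoImp : Formula → Prop
  | var _ => True
  | all A => NoImp A
  | mu A => NoImp A
  | lolli A B => NoImp A ∧ NoImp B
  | imp _ _ => False

/-- The formulas of the grammar: the premise of a linear arrow and the body of a type fixpoint are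
linear, and the variable of a type fixpoint occurs only positively. -/
def WF : Formula → Prop
  | var _ => True
  | all A => WF A
  | mu L => WF L ∧ NoImp L ∧ OccursOnly true 0 L
  | lolli L B => WF L ∧ NoImp L ∧ WF B
  | imp A B => WF A ∧ WF B

/-- The linear formulas of the grammar. -/
def IsLinear (L : Formula) : Prop := WF L ∧ NoImp L

end Formula

/-- Typing contexts. -/
abbrev Ctx : Type := List (ℕ × Formula)

/-- The variables declared in a context. -/
def Ctx.names (Γ : Ctx) : List ℕ := Γ.map Prod.fst

open LTerm Formula in
/-- `Derivable Γ Δ t A`: the judgment `Γ; Δ ⊢ t : A` is derivable. The order of the declarations in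
a context is immaterial, hence the rule `perm`; all declared variables are distinct. -/
inductive Derivable : Ctx → Ctx → LTerm → Formula → Prop
  | ax1 (x : ℕ) (A : Formula) : A.WF → Derivable [(x, A)] [] (.var x) A
  | ax2 (x : ℕ) (L : Formula) : L.IsLinear → Derivable [] [(x, L)] (.var x) L
  | mu_e {Γ Δ : Ctx} {t : LTerm} {L : Formula} :
      Derivable Γ Δ t (.mu L) → Derivable Γ Δ t (L.inst (.mu L))
  | mu_i {Γ Δ : Ctx} {t : LTerm} {L : Formula} :
      (Formula.mu L).WF → Derivable Γ Δ t (L.inst (.mu L)) → Derivable Γ Δ t (.mu L)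
  | all_i {Γ Δ : Ctx} {t : LTerm} {A : Formula} (α : ℕ) :
      Derivable Γ Δ t A → (∀ c ∈ Γ ++ Δ, ¬ Occurs α c.2) →
      Derivable Γ Δ t (forallVar α A)
  | all_e {Γ Δ : Ctx} {t : LTerm} {A L : Formula} :
      Derivable Γ Δ t (.all A) → L.IsLinear → Derivable Γ Δ t (A.inst L)
  | imp_e {Γ₁ Γ₂ Δ : Ctx} {t u : LTerm} {A B : Formula} :
      Derivable Γ₁ Δ t (.imp A B) → Derivable Γ₂ [] u A →
      (Ctx.names (Γ₁ ++ Γ₂ ++ Δ)).Nodup →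
      Derivable (Γ₁ ++ Γ₂) Δ (.app t u) B
  | imp_i {Γ Δ : Ctx} {t : LTerm} {A B : Formula} {z : ℕ} :
      Derivable (Γ ++ [(z, A)]) Δ t B → Derivable Γ Δ (abs z t) (.imp A B)
  | lolli_e {Γ₁ Γ₂ Δ₁ Δ₂ : Ctx} {t u : LTerm} {L B : Formula} :
      Derivable Γ₁ Δ₁ t (.lolli L B) → Derivable Γ₂ Δ₂ u L →
      (Ctx.names (Γ₁ ++ Γ₂ ++ (Δ₁ ++ Δ₂))).Nodup →
      Derivable (Γ₁ ++ Γ₂) (Δ₁ ++ Δ₂) (.app t u) B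
  | lolli_i {Γ Δ : Ctx} {t : LTerm} {L B : Formula} {z : ℕ} :
      Derivable Γ (Δ ++ [(z, L)]) t B → Derivable Γ Δ (abs z t) (.lolli L B)
  | contr {Γ Δ : Ctx} {t : LTerm} {A B : Formula} {x y z : ℕ} :
      Derivable (Γ ++ [(x, A), (y, A)]) Δ t B → z ∉ Ctx.names (Γ ++ Δ) →
      Derivable (Γ ++ [(z, A)]) Δ (t.contract z x y) B
  | derel {Γ Δ : Ctx} {t : LTerm} {L B : Formula} {x : ℕ} :
      Derivable Γ (Δ ++ [(x, L)]) t B → Derivable (Γ ++ [(x, L)]) Δ t B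
  | weak {Γ Γ' Δ Δ' : Ctx} {t : LTerm} {B : Formula} :
      Derivable Γ Δ t B → (∀ c ∈ Γ', c.2.WF) → (∀ c ∈ Δ', c.2.IsLinear) →
      (Ctx.names (Γ ++ Γ' ++ (Δ ++ Δ'))).Nodup →
      Derivable (Γ ++ Γ') (Δ ++ Δ') t B
  | perm {Γ Γ' Δ Δ' : Ctx} {t : LTerm} {B : Formula} :
      Derivable Γ Δ t B → Γ.Perm Γ' → Δ.Perm Δ' → Derivable Γ' Δ' t B

/-! ## Higher order polynomials -/

/-- Simple types over one base type. -/
inductive Ty : Type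
  | o
  | arrow (σ τ : Ty)

/-- `Idx Γ τ`: the positions of type `τ` in the list of types `Γ`. -/
inductive Idx : List Ty → Ty → Type
  | zero {Γ : List Ty} {τ : Ty} : Idx (τ :: Γ) τ
  | succ {Γ : List Ty} {σ τ : Ty} : Idx Γ τ → Idx (σ :: Γ) τ

/-- `Poly Γ τ`: the higher order polynomials of type `τ` whose free variables have the types `Γ`,
modulo `α`-equivalence. -/
inductive Poly : List Ty → Ty → Type
  | var {Γ : List Ty} {τ : Ty} : Idx Γ τ → Poly Γ τ
  | app {Γ : List Ty} {σ τ : Ty} : Poly Γ (.arrow σ τ) → Poly Γ σ → Poly Γ τ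
  | lam {Γ : List Ty} {σ τ : Ty} : Poly (σ :: Γ) τ → Poly Γ (.arrow σ τ)
  | nat {Γ : List Ty} : ℕ → Poly Γ .o
  | plus {Γ : List Ty} : Poly Γ (.arrow .o (.arrow .o .o))

namespace Poly

/-- Lifts a renaming under a binder. -/
def upRen {Γ Δ : List Ty} {σ : Ty} (ρ : ∀ τ, Idx Γ τ → Idx Δ τ) :
    ∀ τ, Idx (σ :: Γ) τ → Idx (σ :: Δ) τ
  | _, .zero => .zero
  | _, .succ i => .succ (ρ _ i)

/-- Renaming of free variables. -/
def rename : ∀ {Γ Δ : List Ty} {τ : Ty}, (∀ τ, Idx Γ τ → Idx Δ τ) → Poly Γ τ → Poly Δ τ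
  | _, _, _, ρ, var i => var (ρ _ i)
  | _, _, _, ρ, app p q => app (rename ρ p) (rename ρ q)
  | _, _, _, ρ, lam p => lam (rename (upRen ρ) p)
  | _, _, _, _, nat n => nat n
  | _, _, _, _, plus => plus

/-- Weakening by one variable. -/
def wk {Γ : List Ty} {σ τ : Ty} (p : Poly Γ τ) : Poly (σ :: Γ) τ :=
  rename (fun _ i => .succ i) p

/-- Lifts a substitution under a binder. -/
def upSub {Γ Δ : List Ty} {σ : Ty} (s : ∀ τ, Idx Γ τ → Poly Δ τ) :
    ∀ τ, Idx (σ :: Γ) τ → Poly (σ :: Δ) τ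
  | _, .zero => var .zero
  | _, .succ i => wk (s _ i)

/-- Simultaneous substitution for the free variables. -/
def subst : ∀ {Γ Δ : List Ty} {τ : Ty}, (∀ τ, Idx Γ τ → Poly Δ τ) → Poly Γ τ → Poly Δ τ
  | _, _, _, s, var i => s _ i
  | _, _, _, s, app p q => app (subst s p) (subst s q)
  | _, _, _, s, lam p => lam (subst (upSub s) p)
  | _, _, _, _, nat n => nat n
  | _, _, _, _, plus => plus

/-- The substitution of `q` for the first variable. -/
def single {Γ : List Ty} {σ : Ty} (q : Poly Γ σ) : ∀ τ, Idx (σ :: Γ) τ → Poly Γ τ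
  | _, .zero => q
  | _, .succ i => var i

/-- The sum of two polynomials of base type. -/
def plus₂ {Γ : List Ty} (p q : Poly Γ .o) : Poly Γ .o := app (app plus p) q

/-- The identification of higher order polynomials: `βη`-equivalence (`α`-equivalence is built into
`Poly`) and the laws of addition of natural numbers. -/
inductive Conv : ∀ {Γ : List Ty} {τ : Ty}, Poly Γ τ → Poly Γ τ → Prop
  | refl {Γ : List Ty} {τ : Ty} (p : Poly Γ τ) : Conv p p
  | symm {Γ : List Ty} {τ : Ty} {p q : Poly Γ τ} : Conv p q → Conv q p
  | trans {Γ : List Ty} {τ : Ty} {p q r : Poly Γ τ} : Conv p q → Conv q r → Conv p r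
  | app {Γ : List Ty} {σ τ : Ty} {p p' : Poly Γ (.arrow σ τ)} {q q' : Poly Γ σ} :
      Conv p p' → Conv q q' → Conv (p.app q) (p'.app q')
  | lam {Γ : List Ty} {σ τ : Ty} {p p' : Poly (σ :: Γ) τ} : Conv p p' → Conv p.lam p'.lam
  | beta {Γ : List Ty} {σ τ : Ty} (p : Poly (σ :: Γ) τ) (q : Poly Γ σ) :
      Conv (p.lam.app q) (p.subst (single q))
  | eta {Γ : List Ty} {σ τ : Ty} (p : Poly Γ (.arrow σ τ)) :
      Conv (Poly.lam (p.wk.app (var .zero))) p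
  | comm {Γ : List Ty} (p q : Poly Γ .o) : Conv (plus₂ p q) (plus₂ q p)
  | assoc {Γ : List Ty} (p q r : Poly Γ .o) :
      Conv (plus₂ (plus₂ p q) r) (plus₂ p (plus₂ q r))
  | zero {Γ : List Ty} (p : Poly Γ .o) : Conv (plus₂ (nat 0) p) p
  | nat {Γ : List Ty} (m n : ℕ) : Conv (plus₂ (nat m) (nat n) : Poly Γ .o) (nat (m + n))

/-- `p + q = λ x₁ ⋯ xₖ. (p x₁ ⋯ xₖ + q)` for `p : τ₁ → ⋯ → τₖ → o` and `q : o`. -/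
def add : ∀ {Γ : List Ty} {τ : Ty}, Poly Γ τ → Poly Γ .o → Poly Γ τ
  | _, .o, p, q => plus₂ p q
  | _, .arrow _ _, p, q => lam (add (app p.wk (var .zero)) q.wk)

/-- `0_τ = λ x₁ ⋯ xₖ. 0` for `τ = τ₁ → ⋯ → τₖ → o`. -/
def zeroAt : ∀ {Γ : List Ty} (τ : Ty), Poly Γ τ
  | _, .o => nat 0
  | _, .arrow _ τ => lam (zeroAt τ)

/-- The lowering `↓p = p 0_{τ₁} ⋯ 0_{τₖ}` for `p : τ₁ → ⋯ → τₖ → o`; it is `p` itself if `p : o`. -/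
def down : ∀ {Γ : List Ty} {τ : Ty}, Poly Γ τ → Poly Γ .o
  | _, .o, p => p
  | _, .arrow σ _, p => down (app p (zeroAt σ))

end Poly

/-- The functionals of a given type over the natural numbers. -/
def Ty.Den : Ty → Type
  | .o => ℕ
  | .arrow σ τ => σ.Den → τ.Den

/-- Extends an assignment by a value for a new first variable. -/
def extendEnv {Γ : List Ty} {σ : Ty} (x : σ.Den) (e : ∀ τ, Idx Γ τ → τ.Den) :
    ∀ τ, Idx (σ :: Γ) τ → τ.Den
  | _, .zero => x
  | _, .succ i => e _ i

/-- The functional denoted by a higher order polynomial. -/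
def Poly.den : ∀ {Γ : List Ty} {τ : Ty}, Poly Γ τ → (∀ τ, Idx Γ τ → τ.Den) → τ.Den
  | _, _, .var i, e => e _ i
  | _, _, .app p q, e => (p.den e) (q.den e)
  | _, _, .lam p, e => fun x => p.den (extendEnv x e)
  | _, _, .nat n, _ => n
  | _, _, .plus, _ => fun (m n : ℕ) => (m + n : ℕ)

/-- The natural number that a closed higher order polynomial of base type is. -/
def Poly.value (p : Poly [] .o) : ℕ := p.den (fun _ i => nomatch i)

/-- `↓p` as a natural number, for a closed higher order polynomial `p` of any type. -/
def Poly.lower {τ : Ty} (p : Poly [] τ) : ℕ := p.down.value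

/-- Tuples of closed higher order polynomials of the given types. -/
def Args : List Ty → Type
  | [] => Unit
  | τ :: Γ => Poly [] τ × Args Γ

/-- A component of a tuple. -/
def Args.get : ∀ {Γ : List Ty}, Args Γ → ∀ τ, Idx Γ τ → Poly [] τ
  | _ :: _, qs, _, .zero => qs.1
  | _ :: _, qs, _, .succ i => Args.get qs.2 _ i

/-- `p(q₁, …, qₙ)`: the closed polynomials `qᵢ` are substituted for the variables of `p`. -/
def Poly.eval {Γ : List Ty} {τ : Ty} (p : Poly Γ τ) (qs : Args Γ) : Poly [] τ := p.subst qs.get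

/-- `p + ↓m₁ + ⋯ + ↓mₖ`. (The lowering does nothing to the `mᵢ` of base type.) -/
def Poly.addArgs {τ : Ty} : ∀ {Γ : List Ty}, Poly [] τ → Args Γ → Poly [] τ
  | [], p, _ => p
  | _ :: _, p, ms => Poly.addArgs (p.add ms.1.down) ms.2

/-- The type `o(A)` of higher order polynomials associated with a formula. It is `o` if `A` is
linear. -/
def Formula.otype : Formula → Ty
  | .var _ => .o
  | .all A => A.otype
  | .mu _ => .o
  | .lolli _ B => B.otype
  | .imp A B => .arrow A.otype B.otype

/-- The list of the types `o(Aᵢ)` for a context `x₁ : A₁, …, xₙ : Aₙ`. -/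
def Ctx.otypes : Ctx → List Ty
  | [] => []
  | c :: Γ => c.2.otype :: Ctx.otypes Γ

/-! ## Realizability -/

open LTerm in
/-- Saturated sets of type `τ`. They consist of pairs of a term and a closed higher order polynomial
of type `τ`; `resp` says that the polynomials only matter up to their identification.
A saturated set may be empty. -/
structure IsSaturated (τ : Ty) (X : Set (LTerm × Poly [] τ)) : Prop where
  resp : ∀ t p q, Poly.Conv p q → (t, p) ∈ X → (t, q) ∈ X
  bound : ∀ t p, (t, p) ∈ X → Evaluates t ∧ TS t ≤ p.lower
  monotonicity : ∀ t p (n : ℕ), (t, p) ∈ X → (t, p.add (.nat n)) ∈ X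
  exchange : ∀ (t₀ v₁ v₂ : LTerm) (y₁ y₂ : ℕ) (θ ξ : List (LTerm × ℕ)) (vs : List LTerm) p,
    ((θ ++ (v₁, y₁) :: (v₂, y₂) :: ξ).map Prod.snd).Nodup →
    (apps (t₀.bind (θ ++ (v₁, y₁) :: (v₂, y₂) :: ξ)) vs, p) ∈ X →
    (apps (t₀.bind (θ ++ (v₂, y₂) :: (v₁, y₁) :: ξ)) vs, p) ∈ X
  weakening : ∀ (t₀ w : LTerm) (z : ℕ) (θ : List (LTerm × ℕ)) (vs : List LTerm) p,
    ((θ ++ [(w, z)]).map Prod.snd).Nodup → z ∉ FV t₀ → Evaluates w →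
    (apps (t₀.bind θ) vs, p) ∈ X →
    (apps (t₀.bind (θ ++ [(w, z)])) vs, p.add (.nat (TS w + 2))) ∈ X
  contraction : ∀ (t₀ w : LTerm) (z z₁ z₂ : ℕ) (θ : List (LTerm × ℕ)) (vs : List LTerm) p,
    ((θ ++ [(w, z₁), (w, z₂)]).map Prod.snd).Nodup →
    z ∉ θ.map Prod.snd → (z ∈ FV t₀ → z = z₁ ∨ z = z₂) →
    (apps (t₀.bind (θ ++ [(w, z₁), (w, z₂)])) vs, p) ∈ X →
    (apps ((t₀.contract z z₁ z₂).bind (θ ++ [(w, z)])) vs, p) ∈ X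
  concatenation : ∀ (t₀ t₁ : LTerm) (θ ξ : List (LTerm × ℕ)) (vs : List LTerm) p,
    ((θ ++ ξ).map Prod.snd).Nodup →
    (∀ x ∈ θ.map Prod.snd, x ∉ FV t₁) → (∀ x ∈ ξ.map Prod.snd, x ∉ FV t₀) →
    (apps (.app (t₀.bind θ) (t₁.bind ξ)) vs, p) ∈ X →
    (apps ((LTerm.app t₀ t₁).bind (θ ++ ξ)) vs, p) ∈ X
  identity : ∀ (t₀ : LTerm) (x : ℕ) (vs : List LTerm) p,
    (apps t₀ vs, p) ∈ X → (apps ((LTerm.var x).bind [(t₀, x)]) vs, p.add (.nat 3)) ∈ X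

/-- The saturated sets of type `o`. -/
def SatSet : Type := {X : Set (LTerm × Poly [] .o) // IsSaturated .o X}

/-- Valuations of the propositional variables. -/
abbrev Valuation : Type := ℕ → SatSet

/-- The valuation of the body of a binder that gives the value `X` to the bound variable. -/
def Valuation.push (X : SatSet) (η : Valuation) : Valuation
  | 0 => X
  | n + 1 => η n

open LTerm in
/-- The realizability relation `t, p ⊩_η A`. In the clauses for `lolli` and `mu`, the polynomials
`m` and `q` have base type when `L` is linear, so that they are not changed by the lowering. -/
def Realizes : (A : Formula) → Valuation → LTerm → Poly [] A.otype → Prop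
  | .var α, η, t, n => (t, n) ∈ (η α).1
  | .lolli L A, η, t, p =>
      (Evaluates t ∧ TS t ≤ Poly.lower (τ := A.otype) p) ∧
        ∀ (u : LTerm) (m : Poly [] L.otype), Realizes L η u m →
          Realizes A η (.app t u) (Poly.add (τ := A.otype) p m.down)
  | .imp B A, η, t, p =>
      (Evaluates t ∧ TS t ≤ Poly.lower (τ := .arrow B.otype A.otype) p) ∧
        ∀ (u : LTerm) (q : Poly [] B.otype), Realizes B η u q →
          Realizes A η (.app t u) (Poly.app (σ := B.otype) (τ := A.otype) p q)
  | .all A, η, t, p => ∀ X : SatSet, Realizes A (η.push X) t p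
  | .mu L, η, t, p => ∀ X : SatSet,
      (∀ (u : LTerm) (q : Poly [] L.otype), Realizes L (η.push X) u q → (u, q.down) ∈ X.1) →
        (t, p) ∈ X.1

/-- `RealizesCtx η Γ us qs`: the lists `us` and `qs` have the length of `Γ` and
`uᵢ, qᵢ ⊩_η Aᵢ` for every declaration `xᵢ : Aᵢ` of `Γ`. -/
def RealizesCtx (η : Valuation) : (Γ : Ctx) → List LTerm → Args Γ.otypes → Prop
  | [], [], _ => True
  | c :: Γ, u :: us, qs => Realizes c.2 η u qs.1 ∧ RealizesCtx η Γ us qs.2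
  | _, _, _ => False

/-- `c₁ ↓q₁ + ⋯ + cₙ ↓qₙ`, where the `i`-th variable of `Γ` occurs `cᵢ` times in `t`. -/
def occSum (t : LTerm) : (Γ : Ctx) → Args Γ.otypes → ℕ
  | [], _ => 0
  | c :: Γ, qs => t.occ c.1 * Poly.lower (τ := c.2.otype) qs.1 + occSum t Γ qs.2

end DIAL

/-!
Every typing rule is interpreted by an explicit polynomial, under which it is sound for
realizability. A polynomial in the variables of a context is treated as the map it induces from
assignments of closed polynomials to closed polynomials; that closed polynomials of base type are
convertible to numerals follows by a logical relation.

The term `t⟨u₁/x₁, …, uₙ/xₙ⟩` is understood through big-step evaluation: its arguments are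
evaluated one after the other and accumulate into a simultaneous substitution of values in `t`. Two
lists of bindings with the same final substitution therefore lead to the same value, and comparing
the costs gives every closure condition for the set of the pairs `(t, p)` with `t⇓` and
`TS(t) ≤ ↓p`. Saturation then passes to the realizers of every formula by induction, and each rule
combines the bindings of its premises by these closure conditions.
-/

namespace DIAL

namespace LTerm

theorem subst_congr {s s' : ℕ → LTerm} {t : LTerm} (h : ∀ x ∈ FV t, s x = s' x) :
    subst s t = subst s' t := by
  induction t generalizing s s' with
  | var n => exact h n (by simp [FV, occ])
  | lam t ih =>
    rw [subst, subst, ih]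
    rintro (_ | x) hx
    · rfl
    · rw [upSub, upSub, h x hx]
  | app t u iht ihu =>
    rw [subst, subst, iht fun x hx => h x ?_, ihu fun x hx => h x ?_] <;>
      simp_all [FV, occ]

theorem subst_rename (s : ℕ → LTerm) (ρ : ℕ → ℕ) (t : LTerm) :
    subst s (rename ρ t) = subst (s ∘ ρ) t := by
  induction t generalizing s ρ with
  | var n => rfl
  | lam t ih =>
    rw [rename, subst, subst, ih]
    congr 2
    funext x
    cases x <;> rfl
  | app t u iht ihu => rw [rename, subst, subst, iht, ihu]

theorem subst_var_comp (ρ : ℕ → ℕ) (t : LTerm) : subst (var ∘ ρ) t = rename ρ t := by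
  induction t generalizing ρ with
  | var n => rfl
  | lam t ih =>
    rw [rename, subst, ← ih]
    congr 2
    funext x
    cases x <;> rfl
  | app t u iht ihu => rw [rename, subst, iht, ihu]

theorem subst_var (t : LTerm) : subst var t = t := by
  induction t with
  | var n => rfl
  | lam t ih =>
    have h : upSub var = var := by
      funext x
      cases x <;> rfl
    rw [subst, h, ih]
  | app t u iht ihu => rw [subst, iht, ihu]

theorem rename_rename (ρ ρ' : ℕ → ℕ) (t : LTerm) :
    rename ρ' (rename ρ t) = rename (ρ' ∘ ρ) t := by
  rw [← subst_var_comp ρ', subst_rename, Function.comp_assoc, subst_var_comp]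

theorem rename_subst (ρ : ℕ → ℕ) (s : ℕ → LTerm) (t : LTerm) :
    rename ρ (subst s t) = subst (rename ρ ∘ s) t := by
  induction t generalizing s ρ with
  | var n => rfl
  | lam t ih =>
    rw [subst, subst, rename, ih]
    congr 2
    funext x
    cases x with
    | zero => rfl
    | succ x => simp only [Function.comp_apply, upSub, rename_rename]; rfl
  | app t u iht ihu => rw [subst, subst, rename, iht, ihu]

theorem subst_subst (s s' : ℕ → LTerm) (t : LTerm) :
    subst s' (subst s t) = subst (subst s' ∘ s) t := by
  induction t generalizing s s' with
  | var n => rfl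
  | lam t ih =>
    rw [subst, subst, subst, ih]
    congr 2
    funext x
    cases x with
    | zero => rfl
    | succ x => simp only [Function.comp_apply, upSub, rename_subst, subst_rename]; rfl
  | app t u iht ihu => rw [subst, subst, subst, iht, ihu]

/-- The renaming with which `abs x` captures the variable `x`. -/
def capture (x : ℕ) : ℕ → ℕ := fun y => if y = x then 0 else y + 1

theorem capture_self (x : ℕ) : capture x x = 0 := if_pos rfl

theorem capture_of_ne {x y : ℕ} (h : y ≠ x) : capture x y = y + 1 := if_neg h

theorem inst_subst_capture (s : ℕ → LTerm) (x : ℕ) (t v : LTerm) :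
    inst (subst (upSub s) (rename (capture x) t)) v = subst (Function.update s x v) t := by
  rw [inst, subst_subst, subst_rename]
  congr 1
  funext y
  by_cases h : y = x
  · simp only [h, Function.comp_apply, capture_self, upSub, subst, Function.update_self]
  · simp only [Function.comp_apply, capture_of_ne h, upSub, subst_rename, Function.update_of_ne h]
    exact subst_var _

theorem occ_rename {t : LTerm} {ρ : ℕ → ℕ} {z : ℕ} (S : Finset ℕ)
    (h : ∀ w ∈ FV t, ρ w = z ↔ w ∈ S) : occ z (rename ρ t) = ∑ w ∈ S, occ w t := by
  induction t generalizing ρ z S with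
  | var n =>
    have hn := h n (by simp [FV, occ])
    simp only [rename, occ, Finset.sum_ite_eq, hn]
  | lam t ih =>
    rw [rename, occ, ih (S.map ⟨Nat.succ, Nat.succ_injective⟩)]
    · exact Finset.sum_map _ _ _
    · rintro (_ | w) hw
      · simp [upRen]
      · simpa [upRen] using h w hw
  | app t u iht ihu =>
    simp only [rename, occ, Finset.sum_add_distrib]
    rw [iht S fun w hw => h w ?_, ihu S fun w hw => h w ?_] <;> simp_all [FV, occ]

theorem occ_succ_rename_succ (t : LTerm) (k : ℕ) : occ (k + 1) (rename Nat.succ t) = occ k t := by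
  rw [occ_rename {k} (by simp), Finset.sum_singleton]

theorem occ_zero_rename_succ (t : LTerm) : occ 0 (rename Nat.succ t) = 0 := by
  rw [occ_rename ∅ (by simp), Finset.sum_empty]

theorem occ_zero_rename_capture (x : ℕ) (t : LTerm) : occ 0 (rename (capture x) t) = occ x t := by
  rw [occ_rename {x} (by simp [capture]), Finset.sum_singleton]

theorem occ_abs_of_ne {x y : ℕ} (h : y ≠ x) (t : LTerm) : occ y (abs x t) = occ y t := by
  rw [abs, occ, occ_rename {y}, Finset.sum_singleton]
  intro w _
  by_cases hw : w = x <;> simp [hw, h.symm]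

theorem occ_abs_self (x : ℕ) (t : LTerm) : occ x (abs x t) = 0 := by
  rw [abs, occ, occ_rename ∅, Finset.sum_empty]
  intro w _
  by_cases hw : w = x <;> simp [hw]

theorem occ_contract {t : LTerm} {x y z : ℕ} (hxy : x ≠ y) (hz : z ∈ FV t → z = x ∨ z = y) :
    occ z (t.contract z x y) = occ x t + occ y t := by
  rw [contract, occ_rename {x, y}, Finset.sum_pair hxy]
  grind

theorem occ_contract_of_ne (t : LTerm) {w x y z : ℕ} (hz : w ≠ z) (hx : w ≠ x) (hy : w ≠ y) :
    occ w (t.contract z x y) = occ w t := by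
  rw [contract, occ_rename {w}, Finset.sum_singleton]
  grind

theorem occ_subst {t : LTerm} {s : ℕ → LTerm} {k : ℕ} (hk : s k = var k)
    (h : ∀ y, y ≠ k → occ k (s y) = 0) : occ k (subst s t) = occ k t := by
  induction t generalizing s k with
  | var n =>
    by_cases hn : n = k
    · rw [hn, subst, hk]
    · rw [subst, h n hn, occ, if_neg hn]
  | lam _ ih =>
    refine ih ?_ ?_
    · rw [upSub, hk, rename]
    · rintro (_ | y) hy
      · rfl
      · rw [upSub, occ_succ_rename_succ, h y (by simpa using hy)]
  | app t u iht ihu => rw [subst, occ, occ, iht hk h, ihu hk h]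

theorem occ_zero_subst_upSub (t : LTerm) (s : ℕ → LTerm) :
    occ 0 (subst (upSub s) t) = occ 0 t := by
  refine occ_subst rfl ?_
  rintro (_ | y) hy
  · exact absurd rfl hy
  · exact occ_zero_rename_succ _

theorem occ_lams {x : ℕ} {xs : List ℕ} (h : x ∉ xs) (t : LTerm) : occ x (lams xs t) = occ x t := by
  induction xs with
  | nil => rfl
  | cons y xs ih =>
    rw [List.mem_cons, not_or] at h
    exact (occ_abs_of_ne h.1 _).trans (ih h.2)

theorem size_pos (t : LTerm) : 0 < size t := by
  induction t <;> simp only [size] <;> omega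

theorem size_rename (ρ : ℕ → ℕ) (t : LTerm) : size (rename ρ t) = size t := by
  induction t generalizing ρ with
  | var n => rfl
  | lam t ih => rw [rename, size, size, ih]
  | app t u iht ihu => rw [rename, size, size, iht, ihu]

theorem size_abs (x : ℕ) (t : LTerm) : size (abs x t) = size t + 1 := by
  rw [abs, size, size_rename]

theorem size_contract (t : LTerm) (z x y : ℕ) : size (t.contract z x y) = size t :=
  size_rename _ _

theorem size_lams (xs : List ℕ) (t : LTerm) : size (lams xs t) = size t + xs.length := by
  induction xs with
  | nil => rfl
  | cons x xs ih => exact (size_abs _ _).trans (congrArg (· + 1) ih)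

theorem size_apps (t : LTerm) (us : List LTerm) :
    size (apps t us) = size t + (us.map size).sum := by
  induction us generalizing t with
  | nil => rfl
  | cons u us ih =>
    refine (ih (app t u)).trans ?_
    rw [List.map_cons, List.sum_cons, size, add_assoc]

theorem size_bind (t : LTerm) (θ : List (LTerm × ℕ)) :
    size (t.bind θ) = size t + (θ.map fun a => size a.1 + 1).sum := by
  rw [bind, size_apps, size_lams, List.sum_map_add, List.map_map, List.length_map, add_assoc,
    List.map_const', List.sum_replicate, smul_eq_mul, mul_one, add_comm θ.length]
  rfl

theorem size_subst {t : LTerm} {s : ℕ → LTerm} {k : ℕ} (h : ∀ y, y ≠ k → size (s y) = 1) :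
    size (subst s t) = size t + occ k t * (size (s k) - 1) := by
  induction t generalizing s k with
  | var n =>
    by_cases hn : n = k
    · have := size_pos (s k)
      simp only [hn, subst, size, occ, if_true]
      omega
    · rw [subst, h n hn, occ, if_neg hn, size, zero_mul, add_zero]
  | lam t ih =>
    rw [subst, size, size, occ, ih (k := k + 1), upSub, size_rename, add_right_comm]
    rintro (_ | y) hy
    · rfl
    · rw [upSub, size_rename, h y (by simpa using hy)]
  | app t u iht ihu =>
    rw [subst, size, size, occ, iht h, ihu h, add_mul, add_add_add_comm]

theorem size_inst (b v : LTerm) : size (b.inst v) = size b + occ 0 b * (size v - 1) := by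
  refine size_subst ?_
  rintro (_ | y) hy
  · exact absurd rfl hy
  · rfl

theorem apps_concat (t u : LTerm) (us : List LTerm) : apps t (us ++ [u]) = app (apps t us) u :=
  List.foldl_append

/-! ## Big-step evaluation -/

/-- The cost of contracting a redex whose bound variable occurs `o` times and whose argument has
size `s`. -/
def betaCost (o s : ℕ) : ℕ := max (o * (s - 1) - (1 + s)) 1

theorem max_size_inst_sub (b v : LTerm) :
    max (size (b.inst v) - size (app (lam b) v)) 1 = betaCost (occ 0 b) (size v) := by
  rw [betaCost, size_inst, size, size]
  congr 1
  omega

theorem betaCost_zero (s : ℕ) : betaCost 0 s = 1 := by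
  rw [betaCost, zero_mul, Nat.zero_sub, Nat.zero_max]

theorem betaCost_add_le (a b s : ℕ) :
    betaCost (a + b) s + 1 ≤ betaCost a s + betaCost b s + 2 + s := by
  simp only [betaCost, add_mul]
  omega

/-- Big-step evaluation: `Eval t n v` means that `t` evaluates to the value `v` at the cost `n`. -/
inductive Eval : LTerm → ℕ → LTerm → Prop
  | value {v : LTerm} : IsValue v → Eval v 0 v
  | app {t u b v w : LTerm} {n m k : ℕ} : Eval t n (lam b) → Eval u m v → Eval (b.inst v) k w →
      Eval (app t u) (n + m + betaCost (occ 0 b) (size v) + k) w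

namespace Eval

theorem isValue {t v : LTerm} {n : ℕ} (h : Eval t n v) : IsValue v := by
  induction h with
  | value h => exact h
  | app _ _ _ _ _ ih => exact ih

theorem app_iff {t u w : LTerm} {N : ℕ} : Eval (.app t u) N w ↔
    ∃ b v n m k, Eval t n (lam b) ∧ Eval u m v ∧ Eval (b.inst v) k w ∧
      N = n + m + betaCost (occ 0 b) (size v) + k := by
  constructor
  · intro h
    cases h with
    | value h => cases h
    | app ht hu hb => exact ⟨_, _, _, _, _, ht, hu, hb, rfl⟩
  · rintro ⟨b, v, n, m, k, ht, hu, hb, rfl⟩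
    exact .app ht hu hb

theorem eq_of_isValue {t v : LTerm} {n : ℕ} (h : Eval t n v) (ht : IsValue t) :
    n = 0 ∧ v = t := by
  cases h with
  | value _ => exact ⟨rfl, rfl⟩
  | app _ _ _ => cases ht

theorem unique {t v w : LTerm} {n m : ℕ} (h : Eval t n v) (h' : Eval t m w) : n = m ∧ v = w := by
  induction h generalizing m w with
  | value hv =>
    obtain ⟨rfl, rfl⟩ := h'.eq_of_isValue hv
    exact ⟨rfl, rfl⟩
  | app _ _ _ iht ihu ihb =>
    obtain ⟨b, v, n, m, k, ht, hu, hb, rfl⟩ := app_iff.1 h'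
    obtain ⟨rfl, hlam⟩ := iht ht
    obtain ⟨rfl, rfl⟩ := ihu hu
    cases hlam
    obtain ⟨rfl, rfl⟩ := ihb hb
    exact ⟨rfl, rfl⟩

theorem size_le {t v : LTerm} {n : ℕ} (h : Eval t n v) : size v ≤ n + size t := by
  induction h with
  | value _ => exact Nat.le_add_left _ _
  | @app t u b v w n m k _ _ _ iht ihu ihb =>
    have hbeta : size (b.inst v) - size (LTerm.app (lam b) v) ≤ betaCost (occ 0 b) (size v) :=
      max_size_inst_sub b v ▸ le_max_left _ _
    simp only [size] at *
    omega

end Eval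

namespace CostRed

theorem app_left {t t' : LTerm} {n : ℕ} (h : CostRed t n t') (u : LTerm) :
    CostRed (app t u) n (app t' u) := by
  induction h with
  | refl t => exact .refl _
  | step h => simpa only [size, Nat.add_sub_add_right] using CostRed.step (h.left (u := u))
  | trans _ _ ih₁ ih₂ => exact ih₁.trans ih₂

theorem app_right {t t' : LTerm} {n : ℕ} (h : CostRed t n t') (u : LTerm) :
    CostRed (app u t) n (app u t') := by
  induction h with
  | refl t => exact .refl _
  | step h => simpa only [size, Nat.add_sub_add_left] using CostRed.step (h.right (u := u))
  | trans _ _ ih₁ ih₂ => exact ih₁.trans ih₂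

theorem reflTransGen {t t' : LTerm} {n : ℕ} (h : CostRed t n t') :
    Relation.ReflTransGen Step t t' := by
  induction h with
  | refl => exact .refl
  | step h => exact .single h
  | trans _ _ ih₁ ih₂ => exact ih₁.trans ih₂

end CostRed

theorem exists_costRed {t t' : LTerm} (h : Relation.ReflTransGen Step t t') :
    ∃ n, CostRed t n t' := by
  induction h with
  | refl => exact ⟨_, .refl _⟩
  | tail _ h ih =>
    obtain ⟨n, hn⟩ := ih
    exact ⟨_, hn.trans (.step h)⟩

namespace Eval

theorem costRed {t v : LTerm} {n : ℕ} (h : Eval t n v) : CostRed t n v := by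
  induction h with
  | value _ => exact .refl _
  | @app t u b v w n m k _ hu _ iht ihu ihb =>
    have hbeta := CostRed.step (Step.beta (b := b) hu.isValue)
    rw [max_size_inst_sub] at hbeta
    exact (((iht.app_left u).trans (ihu.app_right _)).trans hbeta).trans ihb

theorem of_step {t t' v : LTerm} {k : ℕ} (h : Step t t') (h' : Eval t' k v) :
    Eval t (max (size t' - size t) 1 + k) v := by
  induction h generalizing k v with
  | @beta b w hw =>
    rw [max_size_inst_sub]
    simpa only [zero_add] using Eval.app (.value (.lam b)) (.value hw) h'
  | left _ ih =>
    obtain ⟨b, v, n, m, k, ht, hu, hb, rfl⟩ := app_iff.1 h'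
    convert Eval.app (ih ht) hu hb using 1
    simp only [size, Nat.add_sub_add_right]
    omega
  | right _ ih =>
    obtain ⟨b, v, n, m, k, ht, hu, hb, rfl⟩ := app_iff.1 h'
    convert Eval.app ht (ih hu) hb using 1
    simp only [size, Nat.add_sub_add_left]
    omega

theorem of_costRed {t t' v : LTerm} {n k : ℕ} (h : CostRed t n t') (h' : Eval t' k v) :
    Eval t (n + k) v := by
  induction h generalizing k v with
  | refl t => rwa [zero_add]
  | step h => exact h'.of_step h
  | trans _ _ ih₁ ih₂ => exact add_assoc _ _ k ▸ ih₁ (ih₂ h')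

theorem time_eq {t v : LTerm} {n : ℕ} (h : Eval t n v) : time t = n := by
  have hcost : {m | ∃ w, IsValue w ∧ CostRed t m w} = {n} := by
    ext m
    constructor
    · rintro ⟨w, hw, hm⟩
      exact ((of_costRed hm (.value hw)).unique h).1
    · rintro rfl
      exact ⟨v, h.isValue, h.costRed⟩
  rw [time, hcost, csInf_singleton]

theorem TS_eq {t v : LTerm} {n : ℕ} (h : Eval t n v) : TS t = n + size t := by
  rw [TS, h.time_eq]

end Eval

theorem evaluates_iff_exists_eval {t : LTerm} : Evaluates t ↔ ∃ n v, Eval t n v := by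
  constructor
  · rintro ⟨v, hv, h⟩
    obtain ⟨n, hn⟩ := exists_costRed h
    exact ⟨_, v, .of_costRed hn (.value hv)⟩
  · rintro ⟨n, v, h⟩
    exact ⟨v, h.isValue, h.costRed.reflTransGen⟩

theorem Eval.apps_lam_iff {b u w : LTerm} {us : List LTerm} {N : ℕ} :
    Eval (apps (.app (lam b) u) us) N w ↔ ∃ c v k, Eval u c v ∧ Eval (apps (b.inst v) us) k w ∧
      N = c + betaCost (occ 0 b) (size v) + k := by
  induction us using List.reverseRecOn generalizing N w with
  | nil =>
    constructor
    · intro h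
      obtain ⟨b', v, n, m, k, hlam, hu, hb, rfl⟩ := app_iff.1 h
      obtain ⟨rfl, ⟨⟩⟩ := hlam.eq_of_isValue (.lam b)
      exact ⟨m, v, k, hu, hb, by omega⟩
    · rintro ⟨c, v, k, hu, hb, rfl⟩
      simpa only [zero_add, apps, List.foldl_nil] using Eval.app (.value (.lam b)) hu hb
  | append_singleton us a ih =>
    simp only [apps_concat]
    constructor
    · intro h
      obtain ⟨b', v', n, m, k, hhead, ha, hb, rfl⟩ := app_iff.1 h
      obtain ⟨c, v, k', hu, hus, rfl⟩ := ih.1 hhead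
      exact ⟨c, v, _, hu, .app hus ha hb, by omega⟩
    · rintro ⟨c, v, k, hu, hus, rfl⟩
      obtain ⟨b', v', n, m, k, hhead, ha, hb, rfl⟩ := app_iff.1 hus
      convert Eval.app (ih.2 ⟨c, v, _, hu, hhead, rfl⟩) ha hb using 1
      omega

/-- `t` evaluates, with `TS(t) ≤ N`. -/
def EvalBound (t : LTerm) (N : ℕ) : Prop := Evaluates t ∧ TS t ≤ N

theorem evalBound_iff_exists_eval {t : LTerm} {N : ℕ} :
    EvalBound t N ↔ ∃ n v, Eval t n v ∧ n + size t ≤ N := by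
  constructor
  · rintro ⟨h, hN⟩
    obtain ⟨n, v, h⟩ := evaluates_iff_exists_eval.1 h
    exact ⟨n, v, h, h.TS_eq ▸ hN⟩
  · rintro ⟨n, v, h, hN⟩
    exact ⟨evaluates_iff_exists_eval.2 ⟨n, v, h⟩, h.TS_eq ▸ hN⟩

/-- `Simulates t u k`: whenever `t` evaluates, `u` evaluates to the same value, and its `TS` is
larger by at most `k`. -/
def Simulates (t u : LTerm) (k : ℕ) : Prop :=
  ∀ n v, Eval t n v → ∃ m, Eval u m v ∧ m + size u ≤ n + size t + k

namespace Simulates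

theorem apps {t u : LTerm} {k : ℕ} (h : Simulates t u k) (vs : List LTerm) :
    Simulates (apps t vs) (apps u vs) k := by
  induction vs generalizing t u with
  | nil => exact h
  | cons a _ ih =>
    refine ih fun n v hv => ?_
    obtain ⟨b, w, n, m, j, ht, ha, hb, rfl⟩ := Eval.app_iff.1 hv
    obtain ⟨n', hu, hn⟩ := h _ _ ht
    refine ⟨_, .app hu ha hb, ?_⟩
    simp only [size]
    omega

theorem evalBound {t u : LTerm} {k N : ℕ} (h : Simulates t u k) (ht : EvalBound t N) :
    EvalBound u (N + k) := by
  obtain ⟨n, v, hv, hn⟩ := evalBound_iff_exists_eval.1 ht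
  obtain ⟨m, hm, hle⟩ := h _ _ hv
  exact evalBound_iff_exists_eval.2 ⟨m, v, hm, by omega⟩

end Simulates

/-! ## Evaluation of lists of bindings -/

/-- `BindEval t s θ n s'`: evaluating the arguments in `θ` and contracting the redexes of `t⟨θ⟩`
turns the substitution `s` performed so far on `t` into `s'` at the cost `n`. -/
inductive BindEval (t : LTerm) : (ℕ → LTerm) → List (LTerm × ℕ) → ℕ → (ℕ → LTerm) → Prop
  | nil (s : ℕ → LTerm) : BindEval t s [] 0 s
  | cons {s s' : ℕ → LTerm} {u v : LTerm} {x c k : ℕ} {θ : List (LTerm × ℕ)} : Eval u c v →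
      BindEval t (Function.update s x v) θ k s' →
      BindEval t s ((u, x) :: θ) (c + betaCost (occ x t) (size v) + k) s'

namespace BindEval

variable {t : LTerm} {s s' : ℕ → LTerm} {n : ℕ} {θ ξ : List (LTerm × ℕ)}

theorem nil_iff : BindEval t s [] n s' ↔ n = 0 ∧ s' = s := by
  constructor
  · rintro ⟨⟩
    exact ⟨rfl, rfl⟩
  · rintro ⟨rfl, rfl⟩
    exact .nil _

theorem cons_iff {u : LTerm} {x : ℕ} : BindEval t s ((u, x) :: θ) n s' ↔
    ∃ c v k, Eval u c v ∧ BindEval t (Function.update s x v) θ k s' ∧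
      n = c + betaCost (occ x t) (size v) + k := by
  constructor
  · intro h
    cases h with
    | cons hu hθ => exact ⟨_, _, _, hu, hθ, rfl⟩
  · rintro ⟨c, v, k, hu, hθ, rfl⟩
    exact .cons hu hθ

theorem append_iff : BindEval t s (θ ++ ξ) n s' ↔
    ∃ n₁ n₂ s₁, BindEval t s θ n₁ s₁ ∧ BindEval t s₁ ξ n₂ s' ∧ n = n₁ + n₂ := by
  induction θ generalizing s n with
  | nil => simp [nil_iff]
  | cons a θ ih =>
    obtain ⟨u, x⟩ := a
    rw [List.cons_append, cons_iff]
    constructor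
    · rintro ⟨c, v, k, hu, hθξ, rfl⟩
      obtain ⟨n₁, n₂, s₁, hθ, hξ, rfl⟩ := ih.1 hθξ
      exact ⟨_, n₂, s₁, .cons hu hθ, hξ, by omega⟩
    · rintro ⟨n₁, n₂, s₁, huθ, hξ, rfl⟩
      obtain ⟨c, v, k, hu, hθ, rfl⟩ := cons_iff.1 huθ
      exact ⟨c, v, _, hu, ih.2 ⟨_, _, _, hθ, hξ, rfl⟩, by omega⟩

theorem congr {t' : LTerm} (h : BindEval t s θ n s')
    (ht : ∀ x ∈ θ.map Prod.snd, occ x t = occ x t') : BindEval t' s θ n s' := by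
  induction h with
  | nil s => exact .nil s
  | @cons s s' u v x c k θ hu _ ih =>
    rw [List.map_cons, List.forall_mem_cons] at ht
    rw [ht.1]
    exact .cons hu (ih ht.2)

theorem apply_of_notMem (h : BindEval t s θ n s') {x : ℕ} (hx : x ∉ θ.map Prod.snd) :
    s' x = s x := by
  induction h with
  | nil s => rfl
  | cons _ _ ih =>
    rw [List.map_cons, List.mem_cons, not_or] at hx
    rw [ih hx.2, Function.update_of_ne hx.1]

theorem exists_of_subst (h : BindEval t s θ n s') (r : ℕ → LTerm) :
    ∃ r', BindEval t r θ n r' ∧ ∀ x, s x = r x ∨ x ∈ θ.map Prod.snd → r' x = s' x := by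
  induction h generalizing r with
  | nil s => exact ⟨r, .nil r, fun x hx => by simpa [eq_comm] using hx⟩
  | @cons s s' u v y c k θ hu _ ih =>
    obtain ⟨r', hr', heq⟩ := ih (Function.update r y v)
    refine ⟨r', .cons hu hr', fun x hx => heq x ?_⟩
    by_cases hxy : x = y
    · simp [hxy]
    · simpa [hxy] using hx

end BindEval

theorem bind_concat (t u : LTerm) (θ : List (LTerm × ℕ)) (z : ℕ) :
    t.bind (θ ++ [(u, z)]) = app ((abs z t).bind θ) u := by
  simp only [bind, List.map_append, List.map_cons, List.map_nil, apps_concat, lams,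
    List.foldr_append, List.foldr_cons, List.foldr_nil]

theorem Eval.apps_subst_lams_iff {t w : LTerm} {s : ℕ → LTerm} {θ : List (LTerm × ℕ)} {N : ℕ}
    (hθ : (θ.map Prod.snd).Nodup) :
    Eval (apps (subst s (lams (θ.map Prod.snd) t)) (θ.map Prod.fst)) N w ↔
      ∃ n k s', BindEval t s θ n s' ∧ Eval (subst s' t) k w ∧ N = n + k := by
  induction θ generalizing s N with
  | nil => simp [BindEval.nil_iff, apps, lams]
  | cons a θ ih =>
    obtain ⟨u, x⟩ := a
    rw [List.map_cons, List.nodup_cons] at hθ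
    change Eval (apps (.app (lam (subst (upSub s) (rename (capture x) (lams (θ.map Prod.snd) t))))
      u) (θ.map Prod.fst)) _ _ ↔ _
    simp only [apps_lam_iff, inst_subst_capture, occ_zero_subst_upSub, occ_zero_rename_capture,
      occ_lams hθ.1, ih hθ.2]
    constructor
    · rintro ⟨c, v, k, hu, ⟨n, k', s', hs', hw, rfl⟩, rfl⟩
      exact ⟨_, k', s', .cons hu hs', hw, by omega⟩
    · rintro ⟨n, k, s', hs', hw, rfl⟩
      obtain ⟨c, v, j, hu, hθ', rfl⟩ := BindEval.cons_iff.1 hs'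
      exact ⟨c, v, _, hu, ⟨_, _, _, hθ', hw, rfl⟩, by omega⟩

theorem Eval.bind_iff {t w : LTerm} {θ : List (LTerm × ℕ)} {N : ℕ}
    (hθ : (θ.map Prod.snd).Nodup) :
    Eval (t.bind θ) N w ↔ ∃ n k s, BindEval t var θ n s ∧ Eval (subst s t) k w ∧ N = n + k := by
  rw [← Eval.apps_subst_lams_iff hθ, subst_var, bind]

namespace Simulates

theorem exchange {t v₁ v₂ : LTerm} {y₁ y₂ : ℕ} {θ ξ : List (LTerm × ℕ)}
    (h : ((θ ++ (v₁, y₁) :: (v₂, y₂) :: ξ).map Prod.snd).Nodup) :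
    Simulates (t.bind (θ ++ (v₁, y₁) :: (v₂, y₂) :: ξ))
      (t.bind (θ ++ (v₂, y₂) :: (v₁, y₁) :: ξ)) 0 := by
  have hperm : (θ ++ (v₁, y₁) :: (v₂, y₂) :: ξ).Perm (θ ++ (v₂, y₂) :: (v₁, y₁) :: ξ) :=
    (List.Perm.swap _ _ _).append_left θ
  have hne : y₁ ≠ y₂ := by
    rw [List.map_append, List.nodup_append] at h
    rintro rfl
    simp at h
  intro N w hw
  obtain ⟨n, k, s, hs, ht, rfl⟩ := (Eval.bind_iff h).1 hw
  obtain ⟨n₁, n₂, s₁, hθ, hvvξ, rfl⟩ := BindEval.append_iff.1 hs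
  obtain ⟨c₁, w₁, k₁, hv₁, hvξ, rfl⟩ := BindEval.cons_iff.1 hvvξ
  obtain ⟨c₂, w₂, k₂, hv₂, hξ, rfl⟩ := BindEval.cons_iff.1 hvξ
  rw [Function.update_comm hne] at hξ
  refine ⟨_, (Eval.bind_iff ((hperm.map Prod.snd).nodup_iff.1 h)).2 ⟨_, _, s,
    BindEval.append_iff.2 ⟨_, _, _, hθ, .cons hv₂ (.cons hv₁ hξ), rfl⟩, ht, rfl⟩, ?_⟩
  rw [size_bind, size_bind, (hperm.map _).sum_eq]
  omega

theorem weakening {t w : LTerm} {z : ℕ} {θ : List (LTerm × ℕ)}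
    (h : ((θ ++ [(w, z)]).map Prod.snd).Nodup) (hz : z ∉ FV t) (hw : Evaluates w) :
    Simulates (t.bind θ) (t.bind (θ ++ [(w, z)])) (TS w + 2) := by
  intro N x hx
  obtain ⟨c, v, hv⟩ := evaluates_iff_exists_eval.1 hw
  obtain ⟨n, k, s, hs, ht, rfl⟩ := (Eval.bind_iff (List.map_append ▸ h).of_append_left).1 hx
  have hsubst : subst (Function.update s z v) t = subst s t := subst_congr fun y hy =>
    Function.update_of_ne (ne_of_mem_of_not_mem hy hz) _ _
  refine ⟨_, (Eval.bind_iff h).2 ⟨_, k, Function.update s z v,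
    BindEval.append_iff.2 ⟨_, _, _, hs, .cons hv (.nil _), rfl⟩, hsubst ▸ ht, rfl⟩, ?_⟩
  rw [size_bind, size_bind, hv.TS_eq, not_not.1 hz, betaCost_zero, List.map_append, List.sum_append,
    List.map_singleton, List.sum_singleton]
  dsimp only
  omega

theorem contraction {t w : LTerm} {z z₁ z₂ : ℕ} {θ : List (LTerm × ℕ)}
    (h : ((θ ++ [(w, z₁), (w, z₂)]).map Prod.snd).Nodup)
    (hz : z ∉ θ.map Prod.snd) (hzt : z ∈ FV t → z = z₁ ∨ z = z₂) :
    Simulates (t.bind (θ ++ [(w, z₁), (w, z₂)]))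
      ((t.contract z z₁ z₂).bind (θ ++ [(w, z)])) 0 := by
  obtain ⟨hθnodup, hne, hz₁, hz₂⟩ : (θ.map Prod.snd).Nodup ∧ z₁ ≠ z₂ ∧ z₁ ∉ θ.map Prod.snd ∧
      z₂ ∉ θ.map Prod.snd := by
    rw [List.map_append, List.nodup_append] at h
    exact ⟨h.1, by simpa using h.2.1, fun h' => h.2.2 _ h' z₁ (by simp) rfl,
      fun h' => h.2.2 _ h' z₂ (by simp) rfl⟩
  have hnodup : ((θ ++ [(w, z)]).map Prod.snd).Nodup := by
    rw [List.map_append]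
    exact hθnodup.append (List.nodup_singleton z) (List.disjoint_singleton.2 hz)
  intro N x hx
  obtain ⟨n, k, s', hs', ht, rfl⟩ := (Eval.bind_iff h).1 hx
  obtain ⟨n₁, n₂, s, hθ, hww, rfl⟩ := BindEval.append_iff.1 hs'
  obtain ⟨c, v, k₁, hw, hw₂, rfl⟩ := BindEval.cons_iff.1 hww
  obtain ⟨c', v', k₂, hw', hnil, rfl⟩ := BindEval.cons_iff.1 hw₂
  obtain ⟨rfl, rfl⟩ := BindEval.nil_iff.1 hnil
  obtain ⟨rfl, rfl⟩ := hw.unique hw'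
  have hθ' : BindEval (t.contract z z₁ z₂) var θ n₁ s := hθ.congr fun x hx =>
    (occ_contract_of_ne _ (ne_of_mem_of_not_mem hx hz) (ne_of_mem_of_not_mem hx hz₁)
      (ne_of_mem_of_not_mem hx hz₂)).symm
  have hsubst : subst (Function.update s z v) (t.contract z z₁ z₂) =
      subst (Function.update (Function.update s z₁ v) z₂ v) t := by
    rw [contract, subst_rename]
    refine subst_congr fun y hy => ?_
    simp only [Function.comp_apply, Function.update_apply]
    grind
  refine ⟨_, (Eval.bind_iff hnodup).2 ⟨_, k, Function.update s z v,
    BindEval.append_iff.2 ⟨_, _, _, hθ', .cons hw (.nil _), rfl⟩, hsubst ▸ ht, rfl⟩, ?_⟩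
  have hcost := betaCost_add_le (occ z₁ t) (occ z₂ t) (size v)
  have hsize := hw.size_le
  simp only [size_bind, size_contract, occ_contract hne hzt, List.map_append, List.sum_append,
    List.map_cons, List.map_nil, List.sum_cons, List.sum_nil]
  omega

theorem concatenation {t u : LTerm} {θ ξ : List (LTerm × ℕ)}
    (h : ((θ ++ ξ).map Prod.snd).Nodup) (hθu : ∀ x ∈ θ.map Prod.snd, x ∉ FV u)
    (hξt : ∀ x ∈ ξ.map Prod.snd, x ∉ FV t) :
    Simulates (app (t.bind θ) (u.bind ξ)) ((app t u).bind (θ ++ ξ)) 0 := by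
  have hnodup := h
  rw [List.map_append, List.nodup_append] at hnodup
  intro N w hw
  obtain ⟨b, v, n, m, k, htθ, huξ, hb, rfl⟩ := Eval.app_iff.1 hw
  obtain ⟨n₁, k₁, s₁, hθ, ht, rfl⟩ := (Eval.bind_iff hnodup.1).1 htθ
  obtain ⟨n₂, k₂, s₂, hξ, hu, rfl⟩ := (Eval.bind_iff hnodup.2.1).1 huξ
  obtain ⟨s, hξ', heq⟩ := hξ.exists_of_subst s₁
  have hsubst_t : subst s t = subst s₁ t := subst_congr fun x hx =>
    hξ'.apply_of_notMem fun hmem => hξt x hmem hx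
  have hsubst_u : subst s u = subst s₂ u := subst_congr fun x hx =>
    heq x (.inl (hθ.apply_of_notMem fun hmem => hθu x hmem hx).symm)
  have hθ_app : BindEval (app t u) var θ n₁ s₁ := hθ.congr fun x hx => by
    rw [occ, not_not.1 (hθu x hx), add_zero]
  have hξ_app : BindEval (app t u) s₁ ξ n₂ s := hξ'.congr fun x hx => by
    rw [occ, not_not.1 (hξt x hx), zero_add]
  refine ⟨_, (Eval.bind_iff h).2 ⟨_, k₁ + k₂ + betaCost (occ 0 b) (size v) + k, s,
    BindEval.append_iff.2 ⟨_, _, _, hθ_app, hξ_app, rfl⟩, ?_, rfl⟩, ?_⟩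
  · rw [subst, hsubst_t, hsubst_u]
    exact .app ht hu hb
  · simp only [size, size_bind, List.map_append, List.sum_append]
    omega

theorem identity (t : LTerm) (x : ℕ) : Simulates t ((var x).bind [(t, x)]) 3 := by
  intro n v hv
  refine ⟨_, (Eval.bind_iff (θ := [(t, x)]) (List.nodup_singleton x)).2
    ⟨_, 0, Function.update var x v, .cons hv (.nil _), ?_, rfl⟩, ?_⟩
  · rw [subst, Function.update_self]
    exact .value hv.isValue
  · simp only [size_bind, size, occ, betaCost, if_true, List.map_cons, List.map_nil,
      List.sum_singleton]
    omega

end Simulates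

/-- `BindStep t u k`: one of the closure conditions of saturated sets that concern lists of bindings
(exchange, weakening, contraction, concatenation, identity) leads from `t` to `u`, and it adds `k`
to the polynomial. -/
inductive BindStep : LTerm → LTerm → ℕ → Prop
  | exchange {t v₁ v₂ : LTerm} {y₁ y₂ : ℕ} {θ ξ : List (LTerm × ℕ)} :
      ((θ ++ (v₁, y₁) :: (v₂, y₂) :: ξ).map Prod.snd).Nodup →
      BindStep (t.bind (θ ++ (v₁, y₁) :: (v₂, y₂) :: ξ))
        (t.bind (θ ++ (v₂, y₂) :: (v₁, y₁) :: ξ)) 0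
  | weakening {t w : LTerm} {z : ℕ} {θ : List (LTerm × ℕ)} :
      ((θ ++ [(w, z)]).map Prod.snd).Nodup → z ∉ FV t → Evaluates w →
      BindStep (t.bind θ) (t.bind (θ ++ [(w, z)])) (TS w + 2)
  | contraction {t w : LTerm} {z z₁ z₂ : ℕ} {θ : List (LTerm × ℕ)} :
      ((θ ++ [(w, z₁), (w, z₂)]).map Prod.snd).Nodup → z ∉ θ.map Prod.snd →
      (z ∈ FV t → z = z₁ ∨ z = z₂) →
      BindStep (t.bind (θ ++ [(w, z₁), (w, z₂)])) ((t.contract z z₁ z₂).bind (θ ++ [(w, z)])) 0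
  | concatenation {t u : LTerm} {θ ξ : List (LTerm × ℕ)} :
      ((θ ++ ξ).map Prod.snd).Nodup → (∀ x ∈ θ.map Prod.snd, x ∉ FV u) →
      (∀ x ∈ ξ.map Prod.snd, x ∉ FV t) →
      BindStep (app (t.bind θ) (u.bind ξ)) ((app t u).bind (θ ++ ξ)) 0
  | identity (t : LTerm) (x : ℕ) : BindStep t ((var x).bind [(t, x)]) 3

theorem BindStep.simulates {t u : LTerm} {k : ℕ} (h : BindStep t u k) : Simulates t u k := by
  cases h with
  | exchange h => exact .exchange h
  | weakening h hz hw => exact .weakening h hz hw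
  | contraction h hz hzt => exact .contraction h hz hzt
  | concatenation h hθ hξ => exact .concatenation h hθ hξ
  | identity t x => exact .identity t x

theorem betaCost_le {o s T : ℕ} (h : s ≤ T) : betaCost o s ≤ (o - 1) * T + 1 := by
  cases o with
  | zero => exact betaCost_zero s ▸ Nat.le_add_left _ _
  | succ o =>
    have hmul : o * (s - 1) ≤ o * T := Nat.mul_le_mul_left _ (by omega)
    simp only [betaCost, Nat.succ_mul, Nat.add_sub_cancel]
    omega

/-- The list of the bindings `σ(x)/x` for the variables `x` in `l`. -/
def bindings (σ : ℕ → LTerm) (l : List ℕ) : List (LTerm × ℕ) := l.map fun x => (σ x, x)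

theorem map_snd_bindings (σ : ℕ → LTerm) (l : List ℕ) : (bindings σ l).map Prod.snd = l := by
  rw [bindings, List.map_map]
  exact List.map_id l

theorem bindings_append (σ : ℕ → LTerm) (l l' : List ℕ) :
    bindings σ (l ++ l') = bindings σ l ++ bindings σ l' := List.map_append

theorem bindings_congr {σ σ' : ℕ → LTerm} {l : List ℕ} (h : ∀ x ∈ l, σ x = σ' x) :
    bindings σ l = bindings σ' l :=
  List.map_congr_left fun x hx => by rw [h x hx]

section

variable {ι : Type*} {l : List ι} {f : ι → ℕ} {σ : ℕ → LTerm} {T : ι → ℕ}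

theorem exists_bindEval_bindings (t : LTerm) (s : ℕ → LTerm)
    (h : ∀ i ∈ l, EvalBound (σ (f i)) (T i)) :
    ∃ n s', BindEval t s (bindings σ (l.map f)) n s' ∧
      n + (l.map fun i => size (σ (f i)) + 1).sum ≤
        (l.map fun i => (occ (f i) t - 1) * T i + (T i + 2)).sum := by
  induction l generalizing s with
  | nil => exact ⟨0, s, .nil s, le_rfl⟩
  | cons i l ih =>
    rw [List.forall_mem_cons] at h
    obtain ⟨c, v, hv, hc⟩ := evalBound_iff_exists_eval.1 h.1
    obtain ⟨n, s', hs', hn⟩ := ih (Function.update s (f i) v) h.2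
    refine ⟨_, s', .cons hv hs', ?_⟩
    have hbeta := betaCost_le (o := occ (f i) t) (hv.size_le.trans hc)
    simp only [List.map_cons, List.sum_cons]
    omega

theorem evalBound_bind_abs (t : LTerm) (z : ℕ) (hl : (l.map f).Nodup)
    (h : ∀ i ∈ l, EvalBound (σ (f i)) (T i)) :
    EvalBound ((abs z t).bind (bindings σ (l.map f)))
      (size t + 1 + (l.map fun i => (occ (f i) (abs z t) - 1) * T i + (T i + 2)).sum) := by
  obtain ⟨n, s, hs, hn⟩ := exists_bindEval_bindings (abs z t) var h
  refine evalBound_iff_exists_eval.2 ⟨_, _,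
    (Eval.bind_iff ((map_snd_bindings σ _).symm ▸ hl)).2 ⟨n, 0, s, hs, .value (.lam _), rfl⟩, ?_⟩
  simp only [size_bind, size_abs, bindings, List.map_map, Function.comp_def]
  omega

end

end LTerm

/-! ## Closed polynomials and their assignments to variables -/

namespace Poly

section Substitution

variable {Γ Δ Ξ : List Ty} {σ τ : Ty} (ρ : ∀ τ, Idx Γ τ → Idx Δ τ) (ρ' : ∀ τ, Idx Δ τ → Idx Ξ τ)
  (s : ∀ τ, Idx Γ τ → Poly Δ τ) (s' : ∀ τ, Idx Δ τ → Poly Ξ τ)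

theorem upRen_comp :
    (fun τ i => upRen (σ := σ) ρ' τ (upRen ρ τ i)) = upRen fun τ i => ρ' τ (ρ τ i) := by
  funext τ i
  cases i <;> rfl

theorem rename_rename (p : Poly Γ τ) :
    rename ρ' (rename ρ p) = rename (fun τ i => ρ' τ (ρ τ i)) p := by
  induction p generalizing Δ Ξ with
  | var i => rfl
  | app p q ihp ihq => simp only [rename, ihp, ihq]
  | lam p ih => simp only [rename, ih, upRen_comp]
  | nat n => rfl
  | plus => rfl

theorem upSub_upRen :
    (fun τ i => upSub (σ := σ) s' τ (upRen ρ τ i)) = upSub fun τ i => s' τ (ρ τ i) := by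
  funext τ i
  cases i <;> rfl

theorem subst_rename (p : Poly Γ τ) :
    subst s' (rename ρ p) = subst (fun τ i => s' τ (ρ τ i)) p := by
  induction p generalizing Δ Ξ with
  | var i => rfl
  | app p q ihp ihq => simp only [rename, subst, ihp, ihq]
  | lam p ih => simp only [rename, subst, ih, upSub_upRen]
  | nat n => rfl
  | plus => rfl

theorem rename_upSub :
    (fun τ i => rename (upRen ρ') (upSub (σ := σ) s τ i)) = upSub fun τ i => rename ρ' (s τ i) := by
  funext τ i
  cases i with
  | zero => rfl
  | succ i => simp only [upSub, wk, rename_rename, upRen]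

theorem rename_subst (p : Poly Γ τ) :
    rename ρ' (subst s p) = subst (fun τ i => rename ρ' (s τ i)) p := by
  induction p generalizing Δ Ξ with
  | var i => rfl
  | app p q ihp ihq => simp only [rename, subst, ihp, ihq]
  | lam p ih => simp only [rename, subst, ih, rename_upSub]
  | nat n => rfl
  | plus => rfl

theorem rename_wk (p : Poly Γ τ) : rename (upRen (σ := σ) ρ) p.wk = (rename ρ p).wk := by
  simp only [wk, rename_rename, upRen]

theorem subst_wk (p : Poly Γ τ) : subst (upSub (σ := σ) s) p.wk = (subst s p).wk := by
  simp only [wk, subst_rename, upSub, rename_subst]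

theorem subst_upSub :
    (fun τ i => subst (upSub s') (upSub (σ := σ) s τ i)) = upSub fun τ i => subst s' (s τ i) := by
  funext τ i
  cases i with
  | zero => rfl
  | succ i => simp only [upSub, subst_wk]

theorem subst_subst (p : Poly Γ τ) :
    subst s' (subst s p) = subst (fun τ i => subst s' (s τ i)) p := by
  induction p generalizing Δ Ξ with
  | var i => rfl
  | app p q ihp ihq => simp only [subst, ihp, ihq]
  | lam p ih => simp only [subst, ih, subst_upSub]
  | nat n => rfl
  | plus => rfl

theorem upSub_var : upSub (σ := σ) (fun τ (i : Idx Γ τ) => var i) = fun _ i => var i := by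
  funext τ i
  cases i <;> rfl

theorem subst_var (p : Poly Γ τ) : subst (fun _ i => var i) p = p := by
  induction p with
  | var i => rfl
  | app p q ihp ihq => simp only [subst, ihp, ihq]
  | lam p ih => simp only [subst, upSub_var, ih]
  | nat n => rfl
  | plus => rfl

theorem subst_single_wk (p : Poly Γ τ) (q : Poly Γ σ) : subst (single q) p.wk = p := by
  simp only [wk, subst_rename, single, subst_var]

theorem rename_single (p : Poly (σ :: Γ) τ) (q : Poly Γ σ) :
    rename ρ (subst (single q) p) = subst (single (rename ρ q)) (rename (upRen ρ) p) := by
  rw [rename_subst, subst_rename]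
  congr 1
  funext τ i
  cases i <;> rfl

/-- The substitution that extends `s` by `q` for a new first variable. -/
def cons (q : Poly Δ σ) : ∀ τ, Idx (σ :: Γ) τ → Poly Δ τ
  | _, .zero => q
  | _, .succ i => s _ i

theorem subst_single_upSub (p : Poly (σ :: Γ) τ) (q : Poly Δ σ) :
    subst (single q) (subst (upSub s) p) = subst (cons s q) p := by
  rw [subst_subst]
  congr 1
  funext τ i
  cases i with
  | zero => rfl
  | succ i => rw [upSub, subst_single_wk, cons]

theorem rename_add (p : Poly Γ τ) (q : Poly Γ .o) :
    (p.add q).rename ρ = (p.rename ρ).add (q.rename ρ) := by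
  induction τ generalizing Γ Δ with
  | o => rfl
  | arrow σ τ _ ih => simp only [add, rename, ih, rename_wk, upRen]

theorem subst_add (p : Poly Γ τ) (q : Poly Γ .o) :
    (p.add q).subst s = (p.subst s).add (q.subst s) := by
  induction τ generalizing Γ Δ with
  | o => rfl
  | arrow σ τ _ ih => simp only [add, subst, ih, subst_wk, upSub]

theorem subst_zeroAt : (zeroAt τ).subst s = zeroAt τ := by
  induction τ generalizing Γ Δ with
  | o => rfl
  | arrow σ τ _ ih => simp only [zeroAt, subst, ih]

theorem subst_down (p : Poly Γ τ) : p.down.subst s = (p.subst s).down := by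
  induction τ generalizing Γ Δ with
  | o => rfl
  | arrow σ τ _ ih => simp only [down, ih, subst, subst_zeroAt]

end Substitution

section Conversion

variable {Γ Δ : List Ty} {σ τ : Ty}

theorem Conv.rename {p q : Poly Γ τ} (h : Conv p q) (ρ : ∀ τ, Idx Γ τ → Idx Δ τ) :
    Conv (p.rename ρ) (q.rename ρ) := by
  induction h generalizing Δ with
  | refl p => exact .refl _
  | symm _ ih => exact (ih ρ).symm
  | trans _ _ ih₁ ih₂ => exact (ih₁ ρ).trans (ih₂ ρ)
  | app _ _ ih₁ ih₂ => exact .app (ih₁ ρ) (ih₂ ρ)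
  | lam _ ih => exact .lam (ih _)
  | beta p q => exact rename_single ρ p q ▸ .beta _ _
  | eta p =>
    simp only [Poly.rename, rename_wk, Poly.upRen]
    exact .eta _
  | comm p q => exact .comm _ _
  | assoc p q r => exact .assoc _ _ _
  | zero p => exact .zero _
  | nat m n => exact .nat _ _

theorem Conv.of_eq {p q : Poly Γ τ} (h : p = q) : Conv p q := h ▸ .refl p

theorem Conv.plus₂ {p p' q q' : Poly Γ .o} (h : Conv p p') (h' : Conv q q') :
    Conv (p.plus₂ q) (p'.plus₂ q') :=
  .app (.app (.refl _) h) h'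

theorem Conv.add {p p' : Poly Γ τ} {q q' : Poly Γ .o} (h : Conv p p') (h' : Conv q q') :
    Conv (p.add q) (p'.add q') := by
  induction τ generalizing Γ with
  | o => exact h.plus₂ h'
  | arrow σ τ _ ih => exact .lam (ih (.app (h.rename _) (.refl _)) (h'.rename _))

theorem app_add (p : Poly Γ (.arrow σ τ)) (q : Poly Γ .o) (r : Poly Γ σ) :
    Conv (app (p.add q) r) ((app p r).add q) := by
  refine (Conv.beta _ _).trans (.of_eq ?_)
  simp only [subst_add, subst, subst_single_wk, single]

theorem add_add (p : Poly Γ τ) (q r : Poly Γ .o) : Conv ((p.add q).add r) (p.add (q.plus₂ r)) := by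
  induction τ generalizing Γ with
  | o => exact .assoc _ _ _
  | arrow σ τ _ ih =>
    refine .lam (Conv.trans (.add ?_ (.refl _)) (ih _ _ _))
    rw [wk, rename_add]
    exact app_add _ _ _

theorem add_zero (p : Poly Γ τ) : Conv (p.add (nat 0)) p := by
  induction τ generalizing Γ with
  | o => exact (Conv.comm _ _).trans (.zero _)
  | arrow σ τ _ ih => exact (Conv.lam (ih _)).trans (.eta _)

theorem add_right_comm (p : Poly Γ τ) (q r : Poly Γ .o) :
    Conv ((p.add q).add r) ((p.add r).add q) :=
  ((add_add p q r).trans (.add (.refl _) (.comm _ _))).trans (add_add p r q).symm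

theorem add_nat_add_nat (p : Poly Γ τ) (a b : ℕ) :
    Conv ((p.add (nat a)).add (nat b)) (p.add (nat (a + b))) :=
  (add_add _ _ _).trans (.add (.refl _) (.nat _ _))

end Conversion

end Poly

namespace Ty

/-- The functional that is constantly `0`, the denotation of `0_τ`. -/
def zeroDen : ∀ τ : Ty, τ.Den
  | .o => (0 : ℕ)
  | .arrow _ τ => fun _ => τ.zeroDen

/-- The value of a functional at zero arguments, the semantic counterpart of `↓`. -/
def lowDen : ∀ τ : Ty, τ.Den → ℕ
  | .o, n => n
  | .arrow σ τ, f => τ.lowDen (f σ.zeroDen)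

/-- The logical relation over `≤`. It is reflexive only on monotone functionals, such as the
denotations of closed polynomials. -/
def LogicalLe : ∀ τ : Ty, τ.Den → τ.Den → Prop
  | .o, m, n => LE.le (α := ℕ) m n
  | .arrow σ τ, f, g => ∀ x y, σ.LogicalLe x y → τ.LogicalLe (f x) (g y)

theorem zeroDen_logicalLe (τ : Ty) (x : τ.Den) : τ.LogicalLe τ.zeroDen x := by
  induction τ with
  | o => exact Nat.zero_le _
  | arrow σ τ _ ih => exact fun _ b _ => ih (x b)

theorem LogicalLe.lowDen_le {τ : Ty} {x y : τ.Den} (h : τ.LogicalLe x y) :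
    τ.lowDen x ≤ τ.lowDen y := by
  induction τ with
  | o => exact h
  | arrow σ τ _ ih => exact ih (h _ _ (σ.zeroDen_logicalLe _))

end Ty

theorem extendEnv_upRen {Γ Δ : List Ty} {σ : Ty} (ρ : ∀ τ, Idx Γ τ → Idx Δ τ)
    (e : ∀ τ, Idx Δ τ → τ.Den) (x : σ.Den) :
    (fun τ i => extendEnv x e τ (Poly.upRen ρ τ i)) = extendEnv x fun τ i => e τ (ρ τ i) := by
  funext τ i
  cases i <;> rfl

namespace Poly

section Denotation

variable {Γ Δ : List Ty} {σ τ : Ty}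

theorem den_rename (p : Poly Γ τ) (ρ : ∀ τ, Idx Γ τ → Idx Δ τ) (e : ∀ τ, Idx Δ τ → τ.Den) :
    (p.rename ρ).den e = p.den fun τ i => e τ (ρ τ i) := by
  induction p generalizing Δ with
  | var i => rfl
  | app p q ihp ihq => simp only [rename, den, ihp, ihq]
  | lam p ih =>
    funext x
    simp only [rename, den, ih, extendEnv_upRen]
  | nat n => rfl
  | plus => rfl

theorem den_wk (p : Poly Γ τ) (x : σ.Den) (e : ∀ τ, Idx Γ τ → τ.Den) :
    p.wk.den (extendEnv x e) = p.den e := by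
  rw [wk, den_rename]
  rfl

theorem den_upSub (s : ∀ τ, Idx Γ τ → Poly Δ τ) (e : ∀ τ, Idx Δ τ → τ.Den) (x : σ.Den) :
    (fun τ i => (upSub s τ i).den (extendEnv x e)) = extendEnv x fun τ i => (s τ i).den e := by
  funext τ i
  cases i with
  | zero => rfl
  | succ i => exact den_wk _ x e

theorem den_subst (p : Poly Γ τ) (s : ∀ τ, Idx Γ τ → Poly Δ τ) (e : ∀ τ, Idx Δ τ → τ.Den) :
    (p.subst s).den e = p.den fun τ i => (s τ i).den e := by
  induction p generalizing Δ with
  | var i => rfl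
  | app p q ihp ihq => simp only [subst, den, ihp, ihq]
  | lam p ih =>
    funext x
    simp only [subst, den, ih, den_upSub]
  | nat n => rfl
  | plus => rfl

theorem den_single (q : Poly Γ σ) (e : ∀ τ, Idx Γ τ → τ.Den) :
    (fun τ i => (single q τ i).den e) = extendEnv (q.den e) e := by
  funext τ i
  cases i <;> rfl

theorem Conv.den_eq {p q : Poly Γ τ} (h : Conv p q) (e : ∀ τ, Idx Γ τ → τ.Den) :
    p.den e = q.den e := by
  induction h with
  | refl p => rfl
  | symm _ ih => exact (ih e).symm
  | trans _ _ ih₁ ih₂ => exact (ih₁ e).trans (ih₂ e)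
  | app _ _ ih₁ ih₂ => simp only [den, ih₁, ih₂]
  | lam _ ih => exact funext fun x => ih _
  | beta p q => simp only [den, den_subst, den_single]
  | eta p =>
    funext x
    simp only [den, den_wk]
    rfl
  | comm p q => exact Nat.add_comm _ _
  | assoc p q r => exact Nat.add_assoc _ _ _
  | zero p => exact Nat.zero_add _
  | nat m n => rfl

theorem den_logicalLe (p : Poly Γ τ) {e e' : ∀ τ, Idx Γ τ → τ.Den}
    (h : ∀ (τ : Ty) i, τ.LogicalLe (e τ i) (e' τ i)) : τ.LogicalLe (p.den e) (p.den e') := by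
  induction p with
  | var i => exact h _ i
  | app _ q ihp ihq => exact ihp h _ _ (ihq h)
  | lam _ ih =>
    intro x y hxy
    refine ih fun τ i => ?_
    cases i with
    | zero => exact hxy
    | succ i => exact h _ i
  | nat n => exact Nat.le_refl _
  | plus => exact fun a b hab c d hcd => Nat.add_le_add hab hcd

theorem den_zeroAt (τ : Ty) (e : ∀ τ, Idx Γ τ → τ.Den) : (zeroAt τ).den e = τ.zeroDen := by
  induction τ generalizing Γ with
  | o => rfl
  | arrow σ τ _ ih => exact funext fun x => ih _

theorem den_down (p : Poly Γ τ) (e : ∀ τ, Idx Γ τ → τ.Den) :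
    p.down.den e = τ.lowDen (p.den e) := by
  induction τ with
  | o => rfl
  | arrow σ τ _ ih => rw [down, ih, den, den_zeroAt, Ty.lowDen]

theorem lowDen_add (p : Poly Γ τ) (q : Poly Γ .o) (e : ∀ τ, Idx Γ τ → τ.Den) :
    τ.lowDen ((p.add q).den e) = τ.lowDen (p.den e) + Ty.lowDen .o (q.den e) := by
  induction τ generalizing Γ with
  | o => rfl
  | arrow σ τ _ ih =>
    simp only [Ty.lowDen, add, den, ih, den_wk]
    rfl

/-- The unique assignment for the empty list of types, under which closed polynomials are
evaluated. -/
def emptyEnv : ∀ τ, Idx [] τ → τ.Den := fun _ i => nomatch i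

theorem lower_eq_lowDen (p : Poly [] τ) : p.lower = τ.lowDen (p.den emptyEnv) :=
  den_down p emptyEnv

theorem lower_add (p : Poly [] τ) (q : Poly [] .o) : (p.add q).lower = p.lower + q.value := by
  rw [lower_eq_lowDen, lower_eq_lowDen, lowDen_add]
  rfl

theorem Conv.lower_eq {p q : Poly [] τ} (h : Conv p q) : p.lower = q.lower := by
  rw [lower_eq_lowDen, lower_eq_lowDen, h.den_eq]

theorem lower_le_lower_app (p : Poly [] (.arrow σ τ)) (q : Poly [] σ) :
    p.lower ≤ (app p q).lower := by
  rw [lower_eq_lowDen, lower_eq_lowDen]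
  exact Ty.LogicalLe.lowDen_le (den_logicalLe p nofun _ _ (σ.zeroDen_logicalLe _))

end Denotation

section Computability

variable {Γ : List Ty} {τ : Ty}

/-- The logical relation over convertibility to a numeral, the computability predicate that proves
every closed polynomial of base type to be a numeral. -/
def Computable : ∀ {τ : Ty}, Poly [] τ → Prop
  | .o, p => Conv p (nat p.value)
  | .arrow _ _, p => ∀ q, Computable q → Computable (app p q)

theorem Computable.conv {p q : Poly [] τ} (hp : Computable p) (h : Conv p q) :
    Computable q := by
  induction τ with
  | o =>
    have hpq : p.value = q.value := h.lower_eq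
    exact h.symm.trans (hpq ▸ hp)
  | arrow σ τ _ ih => exact fun r hr => ih (hp r hr) (.app h (.refl _))

theorem computable_subst (p : Poly Γ τ) {s : ∀ τ, Idx Γ τ → Poly [] τ}
    (hs : ∀ τ i, Computable (s τ i)) : Computable (p.subst s) := by
  induction p with
  | var i => exact hs _ i
  | app _ q ihp ihq => exact ihp hs _ (ihq hs)
  | lam p ih =>
    intro q hq
    have hcons : ∀ τ i, Computable (cons s q τ i) := by
      intro τ i
      cases i with
      | zero => exact hq
      | succ i => exact hs _ i
    refine (ih hcons).conv ?_
    rw [← subst_single_upSub]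
    exact (Conv.beta _ _).symm
  | nat n => exact .refl _
  | plus => exact fun a ha b hb => (Conv.plus₂ ha hb).trans (.nat _ _)

theorem conv_nat_value (p : Poly [] .o) : Conv p (nat p.value) :=
  subst_var p ▸ computable_subst p (s := fun _ i => var i) nofun

theorem add_conv_add_nat (p : Poly [] τ) (q : Poly [] .o) :
    Conv (p.add q) (p.add (nat q.value)) :=
  .add (.refl _) (conv_nat_value q)

end Computability

end Poly

/-- An assignment of closed polynomials of all types to all variables. Indexing by variable names
rather than by positions makes the reorderings of contexts by the typing rules invisible. -/
abbrev PolyEnv : Type := ℕ → ∀ τ, Poly [] τ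

namespace PolyEnv

open Classical in
/-- Changes the value of the variable `z` at the type `σ` to `q`. -/
noncomputable def set (ρ : PolyEnv) (z : ℕ) (σ : Ty) (q : Poly [] σ) : PolyEnv :=
  Function.update ρ z (Function.update (ρ z) σ q)

theorem set_self (ρ : PolyEnv) (z : ℕ) (σ : Ty) (q : Poly [] σ) : ρ.set z σ q z σ = q := by
  simp only [set, Function.update_self]

theorem set_of_ne (ρ : PolyEnv) {x z : ℕ} (h : x ≠ z) (σ : Ty) (q : Poly [] σ) :
    ρ.set z σ q x = ρ x :=
  Function.update_of_ne h _ _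

/-- The values of the variables of a context. -/
def args (ρ : PolyEnv) : (Γ : Ctx) → Args Γ.otypes
  | [] => ()
  | c :: Γ => (ρ c.1 c.2.otype, args ρ Γ)

/-- Gives the components of a tuple to the variables of a context. -/
noncomputable def ofArgs (ρ : PolyEnv) : (Γ : Ctx) → Args Γ.otypes → PolyEnv
  | [], _ => ρ
  | c :: Γ, qs => (ofArgs ρ Γ qs.2).set c.1 c.2.otype qs.1

theorem args_congr {ρ ρ' : PolyEnv} {Γ : Ctx} (h : ∀ x ∈ Γ.names, ρ x = ρ' x) :
    ρ.args Γ = ρ'.args Γ := by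
  induction Γ with
  | nil => rfl
  | cons c Γ ih =>
    simp only [Ctx.names, List.map_cons, List.mem_cons, forall_eq_or_imp] at h
    rw [args, args, h.1, ih h.2]

theorem args_set (ρ : PolyEnv) {Γ : Ctx} {z : ℕ} (hz : z ∉ Γ.names) (σ : Ty) (q : Poly [] σ) :
    (ρ.set z σ q).args Γ = ρ.args Γ :=
  args_congr fun _ hx => ρ.set_of_ne (ne_of_mem_of_not_mem hx hz) σ q

theorem get_args_set (ρ : PolyEnv) {Γ : Ctx} {z : ℕ} (hz : z ∉ Γ.names) (A : Formula)
    (q : Poly [] A.otype) :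
    ((ρ.set z A.otype q).args ((z, A) :: Γ)).get = Poly.cons (ρ.args Γ).get q := by
  funext τ i
  cases i with
  | zero => exact ρ.set_self z A.otype q
  | succ i => exact congrArg (fun qs => Args.get qs τ i) (ρ.args_set hz A.otype q)

theorem ofArgs_of_notMem (ρ : PolyEnv) {Γ : Ctx} (qs : Args Γ.otypes) {x : ℕ}
    (h : x ∉ Γ.names) : ρ.ofArgs Γ qs x = ρ x := by
  induction Γ with
  | nil => rfl
  | cons c Γ ih =>
    simp only [Ctx.names, List.map_cons, List.mem_cons, not_or] at h
    rw [ofArgs, set_of_ne _ h.1, ih _ h.2]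

theorem args_ofArgs (ρ : PolyEnv) {Γ : Ctx} (qs : Args Γ.otypes) (h : Γ.names.Nodup) :
    (ρ.ofArgs Γ qs).args Γ = qs := by
  induction Γ with
  | nil => rfl
  | cons c Γ ih =>
    simp only [Ctx.names, List.map_cons, List.nodup_cons] at h
    simp only [args, ofArgs, set_self, args_set _ h.1, ih _ h.2]
    rfl

theorem exists_idx {Γ : Ctx} {c : ℕ × Formula} (h : c ∈ Γ) :
    ∃ i : Idx Γ.otypes c.2.otype, ∀ ρ : PolyEnv, (ρ.args Γ).get _ i = ρ c.1 c.2.otype := by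
  induction Γ with
  | nil => cases h
  | cons d Γ ih =>
    rcases List.mem_cons.1 h with rfl | h
    · exact ⟨.zero, fun ρ => rfl⟩
    · obtain ⟨i, hi⟩ := ih h
      exact ⟨.succ i, fun ρ => hi ρ⟩

theorem exists_mem_get_args {Γ : Ctx} {τ : Ty} (i : Idx Γ.otypes τ) :
    ∃ c ∈ Γ, c.2.otype = τ ∧ ∀ ρ : PolyEnv, (ρ.args Γ).get _ i = ρ c.1 τ := by
  induction Γ with
  | nil => cases i
  | cons d Γ ih =>
    match i with
    | .zero => exact ⟨d, List.mem_cons_self, rfl, fun ρ => rfl⟩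
    | .succ i =>
      obtain ⟨c, hc, hτ, hi⟩ := ih i
      exact ⟨c, List.mem_cons_of_mem d hc, hτ, fun ρ => hi ρ⟩

end PolyEnv

/-- `F` is given by a polynomial in the variables of the context `Γ`. -/
def Definable (Γ : Ctx) (τ : Ty) (F : PolyEnv → Poly [] τ) : Prop :=
  ∃ p : Poly Γ.otypes τ, ∀ ρ, F ρ = p.eval (ρ.args Γ)

namespace Definable

variable {Γ Γ' : Ctx} {σ τ : Ty}

theorem rename {F : PolyEnv → Poly [] τ} (hF : Definable Γ τ F) (f : ℕ → ℕ)
    (h : ∀ c ∈ Γ, (f c.1, c.2) ∈ Γ') : Definable Γ' τ fun ρ => F fun x => ρ (f x) := by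
  have hidx : ∀ τ (i : Idx Γ.otypes τ), ∃ j : Idx Γ'.otypes τ, ∀ ρ : PolyEnv,
      (ρ.args Γ').get _ j = (PolyEnv.args (fun x => ρ (f x)) Γ).get _ i := by
    intro τ i
    obtain ⟨c, hc, rfl, hi⟩ := PolyEnv.exists_mem_get_args i
    obtain ⟨j, hj⟩ := PolyEnv.exists_idx (h c hc)
    exact ⟨j, fun ρ => (hj ρ).trans (hi fun x => ρ (f x)).symm⟩
  choose r hr using hidx
  obtain ⟨p, hp⟩ := hF
  refine ⟨p.rename r, fun ρ => ?_⟩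
  simp only [hp, Poly.eval, Poly.subst_rename, hr]

theorem mono {F : PolyEnv → Poly [] τ} (hF : Definable Γ τ F) (h : Γ ⊆ Γ') : Definable Γ' τ F :=
  hF.rename id fun _ hc => h hc

theorem var {c : ℕ × Formula} (h : c ∈ Γ) : Definable Γ c.2.otype fun ρ => ρ c.1 c.2.otype := by
  obtain ⟨i, hi⟩ := PolyEnv.exists_idx h
  exact ⟨.var i, fun ρ => (hi ρ).symm⟩

theorem nat (n : ℕ) : Definable Γ .o fun _ => .nat n := ⟨.nat n, fun _ => rfl⟩

theorem zeroAt : Definable Γ τ fun _ => .zeroAt τ :=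
  ⟨.zeroAt τ, fun _ => (Poly.subst_zeroAt _).symm⟩

theorem app {F : PolyEnv → Poly [] (.arrow σ τ)} {G : PolyEnv → Poly [] σ}
    (hF : Definable Γ _ F) (hG : Definable Γ σ G) :
    Definable Γ τ fun ρ => (F ρ).app (G ρ) := by
  obtain ⟨p, hp⟩ := hF
  obtain ⟨q, hq⟩ := hG
  exact ⟨p.app q, fun ρ => by simp only [hp, hq, Poly.eval, Poly.subst]⟩

theorem add {F : PolyEnv → Poly [] τ} {G : PolyEnv → Poly [] .o}
    (hF : Definable Γ _ F) (hG : Definable Γ _ G) :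
    Definable Γ τ fun ρ => (F ρ).add (G ρ) := by
  obtain ⟨p, hp⟩ := hF
  obtain ⟨q, hq⟩ := hG
  exact ⟨p.add q, fun ρ => by simp only [hp, hq, Poly.eval, Poly.subst_add]⟩

theorem down {F : PolyEnv → Poly [] τ} (hF : Definable Γ _ F) :
    Definable Γ .o fun ρ => (F ρ).down := by
  obtain ⟨p, hp⟩ := hF
  exact ⟨p.down, fun ρ => by simp only [hp, Poly.eval, Poly.subst_down]⟩

theorem lam {A : Formula} {z : ℕ} {F : PolyEnv → Poly [] τ} (hF : Definable ((z, A) :: Γ) τ F)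
    (hz : z ∉ Γ.names) : ∃ G, Definable Γ (.arrow A.otype τ) G ∧
      ∀ ρ q, Poly.Conv ((G ρ).app q) (F (ρ.set z A.otype q)) := by
  obtain ⟨p, hp⟩ := hF
  refine ⟨fun ρ => Poly.eval (Γ := Γ.otypes) (Poly.lam p) (ρ.args Γ), ⟨Poly.lam p, fun _ => rfl⟩,
    fun ρ q => (Poly.Conv.beta _ _).trans (.of_eq ?_)⟩
  rw [hp, Poly.eval, PolyEnv.get_args_set ρ hz]
  exact Poly.subst_single_upSub _ p q

end Definable

/-! ## Saturated sets and realizers -/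

open LTerm

theorem IsSaturated.of_bindStep {τ : Ty} {X : Set (LTerm × Poly [] τ)}
    (resp : ∀ t p q, Poly.Conv p q → (t, p) ∈ X → (t, q) ∈ X)
    (bound : ∀ t p, (t, p) ∈ X → EvalBound t p.lower)
    (monotonicity : ∀ t p (n : ℕ), (t, p) ∈ X → (t, p.add (.nat n)) ∈ X)
    (bindStep : ∀ t u k vs p, BindStep t u k → (apps t vs, p) ∈ X →
      (apps u vs, p.add (.nat k)) ∈ X) : IsSaturated τ X where
  resp := resp
  bound := bound
  monotonicity := monotonicity
  exchange _ _ _ _ _ _ _ vs p hn h := resp _ _ _ p.add_zero (bindStep _ _ _ vs p (.exchange hn) h)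
  weakening _ _ _ _ vs p hn hz hw h := bindStep _ _ _ vs p (.weakening hn hz hw) h
  contraction _ _ _ _ _ _ vs p hn hz hzt h :=
    resp _ _ _ p.add_zero (bindStep _ _ _ vs p (.contraction hn hz hzt) h)
  concatenation _ _ _ _ vs p hn hθ hξ h :=
    resp _ _ _ p.add_zero (bindStep _ _ _ vs p (.concatenation hn hθ hξ) h)
  identity _ _ vs p h := bindStep _ _ _ vs p (.identity _ _) h

theorem IsSaturated.bindStep {τ : Ty} {X : Set (LTerm × Poly [] τ)} (hX : IsSaturated τ X)
    {t u : LTerm} {k : ℕ} (vs : List LTerm) {p : Poly [] τ} (h : BindStep t u k)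
    (ht : (apps t vs, p) ∈ X) : (apps u vs, p.add (.nat k)) ∈ X := by
  cases h with
  | exchange hn => exact hX.monotonicity _ _ 0 (hX.exchange _ _ _ _ _ _ _ vs p hn ht)
  | weakening hn hz hw => exact hX.weakening _ _ _ _ vs p hn hz hw ht
  | contraction hn hz hzt =>
    exact hX.monotonicity _ _ 0 (hX.contraction _ _ _ _ _ _ vs p hn hz hzt ht)
  | concatenation hn hθ hξ =>
    exact hX.monotonicity _ _ 0 (hX.concatenation _ _ _ _ vs p hn hθ hξ ht)
  | identity => exact hX.identity _ _ vs p ht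

theorem isSaturated_evalBound (τ : Ty) :
    IsSaturated τ {x : LTerm × Poly [] τ | EvalBound x.1 x.2.lower} := by
  refine .of_bindStep (fun t p q hpq h => ?_) (fun t p h => h) (fun t p n h => ?_)
    fun t u k vs p hstep h => ?_
  · change EvalBound t q.lower
    rw [← hpq.lower_eq]
    exact h
  · refine ⟨h.1, h.2.trans ?_⟩
    rw [Poly.lower_add]
    exact Nat.le_add_right _ _
  · change EvalBound _ (p.add (.nat k)).lower
    rw [Poly.lower_add]
    exact (hstep.simulates.apps vs).evalBound h

theorem isSaturated_forall {ι : Type*} {τ : Ty} {P : ι → Prop} {X : ι → Set (LTerm × Poly [] τ)}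
    (hX : ∀ i, P i → IsSaturated τ (X i)) (hP : ∃ i, P i) :
    IsSaturated τ {x | ∀ i, P i → x ∈ X i} := by
  obtain ⟨i₀, hi₀⟩ := hP
  exact .of_bindStep (fun t p q hpq h i hi => (hX i hi).resp t p q hpq (h i hi))
    (fun t p h => (hX i₀ hi₀).bound t p (h i₀ hi₀))
    (fun t p n h i hi => (hX i hi).monotonicity t p n (h i hi))
    fun t u k vs p hstep h i hi => (hX i hi).bindStep vs hstep (h i hi)

theorem isSaturated_arrow {ρ σ τ : Ty} {X : Set (LTerm × Poly [] τ)} (hX : IsSaturated τ X)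
    (Y : Set (LTerm × Poly [] ρ)) (f : Poly [] ρ → Poly [] σ → Poly [] τ)
    (hf : ∀ q p p', Poly.Conv p p' → Poly.Conv (f q p) (f q p'))
    (hf_add : ∀ q p n, Poly.Conv ((f q p).add (.nat n)) (f q (p.add (.nat n)))) :
    IsSaturated σ
      {x | EvalBound x.1 x.2.lower ∧ ∀ u q, (u, q) ∈ Y → (app x.1 u, f q x.2) ∈ X} := by
  have hbase := isSaturated_evalBound σ
  refine .of_bindStep (fun t p q hpq h => ⟨hbase.resp t p q hpq h.1, fun u r hu => ?_⟩)
    (fun t p h => h.1) (fun t p n h => ⟨hbase.monotonicity t p n h.1, fun u r hu => ?_⟩)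
    fun t u k vs p hstep h => ⟨hbase.bindStep vs hstep h.1, fun w r hw => ?_⟩
  · exact hX.resp _ _ _ (hf r p q hpq) (h.2 u r hu)
  · exact hX.resp _ _ _ (hf_add r p n) (hX.monotonicity _ _ n (h.2 u r hu))
  · have happ := h.2 w r hw
    simp only [← apps_concat] at happ ⊢
    exact hX.resp _ _ _ (hf_add r p k) (hX.bindStep (vs ++ [w]) hstep happ)

/-- The largest saturated set of type `o`. -/
def topSat : SatSet := ⟨_, isSaturated_evalBound .o⟩

theorem isSaturated_realizes (A : Formula) (η : Valuation) :
    IsSaturated A.otype {x | Realizes A η x.1 x.2} := by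
  induction A generalizing η with
  | var α => exact (η α).2
  | all A ih =>
    have hforall := isSaturated_forall (P := fun _ : SatSet => True) (fun X _ => ih (η.push X))
      ⟨topSat, trivial⟩
    simp only [true_imp_iff] at hforall
    exact hforall
  | mu L ih =>
    exact isSaturated_forall (P := fun X : SatSet => ∀ (u : LTerm) (q : Poly [] L.otype),
      Realizes L (η.push X) u q → (u, q.down) ∈ X.1) (fun X _ => X.2)
      ⟨topSat, fun u q hq => (ih _).bound u q hq⟩
  | lolli L A _ ihA =>
    exact isSaturated_arrow (σ := A.otype) (ihA η) {x | Realizes L η x.1 x.2}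
      (fun m p => p.add m.down) (fun _ _ _ h => .add h (.refl _))
      fun _ p _ => p.add_right_comm _ _
  | imp B A _ ihA =>
    exact isSaturated_arrow (σ := .arrow B.otype A.otype) (ihA η) {x | Realizes B η x.1 x.2}
      (fun q p => p.app q) (fun _ _ _ h => .app h (.refl _))
      fun q p _ => (p.app_add _ q).symm

theorem realizes_lolli {L A : Formula} {η : Valuation} {t : LTerm} {p : Poly [] A.otype} :
    Realizes (.lolli L A) η t p ↔ EvalBound t p.lower ∧
      ∀ u m, Realizes L η u m → Realizes A η (app t u) (p.add m.down) :=
  Iff.rfl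

theorem realizes_imp {B A : Formula} {η : Valuation} {t : LTerm}
    {p : Poly [] (.arrow B.otype A.otype)} :
    Realizes (.imp B A) η t p ↔ EvalBound t p.lower ∧
      ∀ u q, Realizes B η u q → Realizes A η (app t u) (p.app q) :=
  Iff.rfl

open Formula in
/-- The relation between valuations under which the realizers of `A` grow: at each variable, one
inclusion is needed for its positive occurrences in `A` and the other for its negative ones. -/
def Valuation.LeOn (A : Formula) (η η' : Valuation) : Prop :=
  ∀ α, ((η α).1 ⊆ (η' α).1 ∨ OccursOnly false α A) ∧
    ((η' α).1 ⊆ (η α).1 ∨ OccursOnly true α A)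

namespace Valuation.LeOn

variable {A B : Formula} {η η' : Valuation}

open Formula in
theorem push (X : SatSet)
    (h : ∀ α, ((η α).1 ⊆ (η' α).1 ∨ OccursOnly false (α + 1) A) ∧
      ((η' α).1 ⊆ (η α).1 ∨ OccursOnly true (α + 1) A)) :
    LeOn A (η.push X) (η'.push X) := by
  intro α
  cases α with
  | zero => exact ⟨.inl subset_rfl, .inl subset_rfl⟩
  | succ α => exact h α

theorem push_of_subset (η : Valuation) {X Y : SatSet} (hXY : X.1 ⊆ Y.1)
    (hA : A.OccursOnly true 0) : LeOn A (η.push X) (η.push Y) := by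
  intro α
  cases α with
  | zero => exact ⟨.inl hXY, .inr hA⟩
  | succ α => exact ⟨.inl subset_rfl, .inl subset_rfl⟩

theorem lolli_left (h : LeOn (.lolli A B) η η') : LeOn A η' η := fun α =>
  ⟨(h α).2.imp_right fun hα => hα.1, (h α).1.imp_right fun hα => hα.1⟩

theorem lolli_right (h : LeOn (.lolli A B) η η') : LeOn B η η' := fun α =>
  ⟨(h α).1.imp_right fun hα => hα.2, (h α).2.imp_right fun hα => hα.2⟩

theorem imp_left (h : LeOn (.imp A B) η η') : LeOn A η' η := fun α =>
  ⟨(h α).2.imp_right fun hα => hα.1, (h α).1.imp_right fun hα => hα.1⟩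

theorem imp_right (h : LeOn (.imp A B) η η') : LeOn B η η' := fun α =>
  ⟨(h α).1.imp_right fun hα => hα.2, (h α).2.imp_right fun hα => hα.2⟩

end Valuation.LeOn

namespace Realizes

theorem mono {A : Formula} {η η' : Valuation} (h : Valuation.LeOn A η η') {t : LTerm}
    {p : Poly [] A.otype} (ht : Realizes A η t p) : Realizes A η' t p := by
  induction A generalizing η η' t with
  | var α =>
    rcases (h α).1 with hsub | hneg
    · exact hsub ht
    · exact absurd (hneg rfl) Bool.false_ne_true
  | all A ih => exact fun X => ih (.push X h) (ht X)
  | mu L ih => exact fun X hX => ht X fun u q hq => hX u q (ih (.push X h) hq)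
  | lolli L A ihL ihA =>
    exact ⟨ht.1, fun u m hu => ihA h.lolli_right (ht.2 u m (ihL h.lolli_left hu))⟩
  | imp B A ihB ihA =>
    exact ⟨ht.1, fun u q hu => ihA h.imp_right (ht.2 u q (ihB h.imp_left hu))⟩

variable {A : Formula} {η : Valuation} {t : LTerm} {p q : Poly [] A.otype}

theorem conv (h : Realizes A η t p) (hpq : Poly.Conv p q) : Realizes A η t q :=
  (isSaturated_realizes A η).resp t p q hpq h

theorem add_nat (h : Realizes A η t p) (n : ℕ) : Realizes A η t (p.add (.nat n)) :=
  (isSaturated_realizes A η).monotonicity t p n h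

theorem evalBound (h : Realizes A η t p) : EvalBound t p.lower :=
  (isSaturated_realizes A η).bound t p h

theorem bindStep {u : LTerm} {k : ℕ} (h : Realizes A η t p) (hstep : BindStep t u k) :
    Realizes A η u (p.add (.nat k)) :=
  (isSaturated_realizes A η).bindStep [] hstep h

end Realizes

namespace Poly

variable {σ σ' τ τ' : Ty}

/-- The transport of a closed polynomial along an equality of types; the types `o(A)` and `o(A')`
of formulas with the same realizers are equal, but not definitionally. -/
def cast (h : σ = τ) (p : Poly [] σ) : Poly [] τ := h ▸ p

theorem cast_cast (h : σ = τ) (h' : τ = σ') (p : Poly [] σ) :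
    (p.cast h).cast h' = p.cast (h.trans h') := by
  subst h h'
  rfl

theorem lower_cast (h : σ = τ) (p : Poly [] σ) : (p.cast h).lower = p.lower := by
  subst h
  rfl

theorem down_cast (h : σ = τ) (p : Poly [] σ) : (p.cast h).down = p.down := by
  subst h
  rfl

theorem down_eq_cast (h : τ = .o) (p : Poly [] τ) : p.down = p.cast h := by
  subst h
  rfl

theorem add_cast (h : σ = τ) (p : Poly [] σ) (q : Poly [] .o) :
    (p.cast h).add q = (p.add q).cast h := by
  subst h
  rfl

theorem app_cast (hσ : σ = σ') (hτ : τ = τ') (p : Poly [] (.arrow σ τ)) (q : Poly [] σ) :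
    (p.cast (congrArg₂ Ty.arrow hσ hτ)).app (q.cast hσ) = (p.app q).cast hτ := by
  subst hσ hτ
  rfl

end Poly

theorem IsSaturated.preimage_cast {σ τ : Ty} (h : τ = σ) {X : Set (LTerm × Poly [] σ)}
    (hX : IsSaturated σ X) : IsSaturated τ {x | (x.1, x.2.cast h) ∈ X} := by
  subst h
  exact hX

/-- `A` under `η` and `A'` under `η'` have the same realizers. -/
def SameRealizers (A : Formula) (η : Valuation) (A' : Formula) (η' : Valuation) : Prop :=
  ∃ h : A.otype = A'.otype, ∀ t p, Realizes A η t p ↔ Realizes A' η' t (p.cast h)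

namespace SameRealizers

variable {A A' B B' : Formula} {η η' : Valuation}

theorem refl (A : Formula) (η : Valuation) : SameRealizers A η A η :=
  ⟨rfl, fun _ _ => Iff.rfl⟩

theorem of_imp (h : A.otype = A'.otype)
    (mp : ∀ t p, Realizes A η t p → Realizes A' η' t (p.cast h))
    (mpr : ∀ t p, Realizes A' η' t p → Realizes A η t (p.cast h.symm)) :
    SameRealizers A η A' η' := by
  refine ⟨h, fun t p => ⟨mp t p, fun hp => ?_⟩⟩
  have hback := mpr t _ hp
  rwa [Poly.cast_cast] at hback

theorem symm (h : SameRealizers A η A' η') : SameRealizers A' η' A η := by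
  obtain ⟨hτ, h⟩ := h
  refine ⟨hτ.symm, fun t p => ?_⟩
  rw [h, Poly.cast_cast]
  rfl

theorem all (h : ∀ X, SameRealizers A (η.push X) A' (η'.push X)) :
    SameRealizers (.all A) η (.all A') η' :=
  ⟨(h topSat).1, fun t p => forall_congr' fun X => (h X).2 t p⟩

theorem mu_mp (h : ∀ X, SameRealizers A (η.push X) A' (η'.push X)) {t : LTerm} {p : Poly [] .o}
    (ht : Realizes (.mu A) η t p) : Realizes (.mu A') η' t p := by
  intro X hX
  obtain ⟨hτ, h⟩ := h X
  refine ht X fun u q hq => ?_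
  rw [← Poly.down_cast hτ]
  exact hX u _ ((h u q).1 hq)

theorem mu (h : ∀ X, SameRealizers A (η.push X) A' (η'.push X)) :
    SameRealizers (.mu A) η (.mu A') η' :=
  ⟨rfl, fun _ _ => ⟨mu_mp h, mu_mp fun X => (h X).symm⟩⟩

theorem lolli_mp (hA : SameRealizers A η A' η') (hB : SameRealizers B η B' η') {t : LTerm}
    {p : Poly [] B.otype} (ht : Realizes (.lolli A B) η t p) :
    Realizes (.lolli A' B') η' t (p.cast hB.1) := by
  obtain ⟨hσ, hA⟩ := hA.symm
  obtain ⟨hτ, hB⟩ := hB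
  refine realizes_lolli.2 ⟨(Poly.lower_cast hτ p).symm ▸ ht.1, fun u m hu => ?_⟩
  have happ := (hB _ _).1 (ht.2 u _ ((hA u m).1 hu))
  rwa [← Poly.add_cast, Poly.down_cast] at happ

theorem lolli (hA : SameRealizers A η A' η') (hB : SameRealizers B η B' η') :
    SameRealizers (.lolli A B) η (.lolli A' B') η' :=
  .of_imp hB.1 (fun _ _ => lolli_mp hA hB) fun _ _ => lolli_mp hA.symm hB.symm

theorem imp_mp (hA : SameRealizers A η A' η') (hB : SameRealizers B η B' η') {t : LTerm}
    {p : Poly [] (.arrow A.otype B.otype)} (ht : Realizes (.imp A B) η t p) :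
    Realizes (.imp A' B') η' t (p.cast (congrArg₂ Ty.arrow hA.1 hB.1)) := by
  obtain ⟨hσ, hA⟩ := hA
  obtain ⟨hτ, hB⟩ := hB
  refine realizes_imp.2 ⟨(Poly.lower_cast _ p).symm ▸ ht.1, fun u q hu => ?_⟩
  obtain ⟨q, rfl⟩ : ∃ r : Poly [] A.otype, r.cast hσ = q := ⟨q.cast hσ.symm, Poly.cast_cast _ _ q⟩
  have happ := (hB _ _).1 (ht.2 u q ((hA u q).2 hu))
  rwa [← Poly.app_cast hσ hτ] at happ

theorem imp (hA : SameRealizers A η A' η') (hB : SameRealizers B η B' η') :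
    SameRealizers (.imp A B) η (.imp A' B') η' :=
  .of_imp (congrArg₂ Ty.arrow hA.1 hB.1) (fun _ _ => imp_mp hA hB)
    fun _ _ => imp_mp hA.symm hB.symm

end SameRealizers

theorem Valuation.push_comp_upRen (η : Valuation) (X : SatSet) (f : ℕ → ℕ) :
    (fun α => η.push X (upRen f α)) = Valuation.push X fun α => η (f α) := by
  funext α
  cases α <;> rfl

theorem sameRealizers_rename (A : Formula) (f : ℕ → ℕ) (η : Valuation) :
    SameRealizers (A.rename f) η A fun α => η (f α) := by
  induction A generalizing f η with
  | var α => exact .refl (.var (f α)) η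
  | all A ih => exact .all fun X => η.push_comp_upRen X f ▸ ih (upRen f) (η.push X)
  | mu A ih => exact .mu fun X => η.push_comp_upRen X f ▸ ih (upRen f) (η.push X)
  | lolli A B ihA ihB => exact .lolli (ihA f η) (ihB f η)
  | imp A B ihA ihB => exact .imp (ihA f η) (ihB f η)

/-- The saturated set of the realizers of a formula `L` with `o(L) = o`. -/
def satOf (L : Formula) (h : L.otype = .o) (η : Valuation) : SatSet :=
  ⟨{x | Realizes L η x.1 (x.2.cast h.symm)}, (isSaturated_realizes L η).preimage_cast h.symm⟩

theorem mem_satOf {L : Formula} {h : L.otype = .o} {η : Valuation} {t : LTerm} {p : Poly [] .o} :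
    (t, p) ∈ (satOf L h η).1 ↔ Realizes L η t (p.cast h.symm) := Iff.rfl

theorem cast_mem_satOf {L : Formula} {h : L.otype = .o} {η : Valuation} {t : LTerm}
    {p : Poly [] L.otype} : (t, p.cast h) ∈ (satOf L h η).1 ↔ Realizes L η t p := by
  rw [mem_satOf, Poly.cast_cast]
  rfl

theorem SameRealizers.satOf_eq {L L' : Formula} {η η' : Valuation}
    (hL : SameRealizers L η L' η') (h : L.otype = .o) (h' : L'.otype = .o) :
    satOf L h η = satOf L' h' η' := by
  obtain ⟨hτ, hL⟩ := hL
  apply Subtype.ext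
  ext ⟨t, p⟩
  rw [mem_satOf, mem_satOf, hL, Poly.cast_cast]

theorem otype_upSub {s : ℕ → Formula} (hs : ∀ α, (s α).otype = .o) (α : ℕ) :
    (Formula.upSub s α).otype = .o := by
  cases α with
  | zero => rfl
  | succ α => exact (sameRealizers_rename (s α) Nat.succ fun _ => topSat).1.trans (hs α)

theorem satOf_upSub {s : ℕ → Formula} (hs : ∀ α, (s α).otype = .o) (η : Valuation) (X : SatSet) :
    (fun α => satOf (Formula.upSub s α) (otype_upSub hs α) (η.push X)) =
      Valuation.push X fun α => satOf (s α) (hs α) η := by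
  funext α
  cases α with
  | zero => rfl
  | succ α => exact (sameRealizers_rename (s α) Nat.succ (η.push X)).satOf_eq _ (hs α)

theorem sameRealizers_subst (A : Formula) {s : ℕ → Formula} (hs : ∀ α, (s α).otype = .o)
    (η : Valuation) : SameRealizers (A.subst s) η A fun α => satOf (s α) (hs α) η := by
  induction A generalizing s η with
  | var α => exact ⟨hs α, fun t p => cast_mem_satOf.symm⟩
  | all A ih => exact .all fun X => satOf_upSub hs η X ▸ ih (otype_upSub hs) (η.push X)
  | mu A ih => exact .mu fun X => satOf_upSub hs η X ▸ ih (otype_upSub hs) (η.push X)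
  | lolli A B ihA ihB => exact .lolli (ihA hs η) (ihB hs η)
  | imp A B ihA ihB => exact .imp (ihA hs η) (ihB hs η)

theorem sameRealizers_inst (A : Formula) {L : Formula} (h : L.otype = .o) (η : Valuation) :
    SameRealizers (A.inst L) η A (η.push (satOf L h η)) := by
  have hs : ∀ α, ((fun n => match n with
    | 0 => L
    | k + 1 => .var k : ℕ → Formula) α).otype = .o := by
    rintro (_ | α)
    · exact h
    · rfl
  have hpush : (fun α => satOf _ (hs α) η) = η.push (satOf L h η) := by
    funext α
    cases α <;> rfl
  exact hpush ▸ sameRealizers_subst A hs η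

/-- One half of the fixed point property: the realizers of `μα L` are closed under the operator
that `L` defines, which is monotone because `α` occurs only positively in `L`. -/
theorem realizes_mu_of_push {L : Formula} (hL : L.OccursOnly true 0) {η : Valuation} {u : LTerm}
    {q : Poly [] L.otype} (hq : Realizes L (η.push (satOf (.mu L) rfl η)) u q) :
    Realizes (.mu L) η u q.down := fun X hX =>
  hX u q (hq.mono (.push_of_subset η (fun ⟨_, _⟩ hx => hx X hX) hL))

theorem sameRealizers_mu {L : Formula} (h : L.otype = .o) (hL : L.OccursOnly true 0)
    (η : Valuation) : SameRealizers L (η.push (satOf (.mu L) rfl η)) (.mu L) η := by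
  refine ⟨h, fun t p => ⟨fun hp => ?_, fun hp => ?_⟩⟩
  · exact Poly.down_eq_cast h p ▸ realizes_mu_of_push hL hp
  · refine cast_mem_satOf.1 (hp (satOf L h _) fun u q hq => ?_)
    rw [Poly.down_eq_cast h, cast_mem_satOf]
    refine hq.mono (.push_of_subset η (fun ⟨v, r⟩ hr => ?_) hL)
    have hmu := realizes_mu_of_push hL (mem_satOf.1 hr)
    rwa [Poly.down_cast] at hmu

/-! ## Derivable judgments -/

namespace Formula

theorem NoImp.otype_eq {L : Formula} (h : NoImp L) : L.otype = .o := by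
  induction L with
  | var α => rfl
  | all A ih => exact ih h
  | mu L _ => rfl
  | lolli A B _ ihB => exact ihB h.2
  | imp A B _ _ => exact h.elim

theorem IsLinear.otype_eq {L : Formula} (h : L.IsLinear) : L.otype = .o := h.2.otype_eq

theorem occursOnly_of_not_occurs {A : Formula} {k : ℕ} (h : ¬ Occurs k A) (b : Bool) :
    OccursOnly b k A := by
  induction A generalizing k b with
  | var α => exact fun e => absurd e h
  | all A ih => exact ih h b
  | mu L ih => exact ih h b
  | lolli A B ihA ihB => exact ⟨ihA (fun e => h (.inl e)) _, ihB (fun e => h (.inr e)) _⟩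
  | imp A B ihA ihB => exact ⟨ihA (fun e => h (.inl e)) _, ihB (fun e => h (.inr e)) _⟩

theorem upRen_eq_succ {f : ℕ → ℕ} {j k : ℕ} (h : upRen f j = k + 1) :
    ∃ i, j = i + 1 ∧ f i = k := by
  cases j with
  | zero => cases h
  | succ i => exact ⟨i, rfl, Nat.succ.inj h⟩

theorem Occurs.of_rename {A : Formula} {f : ℕ → ℕ} {k : ℕ} (h : Occurs k (A.rename f)) :
    ∃ j, f j = k ∧ Occurs j A := by
  induction A generalizing f k with
  | var α => exact ⟨α, h, rfl⟩
  | all A ih =>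
    obtain ⟨j, hj, ho⟩ := ih h
    obtain ⟨i, rfl, hi⟩ := upRen_eq_succ hj
    exact ⟨i, hi, ho⟩
  | mu A ih =>
    obtain ⟨j, hj, ho⟩ := ih h
    obtain ⟨i, rfl, hi⟩ := upRen_eq_succ hj
    exact ⟨i, hi, ho⟩
  | lolli A B ihA ihB =>
    rcases h with h | h
    · obtain ⟨j, hj, ho⟩ := ihA h
      exact ⟨j, hj, .inl ho⟩
    · obtain ⟨j, hj, ho⟩ := ihB h
      exact ⟨j, hj, .inr ho⟩
  | imp A B ihA ihB =>
    rcases h with h | h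
    · obtain ⟨j, hj, ho⟩ := ihA h
      exact ⟨j, hj, .inl ho⟩
    · obtain ⟨j, hj, ho⟩ := ihB h
      exact ⟨j, hj, .inr ho⟩

theorem eq_succ_of_upRen_eq_succ {f : ℕ → ℕ} {k k' : ℕ} (hf : ∀ j, f j = k' → j = k) (j : ℕ)
    (hj : upRen f j = k' + 1) : j = k + 1 := by
  obtain ⟨i, rfl, hi⟩ := upRen_eq_succ hj
  rw [hf i hi]

theorem OccursOnly.rename {A : Formula} {f : ℕ → ℕ} {k k' : ℕ} {b : Bool}
    (h : OccursOnly b k A) (hf : ∀ j, f j = k' → j = k) : OccursOnly b k' (A.rename f) := by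
  induction A generalizing f k k' b with
  | var α => exact fun e => h (hf α e)
  | all A ih => exact ih h (eq_succ_of_upRen_eq_succ hf)
  | mu L ih => exact ih h (eq_succ_of_upRen_eq_succ hf)
  | lolli A B ihA ihB => exact ⟨ihA h.1 hf, ihB h.2 hf⟩
  | imp A B ihA ihB => exact ⟨ihA h.1 hf, ihB h.2 hf⟩

theorem upSub_eq_var_succ {s : ℕ → Formula} {k : ℕ} (h : s k = var k) :
    upSub s (k + 1) = var (k + 1) := by
  rw [upSub, h]
  rfl

theorem not_occurs_upSub {s : ℕ → Formula} {k : ℕ} (hs : ∀ j, j ≠ k → ¬ Occurs k (s j)) (j : ℕ)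
    (hj : j ≠ k + 1) : ¬ Occurs (k + 1) (upSub s j) := by
  cases j with
  | zero => exact Nat.zero_ne_add_one k
  | succ j =>
    intro hocc
    obtain ⟨i, hi, ho⟩ := Occurs.of_rename hocc
    cases hi
    exact hs j (fun e => hj (congrArg Nat.succ e)) ho

theorem OccursOnly.subst {A : Formula} {s : ℕ → Formula} {k : ℕ} {b : Bool}
    (h : OccursOnly b k A) (hk : s k = var k) (hs : ∀ j, j ≠ k → ¬ Occurs k (s j)) :
    OccursOnly b k (A.subst s) := by
  induction A generalizing s k b with
  | var α =>
    by_cases hα : α = k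
    · subst hα
      rwa [Formula.subst, hk]
    · exact occursOnly_of_not_occurs (hs α hα) b
  | all A ih => exact ih h (upSub_eq_var_succ hk) (not_occurs_upSub hs)
  | mu L ih => exact ih h (upSub_eq_var_succ hk) (not_occurs_upSub hs)
  | lolli A B ihA ihB => exact ⟨ihA h.1 hk hs, ihB h.2 hk hs⟩
  | imp A B ihA ihB => exact ⟨ihA h.1 hk hs, ihB h.2 hk hs⟩

theorem NoImp.rename {A : Formula} (h : NoImp A) (f : ℕ → ℕ) : NoImp (A.rename f) := by
  induction A generalizing f with
  | var α => trivial
  | all A ih => exact ih h _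
  | mu L ih => exact ih h _
  | lolli A B ihA ihB => exact ⟨ihA h.1 f, ihB h.2 f⟩
  | imp A B _ _ => exact h.elim

theorem WF.rename {A : Formula} (h : WF A) (f : ℕ → ℕ) : WF (A.rename f) := by
  induction A generalizing f with
  | var α => trivial
  | all A ih => exact ih h _
  | mu L ih =>
    refine ⟨ih h.1 _, h.2.1.rename _, h.2.2.rename fun j hj => ?_⟩
    cases j with
    | zero => rfl
    | succ j => cases hj
  | lolli A B ihA ihB => exact ⟨ihA h.1 f, h.2.1.rename f, ihB h.2.2 f⟩
  | imp A B ihA ihB => exact ⟨ihA h.1 f, ihB h.2 f⟩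

theorem IsLinear.upSub {s : ℕ → Formula} (hs : ∀ α, (s α).IsLinear) (α : ℕ) :
    (Formula.upSub s α).IsLinear := by
  cases α with
  | zero => exact ⟨trivial, trivial⟩
  | succ α => exact ⟨(hs α).1.rename _, (hs α).2.rename _⟩

theorem NoImp.subst {A : Formula} (h : NoImp A) {s : ℕ → Formula} (hs : ∀ α, (s α).IsLinear) :
    NoImp (A.subst s) := by
  induction A generalizing s with
  | var α => exact (hs α).2
  | all A ih => exact ih h (IsLinear.upSub hs)
  | mu L ih => exact ih h (IsLinear.upSub hs)
  | lolli A B ihA ihB => exact ⟨ihA h.1 hs, ihB h.2 hs⟩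
  | imp A B _ _ => exact h.elim

theorem WF.subst {A : Formula} (h : WF A) {s : ℕ → Formula} (hs : ∀ α, (s α).IsLinear) :
    WF (A.subst s) := by
  induction A generalizing s with
  | var α => exact (hs α).1
  | all A ih => exact ih h (IsLinear.upSub hs)
  | mu L ih =>
    refine ⟨ih h.1 (IsLinear.upSub hs), h.2.1.subst (IsLinear.upSub hs), h.2.2.subst rfl ?_⟩
    rintro (_ | j) hj ho
    · exact hj rfl
    · obtain ⟨i, hi, _⟩ := Occurs.of_rename ho
      cases hi
  | lolli A B ihA ihB => exact ⟨ihA h.1 hs, h.2.1.subst hs, ihB h.2.2 hs⟩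
  | imp A B ihA ihB => exact ⟨ihA h.1 hs, ihB h.2 hs⟩

theorem WF.inst {A L : Formula} (h : WF A) (hL : L.IsLinear) : WF (A.inst L) := by
  apply h.subst
  rintro (_ | α)
  · exact hL
  · exact ⟨trivial, trivial⟩

end Formula

namespace LTerm

theorem exists_mem_FV_of_mem_FV_rename {t : LTerm} {f : ℕ → ℕ} {k : ℕ} (h : k ∈ FV (rename f t)) :
    ∃ j, f j = k ∧ j ∈ FV t := by
  by_contra! hnot
  refine h (occ_rename ∅ fun w hw => ?_)
  simp only [Finset.notMem_empty, iff_false]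
  exact fun e => hnot w e hw

theorem mem_FV_app {x : ℕ} {t u : LTerm} : x ∈ FV (app t u) ↔ x ∈ FV t ∨ x ∈ FV u := by
  simp only [FV, occ, Set.mem_ofPred_eq]
  omega

theorem mem_FV_abs {x z : ℕ} {t : LTerm} : x ∈ FV (abs z t) ↔ x ≠ z ∧ x ∈ FV t := by
  by_cases hx : x = z
  · subst hx
    simp only [FV, Set.mem_ofPred_eq, occ_abs_self, ne_eq, not_true_eq_false, false_and]
  · simp only [FV, Set.mem_ofPred_eq, occ_abs_of_ne hx, ne_eq, hx, not_false_eq_true, true_and]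

theorem mem_FV_var {x y : ℕ} : x ∈ FV (var y) ↔ y = x := by
  simp only [FV, Set.mem_ofPred_eq, occ, ne_eq, ite_eq_right_iff, one_ne_zero, imp_false, not_not]

end LTerm

namespace Ctx

theorem names_append (Γ Δ : Ctx) : Ctx.names (Γ ++ Δ) = Γ.names ++ Δ.names := List.map_append

theorem names_cons (c : ℕ × Formula) (Γ : Ctx) : Ctx.names (c :: Γ) = c.1 :: Γ.names := rfl

theorem names_nil : Ctx.names [] = [] := rfl

theorem mem_names {c : ℕ × Formula} {Γ : Ctx} (h : c ∈ Γ) : c.1 ∈ Γ.names :=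
  List.mem_map_of_mem h

end Ctx

/-- The properties of derivable judgments that concern variables and the grammar of formulas. -/
structure WellFormed (Γ Δ : Ctx) (t : LTerm) (A : Formula) : Prop where
  nodup : (Γ.names ++ Δ.names).Nodup
  mem_names : ∀ x ∈ FV t, x ∈ Γ.names ++ Δ.names
  wf : A.WF
  wf_left : ∀ c ∈ Γ, c.2.WF
  linear_right : ∀ c ∈ Δ, c.2.IsLinear
  occ_le : ∀ x ∈ Δ.names, occ x t ≤ 1

namespace WellFormed

variable {Γ Γ' Γ₁ Γ₂ Δ Δ' Δ₁ Δ₂ : Ctx} {t u : LTerm} {A B C L : Formula} {x y z : ℕ}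

theorem var_left (x : ℕ) (hA : A.WF) : WellFormed [(x, A)] [] (.var x) A where
  nodup := List.nodup_singleton x
  mem_names y hy := List.mem_singleton.2 (mem_FV_var.1 hy).symm
  wf := hA
  wf_left := by grind
  linear_right := by grind
  occ_le := by grind [Ctx.names_nil]

theorem var_right (x : ℕ) (hL : L.IsLinear) : WellFormed [] [(x, L)] (.var x) L where
  nodup := List.nodup_singleton x
  mem_names y hy := List.mem_singleton.2 (mem_FV_var.1 hy).symm
  wf := hL.1
  wf_left := by grind
  linear_right := by grind
  occ_le := by grind [occ]

theorem app (ht : WellFormed Γ₁ Δ₁ t A) (hu : WellFormed Γ₂ Δ₂ u B)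
    (hn : (Ctx.names (Γ₁ ++ Γ₂ ++ (Δ₁ ++ Δ₂))).Nodup) (hC : C.WF) :
    WellFormed (Γ₁ ++ Γ₂) (Δ₁ ++ Δ₂) (.app t u) C where
  nodup := by rwa [← Ctx.names_append]
  mem_names x hx := by
    have := ht.mem_names x
    have := hu.mem_names x
    grind [mem_FV_app, Ctx.names_append]
  wf := hC
  wf_left c hc := (List.mem_append.1 hc).elim (ht.wf_left c) (hu.wf_left c)
  linear_right c hc := (List.mem_append.1 hc).elim (ht.linear_right c) (hu.linear_right c)
  occ_le x hx := by
    have hxt := ht.mem_names x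
    have hxu := hu.mem_names x
    have := ht.occ_le x
    have := hu.occ_le x
    simp only [Ctx.names_append] at hn hx
    simp only [FV, Set.mem_ofPred_eq] at hxt hxu
    grind [occ]

theorem abs_left (h : WellFormed (Γ ++ [(z, A)]) Δ t B) : WellFormed Γ Δ (abs z t) (.imp A B) where
  nodup := by
    have := h.nodup
    grind [Ctx.names_append]
  mem_names x hx := by
    have := h.mem_names x
    grind [mem_FV_abs, Ctx.names_append, Ctx.names_cons, Ctx.names_nil]
  wf := ⟨h.wf_left (z, A) (by grind), h.wf⟩
  wf_left c hc := h.wf_left c (List.mem_append_left _ hc)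
  linear_right := h.linear_right
  occ_le x hx := by
    have := h.nodup
    rw [occ_abs_of_ne (by grind [Ctx.names_append, Ctx.names_cons])]
    exact h.occ_le x hx

theorem abs_right (h : WellFormed Γ (Δ ++ [(z, L)]) t B) :
    WellFormed Γ Δ (abs z t) (.lolli L B) where
  nodup := by
    have := h.nodup
    grind [Ctx.names_append]
  mem_names x hx := by
    have := h.mem_names x
    grind [mem_FV_abs, Ctx.names_append, Ctx.names_cons, Ctx.names_nil]
  wf := ⟨(h.linear_right (z, L) (by grind)).1, (h.linear_right (z, L) (by grind)).2, h.wf⟩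
  wf_left := h.wf_left
  linear_right c hc := h.linear_right c (List.mem_append_left _ hc)
  occ_le x hx := by
    have := h.nodup
    rw [occ_abs_of_ne (by grind [Ctx.names_append, Ctx.names_cons])]
    exact h.occ_le x (by grind [Ctx.names_append])

theorem contract (h : WellFormed (Γ ++ [(x, A), (y, A)]) Δ t B)
    (hz : z ∉ Ctx.names (Γ ++ Δ)) : WellFormed (Γ ++ [(z, A)]) Δ (t.contract z x y) B where
  nodup := by
    have := h.nodup
    grind [Ctx.names_append, Ctx.names_cons, Ctx.names_nil]
  mem_names w hw := by
    obtain ⟨j, hj, ho⟩ := exists_mem_FV_of_mem_FV_rename hw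
    have := h.mem_names j ho
    grind [Ctx.names_append, Ctx.names_cons, Ctx.names_nil]
  wf := h.wf
  wf_left c hc := by
    have := h.wf_left c
    have := h.wf_left (x, A)
    grind
  linear_right := h.linear_right
  occ_le w hw := by
    have := h.nodup
    simp only [Ctx.names_append, Ctx.names_cons] at this hz
    rw [occ_contract_of_ne _ (by grind) (by grind) (by grind)]
    exact h.occ_le w hw

theorem derelict (h : WellFormed Γ (Δ ++ [(x, L)]) t B) : WellFormed (Γ ++ [(x, L)]) Δ t B where
  nodup := by
    have := h.nodup
    grind [Ctx.names_append, Ctx.names_cons, Ctx.names_nil]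
  mem_names w hw := by
    have := h.mem_names w hw
    grind [Ctx.names_append, Ctx.names_cons, Ctx.names_nil]
  wf := h.wf
  wf_left c hc := by
    have := h.wf_left c
    have := (h.linear_right (x, L) (by grind)).1
    grind
  linear_right c hc := h.linear_right c (List.mem_append_left _ hc)
  occ_le w hw := h.occ_le w (by grind [Ctx.names_append])

theorem weaken (h : WellFormed Γ Δ t B) (hΓ : ∀ c ∈ Γ', c.2.WF) (hΔ : ∀ c ∈ Δ', c.2.IsLinear)
    (hn : (Ctx.names (Γ ++ Γ' ++ (Δ ++ Δ'))).Nodup) : WellFormed (Γ ++ Γ') (Δ ++ Δ') t B where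
  nodup := by rwa [← Ctx.names_append]
  mem_names w hw := by
    have := h.mem_names w hw
    grind [Ctx.names_append]
  wf := h.wf
  wf_left c hc := (List.mem_append.1 hc).elim (h.wf_left c) (hΓ c)
  linear_right c hc := (List.mem_append.1 hc).elim (h.linear_right c) (hΔ c)
  occ_le w hw := by
    have := h.occ_le w
    have hwt := h.mem_names w
    simp only [Ctx.names_append] at hn hw
    simp only [FV, Set.mem_ofPred_eq] at hwt
    grind

theorem perm (h : WellFormed Γ Δ t B) (hΓ : Γ.Perm Γ') (hΔ : Δ.Perm Δ') :
    WellFormed Γ' Δ' t B := by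
  have hp := (hΓ.map Prod.fst).append (hΔ.map Prod.fst)
  exact ⟨hp.nodup_iff.1 h.nodup, fun x hx => hp.mem_iff.1 (h.mem_names x hx), h.wf,
    fun c hc => h.wf_left c (hΓ.mem_iff.2 hc), fun c hc => h.linear_right c (hΔ.mem_iff.2 hc),
    fun x hx => h.occ_le x ((hΔ.map Prod.fst).mem_iff.2 hx)⟩

end WellFormed

theorem Derivable.wellFormed {Γ Δ : Ctx} {t : LTerm} {A : Formula} (h : Derivable Γ Δ t A) :
    WellFormed Γ Δ t A := by
  induction h with
  | ax1 x A hA => exact .var_left x hA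
  | ax2 x L hL => exact .var_right x hL
  | mu_e _ ih => exact { ih with wf := ih.wf.1.inst ⟨ih.wf, ih.wf.2.1⟩ }
  | mu_i hL _ ih => exact { ih with wf := hL }
  | all_i α _ _ ih => exact { ih with wf := ih.wf.rename _ }
  | all_e _ hL ih => exact { ih with wf := Formula.WF.inst ih.wf hL }
  | @imp_e Γ₁ Γ₂ Δ t u A B _ _ hn ih₁ ih₂ =>
    have happ := ih₁.app ih₂ (by rwa [List.append_nil]) ih₁.wf.2
    rwa [List.append_nil] at happ
  | imp_i _ ih => exact ih.abs_left
  | lolli_e _ _ hn ih₁ ih₂ => exact ih₁.app ih₂ hn ih₁.wf.2.2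
  | lolli_i _ ih => exact ih.abs_right
  | contr _ hz ih => exact ih.contract hz
  | derel _ ih => exact ih.derelict
  | weak _ hΓ hΔ hn ih => exact ih.weaken hΓ hΔ hn
  | perm _ hΓ hΔ ih => exact ih.perm hΓ hΔ

namespace Poly

variable {τ : Ty}

theorem add_add_conv_add_nat (p : Poly [] τ) (q r : Poly [] .o) {n : ℕ}
    (h : q.value + r.value = n) : Conv ((p.add q).add r) (p.add (nat n)) :=
  (add_add p q r).trans ((add_conv_add_nat p (q.plus₂ r)).trans
    (.of_eq (congrArg (p.add <| nat ·) h)))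

theorem conv_of_lower_eq (hτ : τ = .o) {p q : Poly [] τ} (h : p.lower = q.lower) : Conv p q := by
  subst hτ
  have hvalue : p.value = q.value := h
  exact (conv_nat_value p).trans (hvalue ▸ (conv_nat_value q).symm)

theorem lower_zeroAt (τ : Ty) : (zeroAt τ : Poly [] τ).lower = 0 := by
  rw [lower_eq_lowDen, den_zeroAt]
  induction τ with
  | o => rfl
  | arrow _ _ _ ih => exact ih

theorem lower_add_nat (p : Poly [] τ) (n : ℕ) : (p.add (nat n)).lower = p.lower + n :=
  lower_add p (nat n)

end Poly

namespace PolyEnv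

/-- The sum `↓m₁ + ⋯ + ↓mₙ` of the values of the variables of a context. -/
def weight (ρ : PolyEnv) (Δ : Ctx) : ℕ := (Δ.map fun c => (ρ c.1 c.2.otype).lower).sum

/-- The sum `c₁ ↓q₁ + ⋯ + cₙ ↓qₙ` of the values of the variables of a context, each taken as often
as the variable occurs in `t`. -/
def occWeight (ρ : PolyEnv) (t : LTerm) (Γ : Ctx) : ℕ :=
  (Γ.map fun c => occ c.1 t * (ρ c.1 c.2.otype).lower).sum

variable (ρ : PolyEnv)

theorem weight_append (Δ Δ' : Ctx) : ρ.weight (Δ ++ Δ') = ρ.weight Δ + ρ.weight Δ' := by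
  simp only [weight, List.map_append, List.sum_append]

theorem weight_singleton (x : ℕ) (A : Formula) : ρ.weight [(x, A)] = (ρ x A.otype).lower :=
  List.sum_singleton

theorem weight_congr {ρ ρ' : PolyEnv} {Δ : Ctx} (h : ∀ x ∈ Δ.names, ρ x = ρ' x) :
    ρ.weight Δ = ρ'.weight Δ :=
  congrArg List.sum (List.map_congr_left fun c hc => by rw [h _ (Ctx.mem_names hc)])

theorem weight_perm {Δ Δ' : Ctx} (h : Δ.Perm Δ') : ρ.weight Δ = ρ.weight Δ' :=
  (h.map _).sum_eq

theorem sum_lower_add_two (Δ : Ctx) :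
    (Δ.map fun c => (ρ c.1 c.2.otype).lower + 2).sum = ρ.weight Δ + 2 * Δ.length := by
  rw [List.sum_map_add, weight, List.map_const', List.sum_replicate, smul_eq_mul, mul_comm 2]

theorem occWeight_append (t : LTerm) (Γ Γ' : Ctx) :
    ρ.occWeight t (Γ ++ Γ') = ρ.occWeight t Γ + ρ.occWeight t Γ' := by
  simp only [occWeight, List.map_append, List.sum_append]

theorem occWeight_singleton (t : LTerm) (x : ℕ) (A : Formula) :
    ρ.occWeight t [(x, A)] = occ x t * (ρ x A.otype).lower :=
  List.sum_singleton

theorem occWeight_congr {ρ ρ' : PolyEnv} {t t' : LTerm} {Γ : Ctx}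
    (h : ∀ x ∈ Γ.names, occ x t = occ x t' ∧ ρ x = ρ' x) : ρ.occWeight t Γ = ρ'.occWeight t' Γ :=
  congrArg List.sum (List.map_congr_left fun c hc => by
    rw [(h _ (Ctx.mem_names hc)).1, (h _ (Ctx.mem_names hc)).2])

theorem occWeight_perm (t : LTerm) {Γ Γ' : Ctx} (h : Γ.Perm Γ') :
    ρ.occWeight t Γ = ρ.occWeight t Γ' :=
  (h.map _).sum_eq

theorem occWeight_app (t u : LTerm) (Γ : Ctx) :
    ρ.occWeight (.app t u) Γ = ρ.occWeight t Γ + ρ.occWeight u Γ := by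
  simp only [occWeight, ← List.sum_map_add, occ, add_mul]

theorem occWeight_abs {t : LTerm} {Γ : Ctx} {z : ℕ} (hz : z ∉ Γ.names) :
    ρ.occWeight (abs z t) Γ = ρ.occWeight t Γ :=
  occWeight_congr fun _ hx => ⟨occ_abs_of_ne (ne_of_mem_of_not_mem hx hz) t, rfl⟩

theorem occWeight_eq_zero {t : LTerm} {Γ : Ctx} (h : ∀ x ∈ Γ.names, x ∉ FV t) :
    ρ.occWeight t Γ = 0 :=
  List.sum_eq_zero fun n hn => by
    obtain ⟨c, hc, rfl⟩ := List.mem_map.1 hn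
    rw [not_not.1 (h _ (Ctx.mem_names hc)), zero_mul]

theorem weight_set {Δ : Ctx} {z : ℕ} (hz : z ∉ Δ.names) (σ : Ty) (q : Poly [] σ) :
    (ρ.set z σ q).weight Δ = ρ.weight Δ :=
  weight_congr fun _ hx => ρ.set_of_ne (ne_of_mem_of_not_mem hx hz) σ q

theorem occWeight_set (t : LTerm) {Γ : Ctx} {z : ℕ} (hz : z ∉ Γ.names) (σ : Ty) (q : Poly [] σ) :
    (ρ.set z σ q).occWeight t Γ = ρ.occWeight t Γ :=
  occWeight_congr fun _ hx => ⟨rfl, ρ.set_of_ne (ne_of_mem_of_not_mem hx hz) σ q⟩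

theorem occSum_args (t : LTerm) (Γ : Ctx) : occSum t Γ (ρ.args Γ) = ρ.occWeight t Γ := by
  induction Γ with
  | nil => rfl
  | cons c Γ ih =>
    rw [occWeight, List.map_cons, List.sum_cons, ← occWeight, ← ih]
    rfl

theorem addArgs_conv (Δ : Ctx) {τ : Ty} (p : Poly [] τ) :
    Poly.Conv (p.addArgs (ρ.args Δ)) (p.add (.nat (ρ.weight Δ))) := by
  induction Δ generalizing p with
  | nil => exact p.add_zero.symm
  | cons c Δ ih => exact (ih _).trans (Poly.add_add_conv_add_nat _ _ _ rfl)

end PolyEnv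

namespace Definable

variable {Γ Γ' : Ctx} {σ τ : Ty}

theorem congr {F : PolyEnv → Poly [] τ} (hF : Definable Γ τ F) {ρ ρ' : PolyEnv}
    (h : ∀ x ∈ Γ.names, ρ x = ρ' x) : F ρ = F ρ' := by
  obtain ⟨p, hp⟩ := hF
  rw [hp, hp, PolyEnv.args_congr h]

theorem cast {F : PolyEnv → Poly [] σ} (hF : Definable Γ σ F) (h : σ = τ) :
    Definable Γ τ fun ρ => (F ρ).cast h := by
  subst h
  exact hF

theorem exists_value_eq_weight_add (h : Γ' ⊆ Γ) (n : ℕ) :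
    ∃ F, Definable Γ .o F ∧ ∀ ρ, (F ρ).value = ρ.weight Γ' + n := by
  induction Γ' with
  | nil => exact ⟨_, nat n, fun _ => (Nat.zero_add n).symm⟩
  | cons c Γ' ih =>
    obtain ⟨hc, hΓ'⟩ := List.cons_subset.1 h
    obtain ⟨F, hF, hv⟩ := ih hΓ'
    refine ⟨_, (var hc).down.add hF, fun ρ => ?_⟩
    rw [PolyEnv.weight, List.map_cons, List.sum_cons, ← PolyEnv.weight, Nat.add_assoc, ← hv]
    rfl

end Definable

namespace Realizes

variable {A : Formula} {η : Valuation} {t u : LTerm} {σ : ℕ → LTerm} {l l' : List ℕ}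
  {p : Poly [] A.otype}

theorem bind_perm_append {θ' θ'' : List (LTerm × ℕ)} (hθ : θ'.Perm θ'') (θ : List (LTerm × ℕ))
    (hn : ((θ ++ θ').map Prod.snd).Nodup) (h : Realizes A η (t.bind (θ ++ θ')) p) :
    Realizes A η (t.bind (θ ++ θ'')) p := by
  induction hθ generalizing θ with
  | nil => exact h
  | cons a _ ih =>
    rw [List.append_cons] at hn h ⊢
    exact ih (θ ++ [a]) hn h
  | swap a b θ' => exact (h.bindStep (.exchange hn)).conv p.add_zero
  | trans h₁ _ ih₁ ih₂ =>
    exact ih₂ θ (((h₁.append_left θ).map Prod.snd).nodup_iff.1 hn) (ih₁ θ hn h)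

theorem perm (h : Realizes A η (t.bind (bindings σ l)) p) (hl : l.Perm l') (hn : l.Nodup) :
    Realizes A η (t.bind (bindings σ l')) p :=
  bind_perm_append (hl.map fun x => (σ x, x)) [] ((map_snd_bindings σ l).symm ▸ hn) h

theorem weaken {ι : Type*} {L : List ι} {f : ι → ℕ} {T : ι → ℕ}
    (h : Realizes A η (t.bind (bindings σ l)) p) (hn : (l ++ L.map f).Nodup)
    (hfv : ∀ i ∈ L, f i ∉ FV t) (hσ : ∀ i ∈ L, EvalBound (σ (f i)) (T i)) :
    Realizes A η (t.bind (bindings σ (l ++ L.map f)))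
      (p.add (.nat (L.map fun i => T i + 2).sum)) := by
  induction L generalizing l p with
  | nil => exact (List.append_nil l).symm ▸ h.add_nat 0
  | cons i L ih =>
    obtain ⟨hfv_i, hfv⟩ := List.forall_mem_cons.1 hfv
    obtain ⟨⟨heval, hTS⟩, hσ⟩ := List.forall_mem_cons.1 hσ
    rw [List.map_cons, List.append_cons] at hn ⊢
    have hstep : BindStep (t.bind (bindings σ l)) (t.bind (bindings σ (l ++ [f i])))
        (TS (σ (f i)) + 2) := by
      rw [bindings_append]
      refine .weakening ?_ hfv_i heval
      change ((bindings σ l ++ bindings σ [f i]).map Prod.snd).Nodup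
      rw [← bindings_append, map_snd_bindings]
      exact hn.of_append_left
    refine ((ih (h.bindStep hstep) hn hfv hσ).add_nat (T i - TS (σ (f i)))).conv ?_
    refine ((Poly.add_nat_add_nat _ _ _).add (.refl _)).trans
      (Poly.add_add_conv_add_nat _ _ _ ?_)
    rw [List.map_cons, List.sum_cons]
    change TS (σ (f i)) + 2 + _ + (T i - TS (σ (f i))) = _
    omega

theorem app_bindings (h : Realizes A η (.app (t.bind (bindings σ l)) (u.bind (bindings σ l'))) p)
    (ht : ∀ x ∈ FV t, x ∈ l) (hu : ∀ x ∈ FV u, x ∈ l') (hn : (l ++ l').Nodup) :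
    Realizes A η ((LTerm.app t u).bind (bindings σ (l ++ l'))) p := by
  have hdisj := List.disjoint_of_nodup_append hn
  rw [bindings_append]
  refine (h.bindStep (.concatenation ?_ ?_ ?_)).conv p.add_zero
  · rwa [← bindings_append, map_snd_bindings]
  · rw [map_snd_bindings]
    exact fun x hx hxu => hdisj hx (hu x hxu)
  · rw [map_snd_bindings]
    exact fun x hx hxt => hdisj (ht x hxt) hx

theorem app_abs {z : ℕ} (h : Realizes A η (t.bind (bindings (Function.update σ z u) (l ++ [z]))) p)
    (hz : z ∉ l) : Realizes A η (.app ((abs z t).bind (bindings σ l)) u) p := by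
  rw [bindings_append, bindings_congr fun x hx =>
    Function.update_of_ne (ne_of_mem_of_not_mem hx hz) u σ] at h
  rw [← bind_concat]
  simpa only [bindings, List.map_cons, List.map_nil, Function.update_self] using h

end Realizes

/-! ## Soundness of the typing rules -/

/-- The terms `σ x` and polynomials `ρ x` are realizers of `A` for every declaration `x : A` of the
context. -/
def RealizesAll (η : Valuation) (σ : ℕ → LTerm) (ρ : PolyEnv) (Γ : Ctx) : Prop :=
  ∀ c ∈ Γ, Realizes c.2 η (σ c.1) (ρ c.1 c.2.otype)

namespace RealizesAll

variable {η : Valuation} {σ σ' : ℕ → LTerm} {ρ ρ' : PolyEnv} {Γ Γ' Δ : Ctx} {t : LTerm} {z : ℕ}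

theorem mono (h : RealizesAll η σ ρ Γ) (hΓ : Γ' ⊆ Γ) : RealizesAll η σ ρ Γ' :=
  fun c hc => h c (hΓ hc)

theorem congr (h : RealizesAll η σ ρ Γ) (hσ : ∀ x ∈ Γ.names, σ' x = σ x)
    (hρ : ∀ x ∈ Γ.names, ρ' x = ρ x) : RealizesAll η σ' ρ' Γ := fun c hc => by
  rw [hσ _ (Ctx.mem_names hc), hρ _ (Ctx.mem_names hc)]
  exact h c hc

theorem rename {f : ℕ → ℕ} (h : RealizesAll η σ ρ Γ) (hΓ : ∀ c ∈ Γ', (f c.1, c.2) ∈ Γ) :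
    RealizesAll η (fun x => σ (f x)) (fun x => ρ (f x)) Γ' :=
  fun c hc => h _ (hΓ c hc)

theorem append (h : RealizesAll η σ ρ Γ) (h' : RealizesAll η σ ρ Γ') :
    RealizesAll η σ ρ (Γ ++ Γ') :=
  fun c hc => (List.mem_append.1 hc).elim (h c) (h' c)

theorem update (h : RealizesAll η σ ρ Γ) {A : Formula} {u : LTerm} {q : Poly [] A.otype}
    (hz : z ∉ Γ.names) (hu : Realizes A η u q) :
    RealizesAll η (Function.update σ z u) (ρ.set z A.otype q) (Γ ++ [(z, A)]) := by
  refine (h.congr (fun x hx => ?_) fun x hx => ?_).append fun c hc => ?_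
  · exact Function.update_of_ne (ne_of_mem_of_not_mem hx hz) _ _
  · exact PolyEnv.set_of_ne _ (ne_of_mem_of_not_mem hx hz) _ _
  · rw [List.mem_singleton.1 hc, Function.update_self, PolyEnv.set_self]
    exact hu

theorem evalBound_bind_abs (h : RealizesAll η σ ρ (Γ ++ Δ)) (hn : (Γ.names ++ Δ.names).Nodup)
    (hocc : ∀ x ∈ Δ.names, occ x (abs z t) ≤ 1) :
    EvalBound ((abs z t).bind (bindings σ (Γ.names ++ Δ.names)))
      (t.size + ρ.occWeight (abs z t) Γ + ρ.weight (Γ ++ Δ) +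
        (2 * (Γ ++ Δ).length + 1)) := by
  rw [← Ctx.names_append] at hn ⊢
  have hbind := LTerm.evalBound_bind_abs t z hn fun c hc => (h c hc).evalBound
  refine ⟨hbind.1, hbind.2.trans ?_⟩
  rw [List.sum_map_add, ρ.sum_lower_add_two, List.map_append, List.sum_append]
  have hΓ : (Γ.map fun c => (occ c.1 (abs z t) - 1) * (ρ c.1 c.2.otype).lower).sum ≤
      ρ.occWeight (abs z t) Γ :=
    List.sum_le_sum fun c _ => Nat.mul_le_mul_right _ (Nat.sub_le _ _)
  have hΔ : (Δ.map fun c => (occ c.1 (abs z t) - 1) * (ρ c.1 c.2.otype).lower).sum = 0 :=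
    List.sum_eq_zero fun n hm => by
      obtain ⟨c, hc, rfl⟩ := List.mem_map.1 hm
      rw [Nat.sub_eq_zero_of_le (hocc _ (Ctx.mem_names hc)), Nat.zero_mul]
  omega

end RealizesAll

theorem SameRealizers.trans {A B C : Formula} {η η' η'' : Valuation} (h : SameRealizers A η B η')
    (h' : SameRealizers B η' C η'') : SameRealizers A η C η'' := by
  obtain ⟨hAB, h⟩ := h
  obtain ⟨hBC, h'⟩ := h'
  exact ⟨hAB.trans hBC, fun t p =>
    (h t p).trans ((h' t _).trans (by rw [Poly.cast_cast]))⟩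

theorem sameRealizers_inst_mu {L : Formula} (hL : (Formula.mu L).WF) (η : Valuation) :
    SameRealizers (L.inst (.mu L)) η (.mu L) η :=
  (sameRealizers_inst L rfl η).trans (sameRealizers_mu hL.2.1.otype_eq hL.2.2 η)

/-- Adequacy of a judgment with a given polynomial `F`, presented as a map from assignments of
closed polynomials to the variables. -/
structure Interprets (Γ Δ : Ctx) (t : LTerm) (A : Formula) (F : PolyEnv → Poly [] A.otype) :
    Prop where
  definable : Definable Γ A.otype F
  realizes : ∀ {η σ ρ}, RealizesAll η σ ρ (Γ ++ Δ) →
    Realizes A η (t.bind (bindings σ (Γ.names ++ Δ.names))) ((F ρ).add (.nat (ρ.weight Δ)))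
  size_le : ∀ ρ, t.size + ρ.occWeight t Γ ≤ (F ρ).lower

theorem append_append_append_perm_comm {α : Type*} (a b c d : List α) :
    ((a ++ b) ++ (c ++ d)).Perm ((a ++ c) ++ (b ++ d)) :=
  Multiset.coe_eq_coe.1 (add_add_add_comm (a : Multiset α) b c d)

namespace WellFormed

variable {Γ₁ Γ₂ Δ₁ Δ₂ : Ctx} {t u : LTerm} {A B C : Formula}

theorem realizes_app (ht : WellFormed Γ₁ Δ₁ t A) (hu : WellFormed Γ₂ Δ₂ u B)
    (hn : (Ctx.names (Γ₁ ++ Γ₂ ++ (Δ₁ ++ Δ₂))).Nodup) {η : Valuation} {σ : ℕ → LTerm}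
    {p : Poly [] C.otype}
    (h : Realizes C η (.app (t.bind (bindings σ (Γ₁.names ++ Δ₁.names)))
      (u.bind (bindings σ (Γ₂.names ++ Δ₂.names)))) p) :
    Realizes C η ((LTerm.app t u).bind
      (bindings σ ((Γ₁ ++ Γ₂).names ++ (Δ₁ ++ Δ₂).names))) p := by
  have hperm : ((Γ₁.names ++ Δ₁.names) ++ (Γ₂.names ++ Δ₂.names)).Perm
      (Ctx.names (Γ₁ ++ Γ₂) ++ Ctx.names (Δ₁ ++ Δ₂)) := by
    simpa only [Ctx.names_append] using append_append_append_perm_comm _ _ _ _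
  rw [Ctx.names_append] at hn
  have hn' := hperm.nodup_iff.2 hn
  exact (h.app_bindings ht.mem_names hu.mem_names hn').perm hperm hn'

theorem occWeight_app (ht : WellFormed Γ₁ Δ₁ t A) (hu : WellFormed Γ₂ Δ₂ u B)
    (hn : (Ctx.names (Γ₁ ++ Γ₂ ++ (Δ₁ ++ Δ₂))).Nodup) (ρ : PolyEnv) :
    ρ.occWeight (.app t u) (Γ₁ ++ Γ₂) = ρ.occWeight t Γ₁ + ρ.occWeight u Γ₂ := by
  simp only [Ctx.names_append] at hn
  have ht₂ : ρ.occWeight t Γ₂ = 0 := ρ.occWeight_eq_zero fun x hx hxt => by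
    have := ht.mem_names x hxt
    grind
  have hu₁ : ρ.occWeight u Γ₁ = 0 := ρ.occWeight_eq_zero fun x hx hxu => by
    have := hu.mem_names x hxu
    grind
  rw [PolyEnv.occWeight_app, PolyEnv.occWeight_append, PolyEnv.occWeight_append, ht₂, hu₁,
    Nat.add_zero, Nat.zero_add]

end WellFormed

namespace Interprets

variable {Γ Γ₁ Γ₂ Δ Δ₁ Δ₂ : Ctx} {t u : LTerm} {A A' B L : Formula}
  {F : PolyEnv → Poly [] A.otype}

theorem var_left (x : ℕ) (A : Formula) :
    Interprets [(x, A)] [] (.var x) A fun ρ => (ρ x A.otype).add (.nat 3) where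
  definable := (Definable.var (List.mem_singleton_self (x, A))).add (.nat 3)
  realizes {_ σ _} h := ((h (x, A) (by grind)).bindStep (.identity (σ x) x)).add_nat 0
  size_le ρ := by
    rw [Poly.lower_add_nat, PolyEnv.occWeight_singleton]
    simp only [size, occ, if_true, one_mul]
    omega

theorem var_right (x : ℕ) (hL : L.otype = .o) :
    Interprets [] [(x, L)] (.var x) L fun _ => (Poly.zeroAt _).add (.nat 3) where
  definable := Definable.zeroAt.add (.nat 3)
  realizes {_ σ ρ} h := by
    refine ((h (x, L) (by grind)).bindStep (.identity (σ x) x)).conv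
      (Poly.conv_of_lower_eq hL ?_)
    rw [Poly.lower_add_nat, Poly.lower_add_nat, Poly.lower_add_nat, Poly.lower_zeroAt,
      PolyEnv.weight_singleton, Nat.zero_add, Nat.add_comm]
  size_le ρ := by
    rw [Poly.lower_add_nat]
    exact (by decide : 1 ≤ 3).trans (Nat.le_add_left _ _)

theorem cast (hF : Interprets Γ Δ t A F) (hA : A.otype = A'.otype)
    (h : ∀ η s p, (∀ η', (∀ c ∈ Γ ++ Δ, ∀ u q, Realizes c.2 η u q → Realizes c.2 η' u q) →
      Realizes A η' s p) → Realizes A' η s (p.cast hA)) :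
    Interprets Γ Δ t A' fun ρ => (F ρ).cast hA where
  definable := hF.definable.cast hA
  realizes hσ := by
    rw [Poly.add_cast]
    exact h _ _ _ fun η' hη => hF.realizes fun c hc => hη c hc _ _ (hσ c hc)
  size_le ρ := by
    rw [Poly.lower_cast]
    exact hF.size_le ρ

theorem exists_of_sameRealizers (hF : Interprets Γ Δ t A F)
    (h : ∀ η, SameRealizers A η A' η) : ∃ F', Interprets Γ Δ t A' F' :=
  ⟨_, hF.cast (h fun _ => topSat).choose fun η s p hA =>
    ((h η).choose_spec s p).1 (hA η fun _ _ _ _ hq => hq)⟩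

theorem exists_forallVar (hF : Interprets Γ Δ t A F) (α : ℕ)
    (hα : ∀ c ∈ Γ ++ Δ, ¬ Formula.Occurs α c.2) : ∃ F', Interprets Γ Δ t (A.forallVar α) F' := by
  have hren := fun η =>
    (sameRealizers_rename A (fun β => if β = α then 0 else β + 1) η).symm
  refine ⟨_, hF.cast (A' := A.forallVar α) (hren fun _ => topSat).choose fun η s p hA X => ?_⟩
  refine ((hren (η.push X)).choose_spec s p).1 (hA _ fun c hc u q hq => hq.mono fun β => ?_)
  by_cases hβ : β = α
  · subst hβ
    exact ⟨.inr (Formula.occursOnly_of_not_occurs (hα c hc) _),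
      .inr (Formula.occursOnly_of_not_occurs (hα c hc) _)⟩
  · rw [if_neg hβ]
    exact ⟨.inl subset_rfl, .inl subset_rfl⟩

theorem exists_inst (hF : Interprets Γ Δ t (.all A) F)
    (hL : L.otype = .o) : ∃ F', Interprets Γ Δ t (A.inst L) F' := by
  have hinst := fun η => (sameRealizers_inst A hL η).symm
  exact ⟨_, hF.cast (hinst fun _ => topSat).choose fun η s p hA =>
    ((hinst η).choose_spec s p).1 (hA η (fun _ _ _ _ hq => hq) _)⟩

theorem imp_app {F : PolyEnv → Poly [] (.arrow A.otype B.otype)} {G : PolyEnv → Poly [] A.otype}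
    (hF : Interprets Γ₁ Δ t (.imp A B) F) (hG : Interprets Γ₂ [] u A G)
    (ht : WellFormed Γ₁ Δ t (.imp A B)) (hu : WellFormed Γ₂ [] u A)
    (hn : (Ctx.names (Γ₁ ++ Γ₂ ++ Δ)).Nodup) :
    Interprets (Γ₁ ++ Γ₂) Δ (.app t u) B fun ρ => ((F ρ).app (G ρ)).add (G ρ).down := by
  rw [← Δ.append_nil] at hn
  have hΓ₁ : Γ₁ ⊆ Γ₁ ++ Γ₂ := List.subset_append_left _ _
  have hΓ₂ : Γ₂ ⊆ Γ₁ ++ Γ₂ := List.subset_append_right _ _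
  have hGΓ := hG.definable.mono hΓ₂
  have hFΓ : Definable (Γ₁ ++ Γ₂) (.arrow A.otype B.otype) F := hF.definable.mono hΓ₁
  refine ⟨(hFΓ.app hGΓ).add hGΓ.down, fun {η σ ρ} h => ?_, fun ρ => ?_⟩
  · have hfun := (realizes_imp.1 (hF.realizes (h.mono (by grind)))).2
    have harg := (hG.realizes (h.mono (Γ' := Γ₂ ++ []) (by grind))).conv (Poly.add_zero _)
    have happ := ((hfun _ _ harg).conv (Poly.app_add _ _ _)).add_nat (G ρ).lower
    rw [← Δ.append_nil]
    refine ht.realizes_app hu hn (happ.conv ((Poly.add_right_comm _ _ _).trans ?_))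
    rw [Δ.append_nil]
    exact .add (Poly.add_conv_add_nat _ _).symm (.refl _)
  · rw [ht.occWeight_app hu hn, Poly.lower_add, size]
    have hle : t.size + ρ.occWeight t Γ₁ ≤ ((F ρ).app (G ρ)).lower :=
      (hF.size_le ρ).trans (Poly.lower_le_lower_app _ _)
    have := hG.size_le ρ
    change _ ≤ _ + (G ρ).lower
    omega

theorem lolli_app {F : PolyEnv → Poly [] B.otype} {G : PolyEnv → Poly [] L.otype}
    (hF : Interprets Γ₁ Δ₁ t (.lolli L B) F) (hG : Interprets Γ₂ Δ₂ u L G)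
    (ht : WellFormed Γ₁ Δ₁ t (.lolli L B)) (hu : WellFormed Γ₂ Δ₂ u L)
    (hn : (Ctx.names (Γ₁ ++ Γ₂ ++ (Δ₁ ++ Δ₂))).Nodup) :
    Interprets (Γ₁ ++ Γ₂) (Δ₁ ++ Δ₂) (.app t u) B fun ρ => (F ρ).add (G ρ).down := by
  have hFΓ : Definable (Γ₁ ++ Γ₂) B.otype F := hF.definable.mono (List.subset_append_left _ _)
  have hGΓ := hG.definable.mono (List.subset_append_right Γ₁ Γ₂)
  refine ⟨hFΓ.add hGΓ.down, fun {η σ ρ} h => ht.realizes_app hu hn ?_, fun ρ => ?_⟩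
  · have hfun := (realizes_lolli.1 (hF.realizes (h.mono (by grind)))).2
    refine (hfun _ _ (hG.realizes (h.mono (by grind)))).conv ?_
    refine (Poly.add_add_conv_add_nat _ _ _ rfl).trans
      (Poly.add_add_conv_add_nat _ _ _ ?_).symm
    change (G ρ).lower + ρ.weight (Δ₁ ++ Δ₂) = ρ.weight Δ₁ + ((G ρ).add (.nat _)).lower
    rw [Poly.lower_add_nat, PolyEnv.weight_append]
    omega
  · rw [ht.occWeight_app hu hn, Poly.lower_add, size]
    have hle : t.size + ρ.occWeight t Γ₁ ≤ (F ρ).lower := hF.size_le ρ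
    have := hG.size_le ρ
    change _ ≤ _ + (G ρ).lower
    omega

end Interprets

theorem RealizesAll.evalBound_bind_abs_of_le {Γ Δ : Ctx} {t : LTerm} {z : ℕ} {τ : Ty}
    {η : Valuation} {σ : ℕ → LTerm} {ρ : PolyEnv} {G : Poly [] τ} {P : Poly [] .o}
    (h : RealizesAll η σ ρ (Γ ++ Δ)) (hn : (Γ.names ++ Δ.names).Nodup)
    (hocc : ∀ x ∈ Δ.names, occ x (abs z t) ≤ 1)
    (hG : t.size + ρ.occWeight (abs z t) Γ ≤ G.lower)
    (hP : P.value = ρ.weight Γ + (2 * (Γ ++ Δ).length + 1)) :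
    EvalBound ((abs z t).bind (bindings σ (Γ.names ++ Δ.names)))
      ((G.add P).add (.nat (ρ.weight Δ))).lower := by
  obtain ⟨heval, hTS⟩ := h.evalBound_bind_abs hn hocc
  refine ⟨heval, hTS.trans ?_⟩
  rw [Poly.lower_add_nat, Poly.lower_add, hP, PolyEnv.weight_append]
  omega

theorem Poly.size_abs_add_le_lower {t : LTerm} {z k : ℕ} {τ : Ty} {G : Poly [] τ} {P : Poly [] .o}
    (hG : t.size + k ≤ G.lower) (hP : 1 ≤ P.value) :
    (abs z t).size + k ≤ (G.add P).lower := by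
  rw [Poly.lower_add, size_abs]
  omega

namespace Interprets

variable {Γ Δ : Ctx} {t : LTerm} {A B L : Formula} {z : ℕ}
  {F : PolyEnv → Poly [] B.otype}

theorem size_le_of_forall_conv_app {G : PolyEnv → Poly [] (.arrow A.otype B.otype)}
    (hF : Interprets (Γ ++ [(z, A)]) Δ t B F) (hz : z ∉ Γ.names)
    (hG : ∀ ρ q, Poly.Conv ((G ρ).app q) (F (ρ.set z A.otype q))) (ρ : PolyEnv) :
    t.size + ρ.occWeight (abs z t) Γ ≤ (G ρ).lower := by
  have hsize := hF.size_le (ρ.set z A.otype (.zeroAt _))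
  rw [PolyEnv.occWeight_append, ρ.occWeight_set t hz, ← (hG ρ _).lower_eq] at hsize
  rw [ρ.occWeight_abs hz]
  exact (Nat.add_le_add_left (Nat.le_add_right _ _) _).trans hsize

theorem exists_abs_imp (hF : Interprets (Γ ++ [(z, A)]) Δ t B F)
    (ht : WellFormed (Γ ++ [(z, A)]) Δ t B) :
    ∃ G, Interprets Γ Δ (abs z t) (.imp A B) G := by
  have habs := ht.abs_left
  have hn := ht.nodup
  rw [Ctx.names_append, Ctx.names_cons, Ctx.names_nil] at hn
  have hz : z ∉ Γ.names ++ Δ.names := by grind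
  have hzΓ : z ∉ Γ.names := fun h => hz (List.mem_append_left _ h)
  have hzΔ : z ∉ Δ.names := fun h => hz (List.mem_append_right _ h)
  obtain ⟨G, hG, hGF⟩ := (hF.definable.mono (Γ' := (z, A) :: Γ) (by grind)).lam hzΓ
  obtain ⟨P, hP, hPv⟩ := Definable.exists_value_eq_weight_add (List.Subset.refl Γ)
    (2 * (Γ ++ Δ).length + 1)
  have hsize := hF.size_le_of_forall_conv_app hzΓ hGF
  refine ⟨fun ρ => (G ρ).add (P ρ), hG.add hP, fun {η σ ρ} h => realizes_imp.2
    ⟨h.evalBound_bind_abs_of_le habs.nodup habs.occ_le (hsize ρ) (hPv ρ), fun u q hu => ?_⟩,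
    fun ρ => Poly.size_abs_add_le_lower (hsize ρ) (by grind)⟩
  have hbody := hF.realizes ((h.update (by rwa [Ctx.names_append]) hu).mono (by grind))
  have hperm : (Ctx.names (Γ ++ [(z, A)]) ++ Δ.names).Perm (Γ.names ++ Δ.names ++ [z]) := by
    rw [Ctx.names_append, List.append_assoc, List.append_assoc]
    exact List.perm_append_comm.append_left _
  rw [ρ.weight_set hzΔ] at hbody
  refine (((hbody.perm hperm ht.nodup).app_abs hz).add_nat (P ρ).value).conv ?_
  refine (Poly.add_right_comm _ _ _).trans (.trans (.add ?_ (.refl _)) (Poly.app_add _ _ _).symm)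
  exact (((hGF ρ q).symm.add (.refl _)).trans (Poly.add_conv_add_nat _ _).symm).trans
    (Poly.app_add _ _ _).symm

theorem exists_abs_lolli (hF : Interprets Γ (Δ ++ [(z, L)]) t B F)
    (ht : WellFormed Γ (Δ ++ [(z, L)]) t B) :
    ∃ G, Interprets Γ Δ (abs z t) (.lolli L B) G := by
  have habs := ht.abs_right
  have hn := ht.nodup
  rw [Ctx.names_append, Ctx.names_cons, Ctx.names_nil, ← List.append_assoc] at hn
  have hz : z ∉ Γ.names ++ Δ.names := by grind
  have hzΓ : z ∉ Γ.names := fun h => hz (List.mem_append_left _ h)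
  have hzΔ : z ∉ Δ.names := fun h => hz (List.mem_append_right _ h)
  obtain ⟨P, hP, hPv⟩ := Definable.exists_value_eq_weight_add (List.Subset.refl Γ)
    (2 * (Γ ++ Δ).length + 1)
  have hsize : ∀ ρ, t.size + ρ.occWeight (abs z t) Γ ≤ (F ρ).lower := fun ρ => by
    rw [ρ.occWeight_abs hzΓ]
    exact hF.size_le ρ
  refine ⟨fun ρ => (F ρ).add (P ρ), hF.definable.add hP, fun {η σ ρ} h => realizes_lolli.2
    ⟨h.evalBound_bind_abs_of_le habs.nodup habs.occ_le (hsize ρ) (hPv ρ), fun u m hu => ?_⟩,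
    fun ρ => Poly.size_abs_add_le_lower (hsize ρ) (by grind)⟩
  have hbody := hF.realizes ((h.update (by rwa [Ctx.names_append]) hu).mono (by grind))
  rw [PolyEnv.weight_append, ρ.weight_set hzΔ, PolyEnv.weight_singleton, PolyEnv.set_self,
    hF.definable.congr fun x hx => ρ.set_of_ne (ne_of_mem_of_not_mem hx hzΓ) _ _,
    Ctx.names_append, Ctx.names_cons, Ctx.names_nil, ← List.append_assoc] at hbody
  refine ((hbody.app_abs hz).add_nat (P ρ).value).conv ?_
  refine ((Poly.add_right_comm _ _ _).trans (.add (Poly.add_conv_add_nat _ _).symm (.refl _))).trans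
    (Poly.add_add_conv_add_nat _ (.nat (ρ.weight Δ)) m.down rfl).symm

end Interprets

/-- The renaming that identifies `x` and `y` with `z`, as performed by `LTerm.contract`. -/
def contractRen (z x y w : ℕ) : ℕ := if w = x ∨ w = y then z else w

section contractRen

variable {x y z w : ℕ}

theorem contractRen_left (z x y : ℕ) : contractRen z x y x = z := if_pos (.inl rfl)

theorem contractRen_right (z x y : ℕ) : contractRen z x y y = z := if_pos (.inr rfl)

theorem contractRen_of_ne (hx : w ≠ x) (hy : w ≠ y) : contractRen z x y w = w :=
  if_neg (not_or.2 ⟨hx, hy⟩)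

theorem Ctx.contractRen_mem {Γ : Ctx} {A : Formula} (hx : x ∉ Γ.names) (hy : y ∉ Γ.names) :
    ∀ c ∈ Γ ++ [(x, A), (y, A)], (contractRen z x y c.1, c.2) ∈ Γ ++ [(z, A)] := by
  intro c hc
  have := Ctx.mem_names (c := c) (Γ := Γ)
  grind [contractRen]

theorem Realizes.contract {B : Formula} {η : Valuation} {t : LTerm} {σ : ℕ → LTerm} {l : List ℕ}
    {p : Poly [] B.otype}
    (h : Realizes B η (t.bind (bindings (fun w => σ (contractRen z x y w)) (l ++ [x, y]))) p)
    (hn : (l ++ [x, y]).Nodup) (hz : z ∉ l) (hzt : z ∈ FV t → z = x ∨ z = y) :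
    Realizes B η ((t.contract z x y).bind (bindings σ (l ++ [z]))) p := by
  have hσ : bindings (fun w => σ (contractRen z x y w)) (l ++ [x, y]) =
      bindings σ l ++ [(σ z, x), (σ z, y)] := by
    rw [bindings_append, bindings_congr (σ' := σ) fun w hw => by
      rw [contractRen_of_ne (by grind) (by grind)]]
    simp only [bindings, List.map_cons, List.map_nil, contractRen_left, contractRen_right]
  rw [hσ] at h
  rw [bindings_append]
  refine (h.bindStep (.contraction ?_ ?_ hzt)).conv p.add_zero
  · rw [← hσ, map_snd_bindings]
    exact hn
  · rwa [map_snd_bindings]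

theorem PolyEnv.occWeight_contract (ρ : PolyEnv) {Γ : Ctx} {A : Formula} {t : LTerm}
    (hn : (Γ.names ++ [x, y]).Nodup) (hz : z ∉ Γ.names) (hzt : z ∈ FV t → z = x ∨ z = y) :
    ρ.occWeight (t.contract z x y) (Γ ++ [(z, A)]) =
      occWeight (fun w => ρ (contractRen z x y w)) t (Γ ++ [(x, A), (y, A)]) := by
  have hΓ : ρ.occWeight (t.contract z x y) Γ =
      occWeight (fun w => ρ (contractRen z x y w)) t Γ :=
    occWeight_congr fun w hw => ⟨occ_contract_of_ne t (by grind) (by grind) (by grind), by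
      rw [contractRen_of_ne (by grind) (by grind)]⟩
  rw [occWeight_append, occWeight_append, hΓ, occWeight_singleton,
    occ_contract (by grind) hzt, add_mul]
  simp only [occWeight, List.map_cons, List.map_nil, List.sum_cons, List.sum_nil, contractRen_left,
    contractRen_right, Nat.add_zero]

end contractRen

namespace Interprets

variable {Γ Γ' Δ Δ' : Ctx} {t : LTerm} {A B L : Formula} {x y z : ℕ}
  {F : PolyEnv → Poly [] B.otype}

theorem contract (hF : Interprets (Γ ++ [(x, A), (y, A)]) Δ t B F)
    (ht : WellFormed (Γ ++ [(x, A), (y, A)]) Δ t B) (hz : z ∉ Ctx.names (Γ ++ Δ)) :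
    Interprets (Γ ++ [(z, A)]) Δ (t.contract z x y) B
      fun ρ => F fun w => ρ (contractRen z x y w) := by
  have hperm₂ : (Ctx.names (Γ ++ [(x, A), (y, A)]) ++ Δ.names).Perm
      (Γ.names ++ Δ.names ++ [x, y]) := by
    rw [Ctx.names_append, List.append_assoc, List.append_assoc]
    exact List.perm_append_comm.append_left _
  have hperm₁ : (Γ.names ++ Δ.names ++ [z]).Perm (Ctx.names (Γ ++ [(z, A)]) ++ Δ.names) := by
    rw [Ctx.names_append, List.append_assoc, List.append_assoc]
    exact List.perm_append_comm.append_left _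
  have hn := hperm₂.nodup_iff.1 ht.nodup
  rw [Ctx.names_append] at hz
  have hzt : z ∈ FV t → z = x ∨ z = y := fun hzt => by
    have := hperm₂.mem_iff.1 (ht.mem_names z hzt)
    grind
  have hxΓ : ∀ w ∈ Γ.names ++ Δ.names, w ≠ x ∧ w ≠ y := by grind
  have hmem := Ctx.contractRen_mem (A := A) (z := z) (Γ := Γ) (x := x) (y := y) (by grind)
    (by grind)
  refine ⟨hF.definable.rename _ hmem, fun {η σ ρ} h => ?_, fun ρ => ?_⟩
  · have hbody := hF.realizes (h.rename (f := contractRen z x y) fun c hc => ?_)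
    · rw [PolyEnv.weight_congr (ρ' := ρ) fun w hw => by
        obtain ⟨hwx, hwy⟩ := hxΓ w (List.mem_append_right _ hw)
        rw [contractRen_of_ne hwx hwy]] at hbody
      exact ((hbody.perm hperm₂ ht.nodup).contract hn hz hzt).perm hperm₁ (by grind)
    · rcases List.mem_append.1 hc with hc | hc
      · exact List.mem_append_left _ (hmem c hc)
      · obtain ⟨hcx, hcy⟩ := hxΓ c.1 (List.mem_append_right _ (Ctx.mem_names hc))
        rw [contractRen_of_ne hcx hcy]
        exact List.mem_append_right _ hc
  · rw [ρ.occWeight_contract (by grind) (by grind) hzt, size_contract]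
    exact hF.size_le _

theorem derelict (hF : Interprets Γ (Δ ++ [(x, L)]) t B F)
    (ht : WellFormed Γ (Δ ++ [(x, L)]) t B) :
    Interprets (Γ ++ [(x, L)]) Δ t B fun ρ => (F ρ).add (ρ x L.otype).down := by
  have hperm : (Γ.names ++ (Δ ++ [(x, L)]).names).Perm
      (Ctx.names (Γ ++ [(x, L)]) ++ Δ.names) := by
    rw [Ctx.names_append, Ctx.names_append, List.append_assoc]
    exact List.perm_append_comm.append_left _
  refine ⟨(hF.definable.mono (List.subset_append_left _ _)).add
    (Definable.var (c := (x, L)) (by grind)).down, fun {η σ ρ} h => ?_, fun ρ => ?_⟩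
  · have hbody := hF.realizes (h.mono (Γ' := Γ ++ (Δ ++ [(x, L)])) (by grind))
    refine (hbody.perm hperm ht.nodup).conv (Poly.add_add_conv_add_nat _ _ _ ?_).symm
    rw [PolyEnv.weight_append, PolyEnv.weight_singleton, Nat.add_comm]
    rfl
  · rw [Poly.lower_add, PolyEnv.occWeight_append, PolyEnv.occWeight_singleton, ← Nat.add_assoc]
    have hocc : occ x t ≤ 1 := ht.occ_le x (by grind [Ctx.names_append, Ctx.names_cons])
    exact Nat.add_le_add (hF.size_le ρ) ((Nat.mul_le_mul_right _ hocc).trans_eq (Nat.one_mul _))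

theorem exists_weaken (hF : Interprets Γ Δ t B F) (ht : WellFormed Γ Δ t B)
    (hn : (Ctx.names (Γ ++ Γ' ++ (Δ ++ Δ'))).Nodup) :
    ∃ G, Interprets (Γ ++ Γ') (Δ ++ Δ') t B G := by
  have hperm : (Γ.names ++ Δ.names ++ (Γ' ++ Δ').names).Perm
      (Ctx.names (Γ ++ Γ') ++ Ctx.names (Δ ++ Δ')) := by
    simpa only [Ctx.names_append] using append_append_append_perm_comm _ _ _ _
  rw [Ctx.names_append] at hn
  have hn' := hperm.nodup_iff.2 hn
  have hfv : ∀ x ∈ (Γ' ++ Δ').names, x ∉ FV t := fun x hx hxt =>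
    List.disjoint_of_nodup_append hn' (ht.mem_names x hxt) hx
  obtain ⟨P, hP, hPv⟩ := Definable.exists_value_eq_weight_add
    (List.subset_append_right Γ Γ') (2 * (Γ' ++ Δ').length)
  refine ⟨fun ρ => (F ρ).add (P ρ), (hF.definable.mono (List.subset_append_left _ _)).add hP,
    fun {η σ ρ} h => ?_, fun ρ => ?_⟩
  · have hbody := (hF.realizes (h.mono (by grind))).weaken (L := Γ' ++ Δ') hn'
      (fun c hc => hfv _ (Ctx.mem_names hc)) fun c hc => (h c (by grind)).evalBound
    refine (hbody.perm hperm hn').conv ((Poly.add_nat_add_nat _ _ _).trans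
      (Poly.add_add_conv_add_nat _ _ _ ?_).symm)
    change (P ρ).value + ρ.weight (Δ ++ Δ') = _
    rw [hPv, ρ.sum_lower_add_two, PolyEnv.weight_append, PolyEnv.weight_append]
    omega
  · rw [Poly.lower_add, PolyEnv.occWeight_append, ρ.occWeight_eq_zero (Γ := Γ') fun x hx =>
      hfv x (by grind [Ctx.names_append])]
    exact (hF.size_le ρ).trans (Nat.le_add_right _ _)

theorem perm (hF : Interprets Γ Δ t B F) (ht : WellFormed Γ Δ t B) (hΓ : Γ.Perm Γ')
    (hΔ : Δ.Perm Δ') : Interprets Γ' Δ' t B F where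
  definable := hF.definable.mono hΓ.subset
  realizes {_ _ ρ} h := by
    rw [← ρ.weight_perm hΔ]
    exact (hF.realizes (h.mono (hΓ.append hΔ).subset)).perm
      ((hΓ.map Prod.fst).append (hΔ.map Prod.fst)) ht.nodup
  size_le ρ := by
    rw [← ρ.occWeight_perm t hΓ]
    exact hF.size_le ρ

end Interprets

theorem Derivable.exists_interprets {Γ Δ : Ctx} {t : LTerm} {A : Formula}
    (h : Derivable Γ Δ t A) : ∃ F, Interprets Γ Δ t A F := by
  induction h with
  | ax1 x A _ => exact ⟨_, .var_left x A⟩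
  | ax2 x L hL => exact ⟨_, .var_right x hL.otype_eq⟩
  | mu_e ht ih =>
    obtain ⟨F, hF⟩ := ih
    exact hF.exists_of_sameRealizers fun η => (sameRealizers_inst_mu ht.wellFormed.wf η).symm
  | mu_i hL _ ih =>
    obtain ⟨F, hF⟩ := ih
    exact hF.exists_of_sameRealizers (sameRealizers_inst_mu hL)
  | all_i α _ hα ih =>
    obtain ⟨F, hF⟩ := ih
    exact hF.exists_forallVar α hα
  | all_e _ hL ih =>
    obtain ⟨F, hF⟩ := ih
    exact hF.exists_inst hL.otype_eq
  | imp_e ht hu hn iht ihu =>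
    obtain ⟨F, hF⟩ := iht
    obtain ⟨G, hG⟩ := ihu
    exact ⟨_, hF.imp_app hG ht.wellFormed hu.wellFormed hn⟩
  | lolli_e ht hu hn iht ihu =>
    obtain ⟨F, hF⟩ := iht
    obtain ⟨G, hG⟩ := ihu
    exact ⟨_, hF.lolli_app hG ht.wellFormed hu.wellFormed hn⟩
  | imp_i ht ih =>
    obtain ⟨F, hF⟩ := ih
    exact hF.exists_abs_imp ht.wellFormed
  | lolli_i ht ih =>
    obtain ⟨F, hF⟩ := ih
    exact hF.exists_abs_lolli ht.wellFormed
  | contr ht hz ih =>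
    obtain ⟨F, hF⟩ := ih
    exact ⟨_, hF.contract ht.wellFormed hz⟩
  | derel ht ih =>
    obtain ⟨F, hF⟩ := ih
    exact ⟨_, hF.derelict ht.wellFormed⟩
  | weak ht _ _ hn ih =>
    obtain ⟨F, hF⟩ := ih
    exact hF.exists_weaken ht.wellFormed hn
  | perm ht hΓ hΔ ih =>
    obtain ⟨F, hF⟩ := ih
    exact ⟨F, hF.perm ht.wellFormed hΓ hΔ⟩

namespace RealizesCtx

variable {η : Valuation} {Γ Δ : Ctx} {us ss : List LTerm}

theorem exists_assignment {qs : Args Γ.otypes} (h : RealizesCtx η Γ us qs) (hn : Γ.names.Nodup)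
    (σ : ℕ → LTerm) (ρ : PolyEnv) :
    ∃ σ', (∀ x ∉ Γ.names, σ' x = σ x) ∧ RealizesAll η σ' (ρ.ofArgs Γ qs) Γ ∧
      us.zip Γ.names = bindings σ' Γ.names := by
  induction Γ generalizing us with
  | nil => exact ⟨σ, fun _ _ => rfl, nofun, List.zip_nil_right⟩
  | cons c Γ ih =>
    cases us with
    | nil => exact h.elim
    | cons u us =>
      rw [Ctx.names_cons, List.nodup_cons] at hn
      obtain ⟨σ', hσ', hΓ, hus⟩ := ih h.2 hn.2
      have hne : ∀ x ∈ Ctx.names Γ, x ≠ c.1 := fun x hx => ne_of_mem_of_not_mem hx hn.1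
      refine ⟨Function.update σ' c.1 u, fun x hx => ?_, ?_, ?_⟩
      · rw [Ctx.names_cons, List.mem_cons, not_or] at hx
        rw [Function.update_of_ne hx.1, hσ' x hx.2]
      · exact (hΓ.update hn.1 h.1).mono (List.perm_append_singleton c Γ).symm.subset
      · rw [Ctx.names_cons, List.zip_cons_cons, hus,
          bindings_congr fun x hx => (Function.update_of_ne (hne x hx) u σ').symm]
        simp only [bindings, List.map_cons, Function.update_self]

theorem exists_assignment_append {qs : Args Γ.otypes} {ms : Args Δ.otypes}
    (hΓ : RealizesCtx η Γ us qs) (hΔ : RealizesCtx η Δ ss ms)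
    (hn : (Γ.names ++ Δ.names).Nodup) :
    ∃ σ ρ, RealizesAll η σ ρ (Γ ++ Δ) ∧ ρ.args Γ = qs ∧ ρ.args Δ = ms ∧
      us.zip Γ.names ++ ss.zip Δ.names = bindings σ (Γ.names ++ Δ.names) := by
  obtain ⟨hnΓ, hnΔ, hdisj⟩ := List.nodup_append'.1 hn
  let ρΔ := PolyEnv.ofArgs (fun _ τ => .zeroAt τ) Δ ms
  obtain ⟨σΔ, -, hallΔ, hss⟩ := hΔ.exists_assignment hnΔ .var fun _ τ => .zeroAt τ
  obtain ⟨σ, hσ, hallΓ, hus⟩ := hΓ.exists_assignment hnΓ σΔ ρΔ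
  have hσΔ : ∀ x ∈ Δ.names, σ x = σΔ x := fun x hx => hσ x (hdisj.symm hx)
  have hρΔ : ∀ x ∈ Δ.names, ρΔ.ofArgs Γ qs x = ρΔ x := fun x hx =>
    ρΔ.ofArgs_of_notMem qs (hdisj.symm hx)
  refine ⟨σ, ρΔ.ofArgs Γ qs, hallΓ.append (hallΔ.congr hσΔ hρΔ), ρΔ.args_ofArgs qs hnΓ, ?_, ?_⟩
  · exact (PolyEnv.args_congr hρΔ).trans (PolyEnv.args_ofArgs _ ms hnΔ)
  · rw [hus, hss, bindings_append, bindings_congr hσΔ]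

end RealizesCtx

end DIAL

theorem theorem3 (Γ Δ : DIAL.Ctx) (t : DIAL.LTerm) (A : DIAL.Formula)
    (h : DIAL.Derivable Γ Δ t A) :
    ∃ p : DIAL.Poly Γ.otypes A.otype,
      (∀ (η : DIAL.Valuation) (us ss : List DIAL.LTerm)
        (qs : DIAL.Args Γ.otypes) (ms : DIAL.Args Δ.otypes),
        DIAL.RealizesCtx η Γ us qs → DIAL.RealizesCtx η Δ ss ms →
        DIAL.Realizes A η (t.bind (us.zip Γ.names ++ ss.zip Δ.names))
          ((p.eval qs).addArgs ms)) ∧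
      ∀ qs : DIAL.Args Γ.otypes, t.size + DIAL.occSum t Γ qs ≤ (p.eval qs).lower := by
  obtain ⟨F, hF⟩ := h.exists_interprets
  obtain ⟨p, hp⟩ := hF.definable
  have hn := h.wellFormed.nodup
  refine ⟨p, fun η us ss qs ms hus hss => ?_, fun qs => ?_⟩
  · obtain ⟨σ, ρ, hall, rfl, rfl, hbind⟩ := hus.exists_assignment_append hss hn
    rw [hbind, ← hp]
    exact (hF.realizes hall).conv (ρ.addArgs_conv Δ (F ρ)).symm
  · let ρ := DIAL.PolyEnv.ofArgs (fun _ τ => .zeroAt τ) Γ qs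
    have hargs : ρ.args Γ = qs := DIAL.PolyEnv.args_ofArgs _ qs (List.nodup_append.1 hn).1
    rw [← hargs, ρ.occSum_args, ← hp]
    exact hF.size_le ρ
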